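/- Let $(M,g)$ be a compact Riemannian manifold of dimension $m$ (smooth, without boundary) with Riemannian measure $v_g$, let $(N,h)$ be a smooth Riemannian manifold, and let $\nabla$, $\nabla^N$ be their Levi-Civita connections. For a smooth map $\varphi:M\to N$ let $\overline\nabla$ be the connection induced on $\varphi^{-1}TN$, let $d$ and $\delta$ be the exterior derivative and the codifferential on $\varphi^{-1}TN$-valued differential forms defined by the induced connections, and let $\{e_i\}_{i=1}^m$ be local orthonormal frames on $M$. Put $$\tau(\varphi)=\sum_{i=1}^m\{\overline\nabla_{e_i}(d\varphi(e_i))-d\varphi(\nabla_{e_i}e_i)\},\qquad \overline\Delta V=-\sum_{i=1}^m\{\overline\nabla_{e_i}\overline\nabla_{e_i}V-\overline\nabla_{\nabla_{e_i}e_i}V\},$$ $$J(V)=\overline\Delta V-\sum_{i=1}^m R^N(V,d\varphi(e_i))d\varphi(e_i),\qquad R^N(X,Y)=\nabla^N_X\nabla^N_Y-\nabla^N_Y\nabla^N_X-\nabla^N_{[X,Y]},$$ for $V\in\Gamma(\varphi^{-1}TN)$, and let the trienergy be $$E_3(\varphi)=\frac12\int_M|(d+\delta)(d+\delta)(d+\delta)\varphi|^2\,v_g,\qquad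 (d+\delta)\varphi:=d\varphi .$$ Let $\varphi_t$ $(-\epsilon<t<\epsilon)$ be a smooth variation of $\varphi=\varphi_0$, that is, $(t,x)\mapsto\varphi_t(x)$ is a smooth map $(-\epsilon,\epsilon)\times M\to N$, with variation vector field $V(x)=\frac{d}{dt}\big|_{t=0}\varphi_t(x)$. Then all integrands above and below are integrable (for every $\varphi_t$ in the case of $E_3$), $E_3(\varphi_t)=\frac12\int_M|\overline\nabla\tau(\varphi_t)|^2\,v_g$ for every $t\in(-\epsilon,\epsilon)$, where $|\overline\nabla W|^2=\sum_i|\overline\nabla_{e_i}W|^2$, the function $t\mapsto E_3(\varphi_t)$ is differentiable at $t=0$, and $$\frac{d}{dt}\Big|_{t=0}E_3(\varphi_t)=-\int_M\langle\tau_3(\varphi),V\rangle\,v_g,\qquad \tau_3(\varphi)=J(\overline\Delta(\tau(\varphi)))-\sum_{i=1}^m R^N(\overline\nabla_{e_i}\tau(\varphi),\tau(\varphi))\,d\varphi(e_i).$$ -/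

import Mathlib

open Bundle Set MeasureTheory
open scoped Manifold ContDiff

noncomputable section

namespace Riem

/-- The standard Euclidean model space of dimension `k`. -/
abbrev Model (k : ℕ) : Type := EuclideanSpace ℝ (Fin k)

section Tangent

variable {k : ℕ} {N : Type*} [TopologicalSpace N] [ChartedSpace (Model k) N]

instance finiteDimensionalTangentSpace (q : N) : FiniteDimensional ℝ (TangentSpace (𝓡 k) q) :=
  inferInstanceAs (FiniteDimensional ℝ (Model k))

/-- The extension of a tangent vector `u` at `q` to the vector field around `q` which has constant
coefficients in the preferred chart at `q`. -/
def constField [IsManifold (𝓡 k) ∞ N] {q : N} (u : TangentSpace (𝓡 k) q) (q' : N) :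
    TangentSpace (𝓡 k) q' :=
  FiberBundle.extend (Model k) (E := fun p : N ↦ TangentSpace (𝓡 k) p) u q'

variable [RiemannianBundle (fun q : N ↦ TangentSpace (𝓡 k) q)]

variable (k) in
/-- An orthonormal basis `e₁, …, e_k` of the tangent space at `q`. -/
def onb (q : N) :
    OrthonormalBasis (Fin (Module.finrank ℝ (TangentSpace (𝓡 k) q))) ℝ (TangentSpace (𝓡 k) q) :=
  stdOrthonormalBasis ℝ (TangentSpace (𝓡 k) q)

variable [IsManifold (𝓡 k) ∞ N]

/-- The Christoffel symbols of the first kind at `q` in the preferred chart at `q`, i.e.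
`½ (u⟨∂_v, ∂_w⟩ + v⟨∂_u, ∂_w⟩ - w⟨∂_u, ∂_v⟩)`, where `∂_u`, `∂_v`, `∂_w` are the vector fields
with constant coefficients `u`, `v`, `w` in that chart. -/
def christoffelFirst (q : N) (u v w : TangentSpace (𝓡 k) q) : ℝ :=
  (1 / 2) * (mvfderiv (𝓡 k) (fun q' : N ↦ inner ℝ (constField v q') (constField w q')) q u
    + mvfderiv (𝓡 k) (fun q' : N ↦ inner ℝ (constField u q') (constField w q')) q v
    - mvfderiv (𝓡 k) (fun q' : N ↦ inner ℝ (constField u q') (constField v q')) q w)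

/-- The Christoffel symbols of the second kind at `q` in the preferred chart at `q`: the vector
`Γ(u, v)` with `⟨Γ(u, v), w⟩ = christoffelFirst q u v w` for all `w`. -/
def christoffel (q : N) (u v : TangentSpace (𝓡 k) q) : TangentSpace (𝓡 k) q :=
  ∑ i, christoffelFirst q u v (onb k q i) • onb k q i

end Tangent

section Along

variable {m n : ℕ}
  {M : Type*} [TopologicalSpace M] [ChartedSpace (Model m) M]
  {N : Type*} [TopologicalSpace N] [ChartedSpace (Model n) N] [IsManifold (𝓡 n) ∞ N]
  [RiemannianBundle (fun q : N ↦ TangentSpace (𝓡 n) q)]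

variable (m n) in
/-- The connection `∇̄` induced on `φ⁻¹TN` by the Levi-Civita connection of `N`:
`covAlong m n φ W x X` is `∇̄_X W` at `x`, for a section `W` of `φ⁻¹TN` and `X` in `T_xM`.
In the preferred chart at `φ x` it is the derivative of the components of `W` in the direction
`X` plus the Christoffel term `Γ(dφ(X), W)`. -/
def covAlong (φ : M → N) (W : ∀ x, TangentSpace (𝓡 n) (φ x)) (x : M)
    (X : TangentSpace (𝓡 m) x) : TangentSpace (𝓡 n) (φ x) :=
  (trivializationAt (Model n) (fun q : N ↦ TangentSpace (𝓡 n) q) (φ x)).symm (φ x)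
      (mvfderiv (𝓡 m) (fun x' : M ↦
        (trivializationAt (Model n) (fun q : N ↦ TangentSpace (𝓡 n) q) (φ x)
          ⟨φ x', W x'⟩).2) x X)
    + christoffel (φ x) (mfderiv (𝓡 m) (𝓡 n) φ x X) (W x)

end Along

section LeviCivita

variable {k : ℕ} {N : Type*} [TopologicalSpace N] [ChartedSpace (Model k) N]
  [IsManifold (𝓡 k) ∞ N] [RiemannianBundle (fun q : N ↦ TangentSpace (𝓡 k) q)]

/-- The Levi-Civita connection: `lcConn Y x X` is `∇_X Y` at `x`. -/
def lcConn (Y : ∀ q : N, TangentSpace (𝓡 k) q) (q : N) (X : TangentSpace (𝓡 k) q) :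
    TangentSpace (𝓡 k) q :=
  covAlong k k (fun q' : N ↦ q') Y q X

/-- The curvature tensor
`R(u, v) w = ∇_U ∇_V W - ∇_V ∇_U W - ∇_[U,V] W`,
where `U`, `V`, `W` extend `u`, `v`, `w`. -/
def curvature (q : N) (u v w : TangentSpace (𝓡 k) q) : TangentSpace (𝓡 k) q :=
  lcConn (fun q' ↦ lcConn (constField w) q' (constField v q')) q u
    - lcConn (fun q' ↦ lcConn (constField w) q' (constField u q')) q v
    - lcConn (constField w) q (VectorField.mlieBracket (𝓡 k) (constField u) (constField v) q)

variable (k) in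
/-- The vector field `∂_i` of the preferred chart at `q`. -/
def coordField (q : N) (i : Fin k) (q' : N) : TangentSpace (𝓡 k) q' :=
  (trivializationAt (Model k) (fun p : N ↦ TangentSpace (𝓡 k) p) q).symm q'
    (EuclideanSpace.single i (1 : ℝ))

variable [MeasurableSpace N]

variable (k) in
/-- The Riemannian measure on the domain of the preferred chart at `q`, extended by zero:
`√(det g_ij) dy¹ … dy^k` in the coordinates of that chart. -/
def chartVolume (q : N) : Measure N :=
  ((volume.restrict (extChartAt (𝓡 k) q).target).withDensity fun y ↦
      ENNReal.ofReal (Real.sqrt (Matrix.of fun i j : Fin k ↦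
        (inner ℝ (coordField k q i ((extChartAt (𝓡 k) q).symm y))
          (coordField k q j ((extChartAt (𝓡 k) q).symm y)) : ℝ)).det)).map
    (extChartAt (𝓡 k) q).symm

variable (k N) in
/-- The Riemannian measure `v_g`: the least measure which dominates the Riemannian measures of the
chart domains. As those agree on overlaps, it restricts to each of them. -/
def riemannianVolume : Measure N := ⨆ q : N, chartVolume k q

end LeviCivita

section Maps

variable (m n : ℕ)
  {M : Type*} [TopologicalSpace M] [ChartedSpace (Model m) M] [IsManifold (𝓡 m) ∞ M]
  [RiemannianBundle (fun x : M ↦ TangentSpace (𝓡 m) x)]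
  {N : Type*} [TopologicalSpace N] [ChartedSpace (Model n) N] [IsManifold (𝓡 n) ∞ N]
  [RiemannianBundle (fun q : N ↦ TangentSpace (𝓡 n) q)]

/-- The second fundamental form `B(φ)(X, Y) = ∇̄_X (dφ(Y)) - dφ(∇_X Y)`. -/
def secondFundamentalForm (φ : M → N) (x : M) (X Y : TangentSpace (𝓡 m) x) :
    TangentSpace (𝓡 n) (φ x) :=
  covAlong m n φ (fun x' ↦ mfderiv (𝓡 m) (𝓡 n) φ x' (constField Y x')) x X
    - mfderiv (𝓡 m) (𝓡 n) φ x (lcConn (constField Y) x X)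

/-- The tension field `τ(φ) = ∑ B(φ)(e_i, e_i)`. -/
def tension (φ : M → N) (x : M) : TangentSpace (𝓡 n) (φ x) :=
  ∑ i, secondFundamentalForm m n φ x (onb m x i) (onb m x i)

/-- The rough Laplacian `Δ̄V = -∑ (∇̄_{e_i} ∇̄_{e_i} V - ∇̄_{∇_{e_i} e_i} V)`. -/
def roughLaplacian (φ : M → N) (V : ∀ x, TangentSpace (𝓡 n) (φ x)) (x : M) :
    TangentSpace (𝓡 n) (φ x) :=
  -∑ i, (covAlong m n φ (fun x' ↦ covAlong m n φ V x' (constField (onb m x i) x')) x (onb m x i)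
    - covAlong m n φ V x (lcConn (constField (onb m x i)) x (onb m x i)))

/-- The Jacobi operator `J(V) = Δ̄V - ∑ R(V, dφ(e_i)) dφ(e_i)`. -/
def jacobiOperator (φ : M → N) (V : ∀ x, TangentSpace (𝓡 n) (φ x)) (x : M) :
    TangentSpace (𝓡 n) (φ x) :=
  roughLaplacian m n φ V x
    - ∑ i, curvature (φ x) (V x) (mfderiv (𝓡 m) (𝓡 n) φ x (onb m x i))
        (mfderiv (𝓡 m) (𝓡 n) φ x (onb m x i))

/-- The tritension field `τ₃(φ) = J(Δ̄τ(φ)) - ∑ R(∇̄_{e_i} τ(φ), τ(φ)) dφ(e_i)`. -/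
def tritension (φ : M → N) (x : M) : TangentSpace (𝓡 n) (φ x) :=
  jacobiOperator m n φ (roughLaplacian m n φ (tension m n φ)) x
    - ∑ i, curvature (φ x) (covAlong m n φ (tension m n φ) x (onb m x i)) (tension m n φ x)
        (mfderiv (𝓡 m) (𝓡 n) φ x (onb m x i))

/-- Differential forms of degree `p` on `M` with values in `φ⁻¹TN`, as families of functions of `p`
tangent vectors. (All the forms that occur below are multilinear, alternating and smooth if `φ` is
smooth; this is not recorded in the type.) -/
abbrev FormAlong (m n : ℕ) {M : Type*} [TopologicalSpace M] [ChartedSpace (Model m) M]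
    {N : Type*} [TopologicalSpace N] [ChartedSpace (Model n) N] (φ : M → N) (p : ℕ) : Type _ :=
  ∀ x : M, (Fin p → TangentSpace (𝓡 m) x) → TangentSpace (𝓡 n) (φ x)

/-- The induced connection on forms:
`(∇̃_X α)(Y₁, …, Y_p) = ∇̄_X (α(Y₁, …, Y_p)) - ∑_j α(Y₁, …, ∇_X Y_j, …, Y_p)`. -/
def covForm (φ : M → N) {p : ℕ} (α : FormAlong m n φ p) (x : M) (X : TangentSpace (𝓡 m) x)
    (Y : Fin p → TangentSpace (𝓡 m) x) : TangentSpace (𝓡 n) (φ x) :=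
  covAlong m n φ (fun x' ↦ α x' fun j ↦ constField (Y j) x') x X
    - ∑ j, α x (Function.update Y j (lcConn (constField (Y j)) x X))

/-- The exterior derivative
`(dα)(Y₀, …, Y_p) = ∑_i (-1)^i (∇̃_{Y_i} α)(Y₀, …, Ŷ_i, …, Y_p)`. -/
def extD (φ : M → N) {p : ℕ} (α : FormAlong m n φ p) : FormAlong m n φ (p + 1) := fun x Y ↦
  ∑ i : Fin (p + 1), (-1 : ℝ) ^ (i : ℕ) • covForm m n φ α x (Y i) (i.removeNth Y)

/-- The codifferential `(δα)(Y₁, …, Y_p) = -∑_i (∇̃_{e_i} α)(e_i, Y₁, …, Y_p)`. -/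
def codiff (φ : M → N) {p : ℕ} (α : FormAlong m n φ (p + 1)) : FormAlong m n φ p := fun x Y ↦
  -∑ i, covForm m n φ α x (onb m x i) (Fin.cons (onb m x i) Y)

/-- The operator `d + δ` on forms of mixed degree (`δ = 0` on forms of degree `0`). -/
def dPlusDelta (φ : M → N) (Ω : ∀ p, FormAlong m n φ p) : ∀ p, FormAlong m n φ p
  | 0 => codiff m n φ (Ω 1)
  | p + 1 => fun x Y ↦ extD m n φ (Ω p) x Y + codiff m n φ (Ω (p + 2)) x Y

/-- `(d + δ)φ = dφ`, a form of degree one. -/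
def differentialForm (φ : M → N) : ∀ p, FormAlong m n φ p
  | 1 => fun x Y ↦ mfderiv (𝓡 m) (𝓡 n) φ x (Y 0)
  | _ => fun _ _ ↦ 0

/-- The squared norm at `x` of a form `Ω` of mixed degree:
the sum over all degrees `p ≤ m` of `(1 / p!) ∑ |Ω(e_{i₁}, …, e_{i_p})|²`. -/
def formNormSq (φ : M → N) (Ω : ∀ p, FormAlong m n φ p) (x : M) : ℝ :=
  ∑ p ∈ Finset.range (m + 1), (1 / (p.factorial : ℝ)) *
    ∑ i : Fin p → Fin (Module.finrank ℝ (TangentSpace (𝓡 m) x)),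
      ‖Ω p x fun j ↦ onb m x (i j)‖ ^ 2

/-- `|(d + δ)(d + δ)(d + δ)φ|²` at `x`. -/
def trienergyDensity (φ : M → N) (x : M) : ℝ :=
  formNormSq m n φ (dPlusDelta m n φ (dPlusDelta m n φ (differentialForm m n φ))) x

/-- `|∇̄W|² = ∑ |∇̄_{e_i} W|²` at `x`. -/
def covNormSq (φ : M → N) (W : ∀ x, TangentSpace (𝓡 n) (φ x)) (x : M) : ℝ :=
  ∑ i, ‖covAlong m n φ W x (onb m x i)‖ ^ 2

/-- The trienergy `E₃(φ) = ½ ∫ |(d + δ)(d + δ)(d + δ)φ|² v_g`. -/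
def trienergy [MeasurableSpace M] (φ : M → N) : ℝ :=
  (1 / 2) * ∫ x, trienergyDensity m n φ x ∂(riemannianVolume m M)

/-- The variation vector field `V(x) = d/dt|_{t=0} φ_t(x)`, a section of `φ₀⁻¹TN`. -/
def variationField (n : ℕ) {M N : Type*} [TopologicalSpace N] [ChartedSpace (Model n) N]
    (Φ : ℝ → M → N) (x : M) : TangentSpace (𝓡 n) (Φ 0 x) :=
  mfderiv 𝓘(ℝ, ℝ) (𝓡 n) (fun t ↦ Φ t x) 0 (1 : ℝ)

end Maps

end Riem

end

/-! Regard the variation as one map on (-ε, ε) × M and use the covariant derivative along it; let T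
be the time direction, so that V = dφ(T) at t = 0.

The density: d(dφ) = 0 because the second fundamental form is symmetric, and δ(dφ) = -τ. Hence (d +
δ)(d + δ)dφ = -∇̄τ and the trienergy density is |∇̄τ|² (`trienergyDensity_eq`).

The variation: commuting T past e_i costs a curvature term, so ½ ∂_t|∇̄τ|² = ∑⟨∇̄_{e_i}∇̄_Tτ,
∇̄_{e_i}τ⟩ + ∑⟨R(V, dφ e_i)τ, ∇̄_{e_i}τ⟩. The symmetries of the curvature turn the last sum into
∑⟨R(∇̄_{e_i}τ, τ)dφ e_i, V⟩. Vanishing torsion and one more commutation give ∇̄_Tτ = -J(V)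
(`cov_tension`). Moving derivatives off ∇̄_Tτ and then off V produces the one-form α(X) = ⟨∇̄_Tτ,
∇̄_Xτ⟩ + ⟨∇̄_XV, Δ̄τ⟩ - ⟨V, ∇̄_XΔ̄τ⟩, and pointwise ½ ∂_t|∇̄τ|² + ⟨τ₃, V⟩ = div α
(`variation_identity`, `deriv_covNormSq_add_inner`). It remains to integrate: the divergence has
integral zero (`integral_divergence_eq_zero`), and the derivative may be taken under the integral
(`hasDerivAt_integral_of_smooth`).

All tensor calculus takes place in vector spaces, for a metric `G` on an open set and maps `f` into
it; the induced connection is shown to have the same expression in every pair of charts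
(`crd_covAlong`). The orthonormal bases are chosen point by point with no continuity, so smoothness
of a trace always comes from rewriting it with the inverse metric coefficients
(`sum_orthonormal_eq`). Chart independence of div α is not proved by transformation: the other side
of the pointwise identity does not mention the chart of M. The same identity yields continuity,
hence integrability, of ⟨τ₃, V⟩. -/

noncomputable section

set_option synthInstance.maxHeartbeats 400000
set_option maxSynthPendingDepth 4
set_option linter.unusedSectionVars false

namespace Riem

/-! ### Riemannian geometry on open subsets of a vector space -/

section LocalGeometry

variable {F : Type*} [NormedAddCommGroup F] [NormedSpace ℝ F]
  {P : Type*} [NormedAddCommGroup P] [NormedSpace ℝ P]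

/-- The covariant derivative in the direction `ξ` of a vector field `W` along a map `f` with values
in a vector space, for the connection with Christoffel symbols `Γ`. -/
def cov (Γ : F → F →L[ℝ] F →L[ℝ] F) (f W : P → F) (z ξ : P) : F :=
  fderiv ℝ W z ξ + Γ (f z) (fderiv ℝ f z ξ) (W z)

/-- The curvature tensor of the connection with Christoffel symbols `Γ`. -/
def curv (Γ : F → F →L[ℝ] F →L[ℝ] F) (y u v w : F) : F :=
  fderiv ℝ Γ y u v w - fderiv ℝ Γ y v u w + Γ y u (Γ y v w) - Γ y v (Γ y u w)

lemma contDiffAt_fderiv {f : P → F} {z : P} (hf : ContDiffAt ℝ ∞ f z) :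
    ContDiffAt ℝ ∞ (fderiv ℝ f) z := hf.fderiv_right (by simp)

lemma contDiffAt_fderiv_apply {f : P → F} {z : P} (hf : ContDiffAt ℝ ∞ f z) (ξ : P) :
    ContDiffAt ℝ ∞ (fun z ↦ fderiv ℝ f z ξ) z :=
  (contDiffAt_fderiv hf).clm_apply contDiffAt_const

lemma differentiableAt_of_contDiffAt {f : P → F} {z : P} (hf : ContDiffAt ℝ ∞ f z) :
    DifferentiableAt ℝ f z := hf.differentiableAt (by simp)

lemma fderiv_fderiv_comm {f : P → F} {z : P} (hf : ContDiffAt ℝ ∞ f z) (ξ η : P) :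
    fderiv ℝ (fderiv ℝ f) z ξ η = fderiv ℝ (fderiv ℝ f) z η ξ :=
  (hf.isSymmSndFDerivAt (by
    simp only [minSmoothness_of_isRCLikeNormedField]
    exact ENat.LEInfty.out)) ξ η

lemma fderiv_fderiv_apply {f : P → F} {z : P} (hf : ContDiffAt ℝ ∞ f z) (ξ η : P) :
    fderiv ℝ (fun z ↦ fderiv ℝ f z η) z ξ = fderiv ℝ (fderiv ℝ f) z ξ η := by
  rw [fderiv_clm_apply (differentiableAt_of_contDiffAt (contDiffAt_fderiv hf))
    (differentiableAt_const _)]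
  simp

/-! ### Covariant derivatives along a map: commutators, torsion, Bianchi identity. -/

section Connection

variable {Γ : F → F →L[ℝ] F →L[ℝ] F} {f W : P → F} {z : P}

lemma contDiffAt_cov (hΓ : ContDiffAt ℝ ∞ Γ (f z)) (hf : ContDiffAt ℝ ∞ f z)
    (hW : ContDiffAt ℝ ∞ W z) (ξ : P) : ContDiffAt ℝ ∞ (fun z ↦ cov Γ f W z ξ) z :=
  (contDiffAt_fderiv_apply hW ξ).add
    (((hΓ.comp z hf).clm_apply (contDiffAt_fderiv_apply hf ξ)).clm_apply hW)

lemma cov_sub (W₁ W₂ : P → F) (h₁ : DifferentiableAt ℝ W₁ z) (h₂ : DifferentiableAt ℝ W₂ z)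
    (ξ : P) : cov Γ f (fun z ↦ W₁ z - W₂ z) z ξ = cov Γ f W₁ z ξ - cov Γ f W₂ z ξ := by
  simp only [cov, fderiv_fun_sub h₁ h₂, sub_apply, map_sub]
  abel

lemma cov_sum {ι : Type*} (s : Finset ι) (W : ι → P → F)
    (h : ∀ i ∈ s, DifferentiableAt ℝ (W i) z) (ξ : P) :
    cov Γ f (fun z ↦ ∑ i ∈ s, W i z) z ξ = ∑ i ∈ s, cov Γ f (W i) z ξ := by
  simp only [cov, fderiv_fun_sum h, sum_apply, map_sum,
    Finset.sum_add_distrib]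

lemma cov_congr {W' : P → F} (h : W =ᶠ[nhds z] W') (ξ : P) : cov Γ f W z ξ = cov Γ f W' z ξ := by
  simp only [cov, h.fderiv_eq, h.eq_of_nhds]

lemma fderiv_cov (hΓ : ContDiffAt ℝ ∞ Γ (f z)) (hf : ContDiffAt ℝ ∞ f z)
    (hW : ContDiffAt ℝ ∞ W z) (ξ η : P) :
    fderiv ℝ (fun z ↦ cov Γ f W z η) z ξ =
      fderiv ℝ (fderiv ℝ W) z ξ η
        + fderiv ℝ Γ (f z) (fderiv ℝ f z ξ) (fderiv ℝ f z η) (W z)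
        + Γ (f z) (fderiv ℝ (fderiv ℝ f) z ξ η) (W z)
        + Γ (f z) (fderiv ℝ f z η) (fderiv ℝ W z ξ) := by
  have hΓf : ContDiffAt ℝ ∞ (fun z ↦ Γ (f z)) z := hΓ.comp z hf
  have h1 := contDiffAt_fderiv_apply hf η
  have h2 := hΓf.clm_apply h1
  have h3 := contDiffAt_fderiv_apply hW η
  have hc : fderiv ℝ (fun z ↦ Γ (f z)) z = (fderiv ℝ Γ (f z)).comp (fderiv ℝ f z) :=
    fderiv_comp z (differentiableAt_of_contDiffAt hΓ) (differentiableAt_of_contDiffAt hf)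
  unfold cov
  rw [fderiv_fun_add (differentiableAt_of_contDiffAt h3)
      (differentiableAt_of_contDiffAt (h2.clm_apply hW)),
    fderiv_clm_apply (differentiableAt_of_contDiffAt h2) (differentiableAt_of_contDiffAt hW),
    fderiv_clm_apply (differentiableAt_of_contDiffAt hΓf) (differentiableAt_of_contDiffAt h1), hc]
  simp only [add_apply, ContinuousLinearMap.comp_apply,
    ContinuousLinearMap.flip_apply, fderiv_fderiv_apply hW, fderiv_fderiv_apply hf]
  abel

/-- The commutator of covariant derivatives is the curvature. -/
lemma cov_cov_sub_cov_cov (hΓ : ContDiffAt ℝ ∞ Γ (f z)) (hf : ContDiffAt ℝ ∞ f z)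
    (hW : ContDiffAt ℝ ∞ W z) (ξ η : P) :
    cov Γ f (fun z ↦ cov Γ f W z η) z ξ - cov Γ f (fun z ↦ cov Γ f W z ξ) z η =
      curv Γ (f z) (fderiv ℝ f z ξ) (fderiv ℝ f z η) (W z) := by
  have e1 : ∀ ξ η, cov Γ f (fun z ↦ cov Γ f W z η) z ξ =
      fderiv ℝ (fun z ↦ cov Γ f W z η) z ξ
        + Γ (f z) (fderiv ℝ f z ξ) (fderiv ℝ W z η + Γ (f z) (fderiv ℝ f z η) (W z)) :=
    fun _ _ ↦ rfl
  -- The second derivatives of `W` and of `f` cancel by symmetry, and the products of Γ with a first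
  -- derivative of `W` cancel in pairs. Only the terms of `curv` remain.
  rw [e1, e1, fderiv_cov hΓ hf hW, fderiv_cov hΓ hf hW, fderiv_fderiv_comm hW ξ η,
    fderiv_fderiv_comm hf ξ η, curv]
  simp only [map_add]
  abel

/-- A connection with symmetric Christoffel symbols is torsion free. -/
lemma cov_fderiv_comm (hsymm : ∀ u v, Γ (f z) u v = Γ (f z) v u) (hf : ContDiffAt ℝ ∞ f z)
    (ξ η : P) :
    cov Γ f (fun z ↦ fderiv ℝ f z η) z ξ = cov Γ f (fun z ↦ fderiv ℝ f z ξ) z η := by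
  simp only [cov, fderiv_fderiv_apply hf]
  rw [fderiv_fderiv_comm hf, hsymm]

lemma cov_add_direction (ξ η : P) : cov Γ f W z (ξ + η) = cov Γ f W z ξ + cov Γ f W z η := by
  simp only [cov, map_add, add_apply]
  abel

/-- The curvature of a connection with symmetric Christoffel symbols satisfies the first Bianchi
identity. -/
lemma curv_bianchi {y : F} (hΓ : ContDiffAt ℝ ∞ Γ y)
    (hsymm : ∀ᶠ y in nhds y, ∀ u v, Γ y u v = Γ y v u) (u v w : F) :
    curv Γ y u v w + curv Γ y v w u + curv Γ y w u v = 0 := by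
  -- Symmetry of Γ on a neighbourhood, not merely at `y`, passes to its derivative.
  have hd : ∀ a b c, fderiv ℝ Γ y a b c = fderiv ℝ Γ y a c b := by
    intro a b c
    have h : ∀ b c : F, fderiv ℝ (fun y ↦ Γ y b c) y a = fderiv ℝ Γ y a b c := by
      intro b c
      have h1 : ContDiffAt ℝ ∞ (fun y ↦ Γ y b) y := hΓ.clm_apply contDiffAt_const
      rw [fderiv_clm_apply (differentiableAt_of_contDiffAt h1) (differentiableAt_const _),
        fderiv_clm_apply (differentiableAt_of_contDiffAt hΓ) (differentiableAt_const _)]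
      simp
    rw [← h, ← h]
    exact DFunLike.congr_fun (Filter.EventuallyEq.fderiv_eq (hsymm.mono fun y h ↦ h b c)) a
  have hs := hsymm.self_of_nhds
  simp only [curv]
  rw [hd u v w, hd v w u, hd w u v, hs v w, hs u w, hs u v]
  abel

end Connection

lemma curv_swap (Γ : F → F →L[ℝ] F →L[ℝ] F) (y u v w : F) :
    curv Γ y u v w = -curv Γ y v u w := by
  simp only [curv]; abel

/-! ### Levi-Civita connection of a metric and the symmetries of its curvature. -/

section Metric

/-- `G` is a smooth Riemannian metric on the open set `D`. -/
structure IsMetricOn (G : F → F →L[ℝ] F →L[ℝ] ℝ) (D : Set F) : Prop where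
  isOpen : IsOpen D
  contDiffOn : ContDiffOn ℝ ∞ G D
  symm : ∀ y ∈ D, ∀ u v, G y u v = G y v u
  pos : ∀ y ∈ D, ∀ u, u ≠ 0 → 0 < G y u u

/-- The Christoffel symbols of the first kind of the metric `G`. -/
def koszul (G : F → F →L[ℝ] F →L[ℝ] ℝ) (y : F) : F →L[ℝ] F →L[ℝ] F →L[ℝ] ℝ :=
  letI A : F →L[ℝ] F →L[ℝ] F →L[ℝ] ℝ := fderiv ℝ G y
  letI B : F →L[ℝ] F →L[ℝ] F →L[ℝ] ℝ :=
    ((ContinuousLinearMap.flipₗᵢ ℝ F F ℝ).toContinuousLinearEquiv :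
        (F →L[ℝ] F →L[ℝ] ℝ) →L[ℝ] (F →L[ℝ] F →L[ℝ] ℝ)).comp A.flip
  (1 / 2 : ℝ) • (A + A.flip - B)

lemma koszul_apply (G : F → F →L[ℝ] F →L[ℝ] ℝ) (y u v w : F) :
    koszul G y u v w =
      (1 / 2) * (fderiv ℝ G y u v w + fderiv ℝ G y v u w - fderiv ℝ G y w u v) := by
  simp [koszul]

/-- The Christoffel symbols of the second kind of the metric `G`. -/
def chr (G : F → F →L[ℝ] F →L[ℝ] ℝ) (y : F) : F →L[ℝ] F →L[ℝ] F :=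
  ((ContinuousLinearMap.compL ℝ F (F →L[ℝ] ℝ) F) (G y).inverse).comp (koszul G y)

lemma chr_apply (G : F → F →L[ℝ] F →L[ℝ] ℝ) (y u v : F) :
    chr G y u v = (G y).inverse (koszul G y u v) := rfl

variable {G : F → F →L[ℝ] F →L[ℝ] ℝ} {D : Set F}

lemma IsMetricOn.contDiffAt (hG : IsMetricOn G D) {y : F} (hy : y ∈ D) : ContDiffAt ℝ ∞ G y :=
  hG.contDiffOn.contDiffAt (hG.isOpen.mem_nhds hy)

lemma IsMetricOn.ext (hG : IsMetricOn G D) {y : F} (hy : y ∈ D) {u v : F}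
    (h : ∀ w, G y u w = G y v w) : u = v := by
  by_contra hne
  have := hG.pos y hy (u - v) (sub_ne_zero.2 hne)
  simp only [map_sub, sub_apply] at this
  have h1 := h u
  have h2 := h v
  linarith

lemma fderiv_metric_apply (hG : IsMetricOn G D) {y : F} (hy : y ∈ D) (u v w : F) :
    fderiv ℝ (fun y ↦ G y v w) y u = fderiv ℝ G y u v w := by
  have h1 : ContDiffAt ℝ ∞ (fun y ↦ G y v) y := (hG.contDiffAt hy).clm_apply contDiffAt_const
  rw [fderiv_clm_apply (differentiableAt_of_contDiffAt h1) (differentiableAt_const _),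
    fderiv_clm_apply (differentiableAt_of_contDiffAt (hG.contDiffAt hy)) (differentiableAt_const _)]
  simp

lemma fderiv_metric_symm (hG : IsMetricOn G D) {y : F} (hy : y ∈ D) (u v w : F) :
    fderiv ℝ G y u v w = fderiv ℝ G y u w v := by
  rw [← fderiv_metric_apply hG hy, ← fderiv_metric_apply hG hy]
  refine DFunLike.congr_fun (Filter.EventuallyEq.fderiv_eq ?_) u
  filter_upwards [hG.isOpen.mem_nhds hy] with y' hy' using hG.symm y' hy' v w

variable [FiniteDimensional ℝ F]

/-- Positive definiteness gives injectivity, and a space and its dual have the same dimension.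
Without this `ContinuousLinearMap.inverse` could be its default value zero. -/
lemma IsMetricOn.exists_equiv (hG : IsMetricOn G D) {y : F} (hy : y ∈ D) :
    ∃ e : F ≃L[ℝ] (F →L[ℝ] ℝ), (e : F →L[ℝ] (F →L[ℝ] ℝ)) = G y := by
  have hinj : Function.Injective (G y : F →ₗ[ℝ] (F →L[ℝ] ℝ)) := by
    intro u v huv
    exact hG.ext hy fun w ↦ by
      have := DFunLike.congr_fun huv w
      simpa using this
  have hfr : Module.finrank ℝ F = Module.finrank ℝ (F →L[ℝ] ℝ) := by
    rw [← (LinearMap.toContinuousLinearMap : (F →ₗ[ℝ] ℝ) ≃ₗ[ℝ] (F →L[ℝ] ℝ)).finrank_eq]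
    exact (Subspace.dual_finrank_eq (K := ℝ) (V := F)).symm
  refine ⟨(LinearEquiv.ofInjectiveOfFinrankEq _ hinj hfr).toContinuousLinearEquiv, ?_⟩
  ext u v
  rfl

lemma IsMetricOn.apply_inverse (hG : IsMetricOn G D) {y : F} (hy : y ∈ D) (l : F →L[ℝ] ℝ) (w : F) :
    G y ((G y).inverse l) w = l w := by
  obtain ⟨e, he⟩ := hG.exists_equiv hy
  rw [← he, ContinuousLinearMap.inverse_equiv]
  simp

lemma IsMetricOn.contDiffAt_inverse (hG : IsMetricOn G D) {y : F} (hy : y ∈ D) :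
    ContDiffAt ℝ ∞ (fun y ↦ (G y).inverse) y := by
  have : CompleteSpace F := FiniteDimensional.complete ℝ F
  obtain ⟨e, he⟩ := hG.exists_equiv hy
  exact ContDiffAt.comp y (he ▸ contDiffAt_map_inverse e) (hG.contDiffAt hy)

/-- Pairing with `G` removes the inverse metric from `chr`. Metric computations use this form,
together with nondegeneracy. -/
lemma metric_chr (hG : IsMetricOn G D) {y : F} (hy : y ∈ D) (u v w : F) :
    G y (chr G y u v) w =
      (1 / 2) * (fderiv ℝ G y u v w + fderiv ℝ G y v u w - fderiv ℝ G y w u v) := by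
  rw [chr_apply, hG.apply_inverse hy, koszul_apply]

lemma contDiffOn_chr (hG : IsMetricOn G D) : ContDiffOn ℝ ∞ (chr G) D := by
  refine contDiffOn_clm_apply.2 fun u ↦ contDiffOn_clm_apply.2 fun v ↦ ?_
  intro y hy
  refine ContDiffAt.contDiffWithinAt ?_
  simp only [chr_apply]
  refine (hG.contDiffAt_inverse hy).clm_apply ?_
  refine (contDiffOn_clm_apply (s := D).2 fun w y hy ↦ ?_).contDiffAt (hG.isOpen.mem_nhds hy)
  refine ContDiffAt.contDiffWithinAt ?_
  simp only [koszul_apply]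
  have h : ∀ a b c : F, ContDiffAt ℝ ∞ (fun y ↦ fderiv ℝ G y a b c) y := fun a b c ↦
    ((contDiffAt_fderiv_apply (hG.contDiffAt hy) a).clm_apply contDiffAt_const).clm_apply
      contDiffAt_const
  exact contDiffAt_const.mul (((h _ _ _).add (h _ _ _)).sub (h _ _ _))

lemma contDiffAt_chr (hG : IsMetricOn G D) {y : F} (hy : y ∈ D) : ContDiffAt ℝ ∞ (chr G) y :=
  (contDiffOn_chr hG).contDiffAt (hG.isOpen.mem_nhds hy)

lemma chr_symm (hG : IsMetricOn G D) {y : F} (hy : y ∈ D) (u v : F) :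
    chr G y u v = chr G y v u := by
  refine hG.ext hy fun w ↦ ?_
  rw [metric_chr hG hy, metric_chr hG hy, fderiv_metric_symm hG hy w u v]
  ring

/-- The Levi-Civita connection is compatible with the metric. -/
lemma fderiv_metric (hG : IsMetricOn G D) {f V W : P → F} {z : P} (hz : f z ∈ D)
    (hf : DifferentiableAt ℝ f z) (hV : DifferentiableAt ℝ V z) (hW : DifferentiableAt ℝ W z)
    (ξ : P) :
    fderiv ℝ (fun z ↦ G (f z) (V z) (W z)) z ξ =
      G (f z) (cov (chr G) f V z ξ) (W z) + G (f z) (V z) (cov (chr G) f W z ξ) := by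
  have hGd := differentiableAt_of_contDiffAt (hG.contDiffAt hz)
  have hGf : DifferentiableAt ℝ (fun z ↦ G (f z)) z := hGd.comp z hf
  have hc : fderiv ℝ (fun z ↦ G (f z)) z = (fderiv ℝ G (f z)).comp (fderiv ℝ f z) :=
    fderiv_comp z hGd hf
  rw [fderiv_clm_apply (hGf.clm_apply hV) hW, fderiv_clm_apply hGf hV, hc]
  simp only [cov, add_apply, ContinuousLinearMap.comp_apply,
    ContinuousLinearMap.flip_apply, map_add, metric_chr hG hz]
  rw [hG.symm _ hz (V z) (chr G (f z) (fderiv ℝ f z ξ) (W z)), metric_chr hG hz,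
    fderiv_metric_symm hG hz (fderiv ℝ f z ξ) (W z) (V z),
    fderiv_metric_symm hG hz (W z) (fderiv ℝ f z ξ) (V z),
    fderiv_metric_symm hG hz (V z) (fderiv ℝ f z ξ) (W z)]
  ring

lemma fderiv_fderiv_metric (hG : IsMetricOn G D) {f V W : P → F} {z : P} (hz : f z ∈ D)
    (hf : ContDiffAt ℝ ∞ f z) (hV : ContDiffAt ℝ ∞ V z) (hW : ContDiffAt ℝ ∞ W z) (ξ η : P) :
    fderiv ℝ (fun z ↦ G (f z) (cov (chr G) f V z η) (W z)) z ξ =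
      G (f z) (cov (chr G) f (fun z ↦ cov (chr G) f V z η) z ξ) (W z)
        + G (f z) (cov (chr G) f V z η) (cov (chr G) f W z ξ) :=
  fderiv_metric hG hz (differentiableAt_of_contDiffAt hf) (differentiableAt_of_contDiffAt
    (contDiffAt_cov (contDiffAt_chr hG hz) hf hV η)) (differentiableAt_of_contDiffAt hW) ξ

/-- Apply metric compatibility twice, along the identity map, to the function `y ↦ G y w x` with
`w`, `x` constant. Its second derivative is symmetric in the directions `u`, `v`; after
antisymmetrising, the products of first covariant derivatives cancel and the commutators are
curvatures. -/
lemma metric_curv_skew (hG : IsMetricOn G D) {y : F} (hy : y ∈ D) (u v w x : F) :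
    G y (curv (chr G) y u v w) x = -G y (curv (chr G) y u v x) w := by
  have hc : ∀ a : F, ContDiffAt ℝ ∞ (fun _ : F ↦ a) y := fun a ↦ contDiffAt_const
  have hid : ContDiffAt ℝ ∞ (fun y : F ↦ y) y := contDiffAt_id
  have hcomm := fun a : F ↦ cov_cov_sub_cov_cov (f := fun y : F ↦ y) (z := y)
    (contDiffAt_chr hG hy) hid (hc a) u v
  simp only [fderiv_fun_id, ContinuousLinearMap.id_apply] at hcomm
  have hfirst : ∀ᶠ y' in nhds y, ∀ a, fderiv ℝ (fun y ↦ G y w x) y' a =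
      G y' (cov (chr G) (fun y : F ↦ y) (fun _ ↦ w) y' a) x
        + G y' (cov (chr G) (fun y : F ↦ y) (fun _ ↦ x) y' a) w := by
    filter_upwards [hG.isOpen.mem_nhds hy] with y' hy' a
    rw [fderiv_metric hG (f := fun y : F ↦ y) (V := fun _ ↦ w) (W := fun _ ↦ x) hy'
      differentiableAt_id (differentiableAt_const _) (differentiableAt_const _), hG.symm y' hy' w]
  have hd : ∀ a b : F, DifferentiableAt ℝ
      (fun y ↦ G y (cov (chr G) (fun y : F ↦ y) (fun _ ↦ a) y b)) y := fun a b ↦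
    differentiableAt_of_contDiffAt ((hG.contDiffAt hy).clm_apply
      (contDiffAt_cov (contDiffAt_chr hG hy) hid (hc a) b))
  have hsecond : ∀ a b, fderiv ℝ (fderiv ℝ (fun y ↦ G y w x)) y a b =
      G y (cov (chr G) (fun y : F ↦ y)
          (fun y ↦ cov (chr G) (fun y : F ↦ y) (fun _ ↦ w) y b) y a) x
        + G y (cov (chr G) (fun y : F ↦ y) (fun _ ↦ w) y b)
          (cov (chr G) (fun y : F ↦ y) (fun _ ↦ x) y a)
        + (G y (cov (chr G) (fun y : F ↦ y)
          (fun y ↦ cov (chr G) (fun y : F ↦ y) (fun _ ↦ x) y b) y a) w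
        + G y (cov (chr G) (fun y : F ↦ y) (fun _ ↦ x) y b)
          (cov (chr G) (fun y : F ↦ y) (fun _ ↦ w) y a)) := by
    intro a b
    have hGwx : ContDiffAt ℝ ∞ (fun y ↦ G y w x) y :=
      ((hG.contDiffAt hy).clm_apply contDiffAt_const).clm_apply contDiffAt_const
    rw [← fderiv_fderiv_apply hGwx a b,
      Filter.EventuallyEq.fderiv_eq (hfirst.mono fun y' h ↦ h b),
      fderiv_fun_add ((hd w b).clm_apply (differentiableAt_const _))
        ((hd x b).clm_apply (differentiableAt_const _)), add_apply,
      fderiv_fderiv_metric hG (f := fun y : F ↦ y) (V := fun _ ↦ w) (W := fun _ ↦ x) hy hid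
        (hc w) (hc x),
      fderiv_fderiv_metric hG (f := fun y : F ↦ y) (V := fun _ ↦ x) (W := fun _ ↦ w) hy hid
        (hc x) (hc w)]
  have hGwx : ContDiffAt ℝ ∞ (fun y ↦ G y w x) y :=
    ((hG.contDiffAt hy).clm_apply contDiffAt_const).clm_apply contDiffAt_const
  have hs := fderiv_fderiv_comm hGwx u v
  rw [hsecond, hsecond] at hs
  rw [← hcomm w, ← hcomm x]
  simp only [map_sub, sub_apply]
  rw [hG.symm y hy (cov (chr G) (fun y : F ↦ y) (fun _ ↦ w) y v),
    hG.symm y hy (cov (chr G) (fun y : F ↦ y) (fun _ ↦ w) y u)] at hs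
  linarith

lemma metric_curv_bianchi (hG : IsMetricOn G D) {y : F} (hy : y ∈ D) (u v w x : F) :
    G y (curv (chr G) y u v w) x + G y (curv (chr G) y v w u) x
      + G y (curv (chr G) y w u v) x = 0 := by
  have h := curv_bianchi (contDiffAt_chr hG hy) (by
    filter_upwards [hG.isOpen.mem_nhds hy] with y' hy' u v using chr_symm hG hy' u v) u v w
  have h2 := congrArg (fun a ↦ G y a x) h
  simpa using h2

/-- The octahedron argument: the four Bianchi identities obtained by rotating the arguments,
combined linearly with the two skew-symmetries. -/
lemma metric_curv_pair (hG : IsMetricOn G D) {y : F} (hy : y ∈ D) (u v w x : F) :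
    G y (curv (chr G) y u v w) x = G y (curv (chr G) y w x u) v := by
  have sw : ∀ a b c d, G y (curv (chr G) y a b c) d = -G y (curv (chr G) y b a c) d := by
    intro a b c d
    rw [curv_swap]; simp
  have sk := metric_curv_skew hG hy
  have b1 := metric_curv_bianchi hG hy u v w x
  have b2 := metric_curv_bianchi hG hy v w x u
  have b3 := metric_curv_bianchi hG hy w x u v
  have b4 := metric_curv_bianchi hG hy x u v w
  have h1 := sk v w u x
  have h2 := sk w u v x
  have h3 := sk w x v u
  have h4 := sk x v w u
  have h5 := sk x u w v
  have h6 := sk u v x w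
  have h7 := sw x v w u
  have h8 := sw u w x v
  have h9 := sw w u x v
  have h10 := sk u w x v
  have h11 := sw u w v x
  have h12 := sw v x u w
  have h13 := sk v x u w
  linarith

end Metric

end LocalGeometry

/-! ### Change of coordinates and the pointwise first variation identity. -/

section Variation

variable {F : Type*} [NormedAddCommGroup F] [NormedSpace ℝ F] [FiniteDimensional ℝ F]
  {P : Type*} [NormedAddCommGroup P] [NormedSpace ℝ P]
  {G : F → F →L[ℝ] F →L[ℝ] ℝ} {D : Set F} {ι : Type*} [Fintype ι]

/-- Transformation law of the Christoffel symbols under a change of coordinates. -/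
lemma chr_transform {F' : Type*} [NormedAddCommGroup F'] [NormedSpace ℝ F']
    [FiniteDimensional ℝ F'] {G' : F' → F' →L[ℝ] F' →L[ℝ] ℝ} {D' : Set F'}
    (hG : IsMetricOn G D) (hG' : IsMetricOn G' D') {ψ : F' → F} {y : F'} (hy : y ∈ D')
    (hψy : ψ y ∈ D) (hψ : ContDiffAt ℝ ∞ ψ y)
    (hsurj : Function.Surjective (fderiv ℝ ψ y))
    (hpull : ∀ᶠ y' in nhds y, ∀ u v, G' y' u v = G (ψ y') (fderiv ℝ ψ y' u) (fderiv ℝ ψ y' v))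
    (u v : F') :
    fderiv ℝ ψ y (chr G' y u v) =
      chr G (ψ y) (fderiv ℝ ψ y u) (fderiv ℝ ψ y v) + fderiv ℝ (fderiv ℝ ψ) y u v := by
  have hψd := differentiableAt_of_contDiffAt hψ
  have hd : ∀ a b c, fderiv ℝ G' y a b c =
      fderiv ℝ G (ψ y) (fderiv ℝ ψ y a) (fderiv ℝ ψ y b) (fderiv ℝ ψ y c)
        + G (ψ y) (fderiv ℝ (fderiv ℝ ψ) y a b) (fderiv ℝ ψ y c)
        + G (ψ y) (fderiv ℝ ψ y b) (fderiv ℝ (fderiv ℝ ψ) y a c) := by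
    intro a b c
    rw [← fderiv_metric_apply hG' hy,
      Filter.EventuallyEq.fderiv_eq (hpull.mono fun y' h ↦ h b c)]
    have hGd := differentiableAt_of_contDiffAt (hG.contDiffAt hψy)
    have hGf : DifferentiableAt ℝ (fun z ↦ G (ψ z)) y := hGd.comp y hψd
    have hc : fderiv ℝ (fun z ↦ G (ψ z)) y = (fderiv ℝ G (ψ y)).comp (fderiv ℝ ψ y) :=
      fderiv_comp y hGd hψd
    have h1 := fun b ↦ differentiableAt_of_contDiffAt (contDiffAt_fderiv_apply hψ b)
    rw [fderiv_clm_apply (hGf.clm_apply (h1 b)) (h1 c), fderiv_clm_apply hGf (h1 b), hc]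
    simp only [add_apply, ContinuousLinearMap.comp_apply, ContinuousLinearMap.flip_apply,
      fderiv_fderiv_apply hψ]
    ring
  -- By surjectivity it suffices to test against vectors `dψ(w)`. In the Koszul combination of `hd`
  -- the second derivatives of `ψ` cancel except for twice `G (D²ψ(u, v)) (dψ w)`, which accounts
  -- for the inhomogeneous term.
  refine hG.ext hψy fun w ↦ ?_
  obtain ⟨w, rfl⟩ := hsurj w
  rw [← hpull.self_of_nhds, metric_chr hG' hy, map_add, add_apply, metric_chr hG hψy, hd, hd, hd,
    fderiv_fderiv_comm hψ v u, fderiv_fderiv_comm hψ w u, fderiv_fderiv_comm hψ w v,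
    hG.symm _ hψy (fderiv ℝ ψ y v), hG.symm _ hψy (fderiv ℝ ψ y u)]
  ring

/-- The covariant derivative of the tension field in the direction of a variation. -/
lemma cov_tension (hG : IsMetricOn G D) {f : P → F} {z : P} (hz : f z ∈ D)
    (hf : ContDiffAt ℝ ∞ f z) (hfn : ∀ᶠ z' in nhds z, f z' ∈ D ∧ ContDiffAt ℝ ∞ f z')
    (T ζ : P) (e : ι → P) :
    cov (chr G) f (fun z ↦ ∑ i, cov (chr G) f (fun z ↦ fderiv ℝ f z (e i)) z (e i)
        - fderiv ℝ f z ζ) z T =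
      ∑ i, cov (chr G) f (fun z ↦ cov (chr G) f (fun z ↦ fderiv ℝ f z T) z (e i)) z (e i)
        - cov (chr G) f (fun z ↦ fderiv ℝ f z T) z ζ
        + ∑ i, curv (chr G) (f z) (fderiv ℝ f z T) (fderiv ℝ f z (e i)) (fderiv ℝ f z (e i)) := by
  have hΓ := contDiffAt_chr hG hz
  have hc : ∀ i, ContDiffAt ℝ ∞ (fun z ↦ cov (chr G) f (fun z ↦ fderiv ℝ f z (e i)) z (e i)) z :=
    fun i ↦ contDiffAt_cov hΓ hf (contDiffAt_fderiv_apply hf _) _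
  rw [cov_sub _ _ (differentiableAt_of_contDiffAt (ContDiffAt.sum fun i _ ↦ hc i))
    (differentiableAt_of_contDiffAt (contDiffAt_fderiv_apply hf _)),
    cov_sum _ _ fun i _ ↦ differentiableAt_of_contDiffAt (hc i),
    cov_fderiv_comm (chr_symm hG hz) hf T ζ]
  have key : ∀ i, cov (chr G) f (fun z ↦ cov (chr G) f (fun z ↦ fderiv ℝ f z (e i)) z (e i)) z T =
      cov (chr G) f (fun z ↦ cov (chr G) f (fun z ↦ fderiv ℝ f z T) z (e i)) z (e i)
        + curv (chr G) (f z) (fderiv ℝ f z T) (fderiv ℝ f z (e i)) (fderiv ℝ f z (e i)) := by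
    intro i
    rw [← cov_cov_sub_cov_cov hΓ hf (contDiffAt_fderiv_apply hf (e i)) T (e i)]
    -- The torsion-free identity is differentiated once more here, so it is needed near `z`; this is
    -- the purpose of `hfn`.
    have : cov (chr G) f (fun z ↦ cov (chr G) f (fun z ↦ fderiv ℝ f z (e i)) z T) z (e i) =
        cov (chr G) f (fun z ↦ cov (chr G) f (fun z ↦ fderiv ℝ f z T) z (e i)) z (e i) := by
      refine cov_congr ?_ _
      filter_upwards [hfn] with z' hz'
      exact cov_fderiv_comm (chr_symm hG hz'.1) hz'.2 T (e i)
    rw [this]; abel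
  rw [Finset.sum_congr rfl fun i _ ↦ key i, Finset.sum_add_distrib]
  abel

/-- The one-form whose divergence is the difference of the integrands of the first variation of
the trienergy. -/
def variationForm (G : F → F →L[ℝ] F →L[ℝ] ℝ) (f τ Λ : P → F) (T : P) (z ξ : P) : ℝ :=
  G (f z) (cov (chr G) f τ z T) (cov (chr G) f τ z ξ)
    + G (f z) (cov (chr G) f (fun z ↦ fderiv ℝ f z T) z ξ) (Λ z)
    - G (f z) (fderiv ℝ f z T) (cov (chr G) f Λ z ξ)

/-- The pointwise heart of the proof: half the time derivative of |∇̄τ|² equals div α minus ⟨τ₃, V⟩.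
The vectors `e i` and `ζ` are arbitrary; in the application they are an orthonormal basis, extended
with constant components, and ∑ ∇_{e_i} e_i. The hypothesis `hS` says ∇̄_Tτ = -J(V), and `hL` says
that `Λ` is Δ̄τ at the point. -/
lemma variation_identity (hG : IsMetricOn G D) {f τ Λ : P → F} {z : P} (hz : f z ∈ D)
    (hf : ContDiffAt ℝ ∞ f z) (hτ : ContDiffAt ℝ ∞ τ z) (hΛ : ContDiffAt ℝ ∞ Λ z)
    (T ζ : P) (e : ι → P)
    (hS : cov (chr G) f τ z T =
      ∑ i, cov (chr G) f (fun z ↦ cov (chr G) f (fun z ↦ fderiv ℝ f z T) z (e i)) z (e i)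
        - cov (chr G) f (fun z ↦ fderiv ℝ f z T) z ζ
        + ∑ i, curv (chr G) (f z) (fderiv ℝ f z T) (fderiv ℝ f z (e i)) (fderiv ℝ f z (e i)))
    (hL : Λ z = -(∑ i, cov (chr G) f (fun z ↦ cov (chr G) f τ z (e i)) z (e i)
        - cov (chr G) f τ z ζ)) :
    (1 / 2) * fderiv ℝ (fun z ↦ ∑ i, G (f z) (cov (chr G) f τ z (e i)) (cov (chr G) f τ z (e i)))
        z T =
      ∑ i, fderiv ℝ (fun z ↦ variationForm G f τ Λ T z (e i)) z (e i)
        - variationForm G f τ Λ T z ζ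
        - G (f z) (-(∑ i, cov (chr G) f (fun z ↦ cov (chr G) f Λ z (e i)) z (e i)
              - cov (chr G) f Λ z ζ)
            - ∑ i, curv (chr G) (f z) (Λ z) (fderiv ℝ f z (e i)) (fderiv ℝ f z (e i))
            - ∑ i, curv (chr G) (f z) (cov (chr G) f τ z (e i)) (τ z) (fderiv ℝ f z (e i)))
          (fderiv ℝ f z T) := by
  have hΓ := contDiffAt_chr hG hz
  have hV := contDiffAt_fderiv_apply hf T
  have hτc := fun ξ ↦ contDiffAt_cov hΓ hf hτ ξ
  have hVc := fun ξ ↦ contDiffAt_cov hΓ hf hV ξ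
  have hΛc := fun ξ ↦ contDiffAt_cov hΓ hf hΛ ξ
  have dd := @differentiableAt_of_contDiffAt F _ _ P _ _
  have hGd : ∀ {A B : P → F}, ContDiffAt ℝ ∞ A z → ContDiffAt ℝ ∞ B z →
      DifferentiableAt ℝ (fun z ↦ G (f z) (A z) (B z)) z := fun hA hB ↦
    differentiableAt_of_contDiffAt ((((hG.contDiffAt hz).comp z hf).clm_apply hA).clm_apply hB)
  have hm : ∀ {A B : P → F} (ξ : P), ContDiffAt ℝ ∞ A z → ContDiffAt ℝ ∞ B z →
      fderiv ℝ (fun z ↦ G (f z) (A z) (B z)) z ξ =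
        G (f z) (cov (chr G) f A z ξ) (B z) + G (f z) (A z) (cov (chr G) f B z ξ) :=
    fun ξ hA hB ↦ fderiv_metric hG hz (dd hf) (dd hA) (dd hB) ξ
  have sy := hG.symm _ hz
  have lhs : (1 / 2) * fderiv ℝ (fun z ↦ ∑ i, G (f z) (cov (chr G) f τ z (e i))
      (cov (chr G) f τ z (e i))) z T =
      ∑ i, (G (f z) (cov (chr G) f (fun z ↦ cov (chr G) f τ z T) z (e i)) (cov (chr G) f τ z (e i))
        + G (f z) (curv (chr G) (f z) (cov (chr G) f τ z (e i)) (τ z) (fderiv ℝ f z (e i)))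
            (fderiv ℝ f z T)) := by
    rw [fderiv_fun_sum fun i _ ↦ hGd (hτc _) (hτc _), sum_apply, Finset.mul_sum]
    refine Finset.sum_congr rfl fun i _ ↦ ?_
    rw [hm T (hτc _) (hτc _), sy (cov (chr G) f τ z (e i))]
    have h1 : cov (chr G) f (fun z ↦ cov (chr G) f τ z (e i)) z T =
        cov (chr G) f (fun z ↦ cov (chr G) f τ z T) z (e i)
          + curv (chr G) (f z) (fderiv ℝ f z T) (fderiv ℝ f z (e i)) (τ z) := by
      rw [← cov_cov_sub_cov_cov hΓ hf hτ]; abel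
    -- Pair symmetry followed by skew-symmetry in each pair isolates V: ⟨R(V, dφ e_i)τ, ∇̄_iτ⟩ =
    -- ⟨R(∇̄_iτ, τ)dφ e_i, V⟩.
    rw [h1, map_add, add_apply, metric_curv_pair hG hz (fderiv ℝ f z T),
      metric_curv_skew hG hz (τ z), curv_swap _ _ (τ z)]
    simp only [map_neg, neg_apply]
    ring
  -- The products ⟨∇̄_iV, ∇̄_iΛ⟩ from the last two terms of α cancel.
  have div : ∀ i, fderiv ℝ (fun z ↦ variationForm G f τ Λ T z (e i)) z (e i) =
      G (f z) (cov (chr G) f (fun z ↦ cov (chr G) f τ z T) z (e i)) (cov (chr G) f τ z (e i))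
      + G (f z) (cov (chr G) f τ z T) (cov (chr G) f (fun z ↦ cov (chr G) f τ z (e i)) z (e i))
      + G (f z) (cov (chr G) f (fun z ↦ cov (chr G) f (fun z ↦ fderiv ℝ f z T) z (e i)) z (e i))
          (Λ z)
      - G (f z) (cov (chr G) f (fun z ↦ cov (chr G) f Λ z (e i)) z (e i)) (fderiv ℝ f z T) := by
    intro i
    unfold variationForm
    rw [fderiv_fun_sub ((hGd (hτc _) (hτc _)).fun_add (hGd (hVc _) hΛ)) (hGd hV (hΛc _)),
      fderiv_fun_add (hGd (hτc _) (hτc _)) (hGd (hVc _) hΛ)]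
    simp only [sub_apply, add_apply]
    rw [hm _ (hτc _) (hτc _), hm _ (hVc _) hΛ, hm _ hV (hΛc _), sy (fderiv ℝ f z T)]
    ring
  -- The curvature term of the Jacobi operator is self-adjoint.
  have pairΛ : ∀ i, G (f z) (curv (chr G) (f z) (Λ z) (fderiv ℝ f z (e i)) (fderiv ℝ f z (e i)))
      (fderiv ℝ f z T) =
      G (f z) (curv (chr G) (f z) (fderiv ℝ f z T) (fderiv ℝ f z (e i)) (fderiv ℝ f z (e i)))
      (Λ z) := by
    intro i
    rw [metric_curv_pair hG hz (Λ z), metric_curv_skew hG hz, curv_swap]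
    simp
  rw [lhs, Finset.sum_congr rfl fun i _ ↦ div i]
  -- ⟨∇̄_Tτ, Λ⟩ is computed twice: with Λ = Δ̄τ it is the term left by the divergence of ⟨∇̄_Tτ,
  -- ∇̄τ⟩, and with ∇̄_Tτ = -J(V) it brings in the Jacobi operator. Comparing the two closes the
  -- identity.
  have hSΛ : G (f z) (cov (chr G) f τ z T) (Λ z) = -(∑ i, G (f z) (cov (chr G) f τ z T)
      (cov (chr G) f (fun z ↦ cov (chr G) f τ z (e i)) z (e i))
        - G (f z) (cov (chr G) f τ z T) (cov (chr G) f τ z ζ)) := by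
    rw [hL]; simp only [map_neg, map_sub, map_sum]
  have hSΛ' : G (f z) (cov (chr G) f τ z T) (Λ z) =
      ∑ i, G (f z) (cov (chr G) f (fun z ↦ cov (chr G) f (fun z ↦ fderiv ℝ f z T) z (e i)) z (e i))
        (Λ z) - G (f z) (cov (chr G) f (fun z ↦ fderiv ℝ f z T) z ζ) (Λ z)
      + ∑ i, G (f z) (curv (chr G) (f z) (fderiv ℝ f z T) (fderiv ℝ f z (e i))
        (fderiv ℝ f z (e i))) (Λ z) := by
    rw [hS]; simp only [map_add, map_sub, map_sum, add_apply, sub_apply, sum_apply]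
  simp only [map_neg, map_sub, map_sum, neg_apply, sub_apply, sum_apply, pairΛ,
    Finset.sum_add_distrib, Finset.sum_sub_distrib, variationForm]
  rw [sy (fderiv ℝ f z T) (cov (chr G) f Λ z ζ)]
  linarith

end Variation

/-! ### Jacobi's formula and the coordinate expression of the divergence. -/

section Divergence

/-- Jacobi's formula for the derivative of a determinant. -/
lemma hasDerivAt_det {ι : Type*} [Fintype ι] [DecidableEq ι] {M : ℝ → Matrix ι ι ℝ}
    {M' : Matrix ι ι ℝ} {s : ℝ} (h : ∀ i j, HasDerivAt (fun s ↦ M s i j) (M' i j) s) :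
    HasDerivAt (fun s ↦ (M s).det) ((M s).adjugate * M').trace s := by
  -- The product rule in the Leibniz expansion differentiates one column at a time. By Cramer's
  -- rule, the determinant with column `i` replaced by that of `M'` is the `i`-th diagonal entry of
  -- the adjugate times `M'`.
  have key : ((M s).adjugate * M').trace = ∑ σ : Equiv.Perm ι, Equiv.Perm.sign σ •
      ∑ i, (∏ j ∈ Finset.univ.erase i, M s (σ j) j) • M' (σ i) i := by
    have h1 : ∀ i, ((M s).adjugate * M') i i = ((M s).updateCol i fun j ↦ M' j i).det := by
      intro i
      rw [← Matrix.cramer_apply, Matrix.cramer_eq_adjugate_mulVec]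
      rfl
    simp only [Matrix.trace, Matrix.diag_apply, h1, Matrix.det_apply, Finset.smul_sum]
    rw [Finset.sum_comm]
    refine Finset.sum_congr rfl fun σ _ ↦ Finset.sum_congr rfl fun i _ ↦ ?_
    rw [← Finset.prod_erase_mul _ _ (Finset.mem_univ i), smul_eq_mul]
    congr 2
    · refine Finset.prod_congr rfl fun j hj ↦ ?_
      rw [Matrix.updateCol_ne (Finset.ne_of_mem_erase hj)]
    · rw [Matrix.updateCol_self]
  rw [key]
  simp only [Matrix.det_apply]
  exact HasDerivAt.fun_sum fun σ _ ↦
    (HasDerivAt.fun_finsetProd fun i _ ↦ h (σ i) i).const_smul (Equiv.Perm.sign σ)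

variable {k : ℕ} {G : Model k → Model k →L[ℝ] Model k →L[ℝ] ℝ} {D : Set (Model k)}
  {ι : Type*} [Fintype ι]

/-- The coordinate vector `∂_a` of Euclidean space. -/
abbrev coordVec (a : Fin k) : Model k := EuclideanSpace.single a (1 : ℝ)

lemma sum_coord_smul_coordVec (u : Model k) : ∑ a, u a • coordVec a = u := by
  ext b
  simp [coordVec, Pi.single_apply]

/-- The coefficients of the inverse of the metric `G`. -/
def invMetric (G : Model k → Model k →L[ℝ] Model k →L[ℝ] ℝ) (y : Model k) (a b : Fin k) : ℝ :=
  (G y).inverse (EuclideanSpace.proj a) b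

/-- The Gram matrix of the coordinate vectors. -/
def gram (G : Model k → Model k →L[ℝ] Model k →L[ℝ] ℝ) (y : Model k) : Matrix (Fin k) (Fin k) ℝ :=
  Matrix.of fun a b ↦ G y (coordVec a) (coordVec b)

lemma contDiffAt_invMetric (hG : IsMetricOn G D) {y : Model k} (hy : y ∈ D) (a b : Fin k) :
    ContDiffAt ℝ ∞ (fun y ↦ invMetric G y a b) y :=
  (EuclideanSpace.proj (𝕜 := ℝ) b).contDiff.contDiffAt.comp y
    ((hG.contDiffAt_inverse hy).clm_apply contDiffAt_const)

lemma contDiffAt_gram (hG : IsMetricOn G D) {y : Model k} (hy : y ∈ D) (a b : Fin k) :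
    ContDiffAt ℝ ∞ (fun y ↦ gram G y a b) y :=
  ((hG.contDiffAt hy).clm_apply contDiffAt_const).clm_apply contDiffAt_const

lemma contDiffAt_det_gram (hG : IsMetricOn G D) {y : Model k} (hy : y ∈ D) :
    ContDiffAt ℝ ∞ (fun y ↦ (gram G y).det) y := by
  simp only [Matrix.det_apply]
  exact ContDiffAt.sum fun σ _ ↦ (contDiffAt_prod fun i _ ↦ contDiffAt_gram hG hy _ _).const_smul _

lemma metric_eq_sum_gram (y u v : Model k) :
    G y u v = ∑ a, ∑ b, u a * gram G y a b * v b := by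
  conv_lhs => rw [← sum_coord_smul_coordVec u, ← sum_coord_smul_coordVec v]
  simp only [map_sum, map_smul, sum_apply, smul_apply, smul_eq_mul, gram, Matrix.of_apply,
    Finset.mul_sum]
  rw [Finset.sum_comm]
  exact Finset.sum_congr rfl fun a _ ↦ Finset.sum_congr rfl fun b _ ↦ by ring

lemma det_gram_pos (hG : IsMetricOn G D) {y : Model k} (hy : y ∈ D) : 0 < (gram G y).det := by
  refine Matrix.PosDef.det_pos (Matrix.PosDef.of_dotProduct_mulVec_pos ?_ ?_)
  · ext a b
    simp [gram, hG.symm y hy (coordVec a)]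
  · intro x hx
    have hx' : (WithLp.toLp 2 x : Model k) ≠ 0 := fun h ↦ hx (by
      simpa using congrArg WithLp.ofLp h)
    have := hG.pos y hy _ hx'
    rw [metric_eq_sum_gram] at this
    simpa [dotProduct, Matrix.mulVec, Finset.mul_sum, mul_assoc] using this

lemma invMetric_mul_gram (hG : IsMetricOn G D) {y : Model k} (hy : y ∈ D) :
    Matrix.of (invMetric G y) * gram G y = 1 := by
  ext a c
  have h := hG.apply_inverse hy (EuclideanSpace.proj a) (coordVec c)
  rw [← sum_coord_smul_coordVec ((G y).inverse _)] at h
  simp only [map_sum, map_smul, sum_apply, smul_apply, smul_eq_mul] at h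
  rw [Matrix.mul_apply]
  simp only [Matrix.of_apply, invMetric, gram]
  rw [h]
  simp [coordVec, Matrix.one_apply]

/-- Orthonormality is used in coordinates only as the expansion `∑ i, G y u (e i) • e i = u`, which
needs neither a basis structure nor a particular index type. -/
lemma inverse_eq_sum (hG : IsMetricOn G D) {y : Model k} (hy : y ∈ D) {e : ι → Model k}
    (he : ∀ u, ∑ i, G y u (e i) • e i = u) (l : Model k →L[ℝ] ℝ) :
    (G y).inverse l = ∑ i, l (e i) • e i := by
  rw [← he ((G y).inverse l)]
  simp only [hG.apply_inverse hy]

/-- The trace of a bilinear map with respect to an orthonormal basis, in coordinates. -/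
lemma sum_orthonormal_eq (hG : IsMetricOn G D) {y : Model k} (hy : y ∈ D) {e : ι → Model k}
    (he : ∀ u, ∑ i, G y u (e i) • e i = u) {H : Type*} [AddCommGroup H] [Module ℝ H]
    (B : Model k →ₗ[ℝ] Model k →ₗ[ℝ] H) :
    ∑ i, B (e i) (e i) = ∑ a, ∑ b, invMetric G y a b • B (coordVec a) (coordVec b) := by
  -- g^{ab} = ∑ e_i^a e_i^b. This is why a trace over pointwise chosen bases can still depend
  -- smoothly on the point.
  have h1 : ∀ a b, invMetric G y a b = ∑ i, e i a * e i b := by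
    intro a b
    rw [invMetric, inverse_eq_sum hG hy he]
    simp [Finset.sum_apply]
  have h2 : ∀ i, B (e i) (e i) =
      ∑ a, ∑ b, (e i a * e i b) • B (coordVec a) (coordVec b) := by
    intro i
    conv_lhs => rw [← sum_coord_smul_coordVec (e i)]
    simp only [map_sum, map_smul, LinearMap.sum_apply, LinearMap.smul_apply, Finset.smul_sum,
      smul_smul]
    rw [Finset.sum_comm]
    exact Finset.sum_congr rfl fun a _ ↦ Finset.sum_congr rfl fun b _ ↦ by rw [mul_comm]
  simp only [h1, h2, Finset.sum_smul]
  rw [Finset.sum_comm]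
  refine Finset.sum_congr rfl fun a _ ↦ ?_
  rw [Finset.sum_comm]

/-- Basis independence of the trace; it converts ∑ ∂_b X^b into a sum over the orthonormal vectors.
-/
lemma sum_coord_eq_sum_metric {y : Model k} {e : ι → Model k}
    (he : ∀ u, ∑ i, G y u (e i) • e i = u) (A : Model k →L[ℝ] Model k) :
    ∑ b, A (coordVec b) b = ∑ i, G y (A (e i)) (e i) := by
  have h1 : ∀ i, G y (A (e i)) (e i) = ∑ b, e i b * G y (A (coordVec b)) (e i) := by
    intro i
    have h := congrArg (fun u ↦ G y (A u) (e i)) (sum_coord_smul_coordVec (e i))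
    simp only [map_sum, map_smul, sum_apply, smul_apply, smul_eq_mul] at h
    exact h.symm
  simp only [h1]
  rw [Finset.sum_comm]
  refine Finset.sum_congr rfl fun b _ ↦ ?_
  conv_lhs => rw [← he (A (coordVec b))]
  simp [Finset.sum_apply, mul_comm]

/-- Jacobi's formula along the line `y + s • X`, with adjugate equal to det · g⁻¹, gives ∂_X log
√det = ½ tr(g⁻¹ ∂_X g). The trace is then rewritten over `e`. -/
lemma fderiv_sqrt_det_gram (hG : IsMetricOn G D) {y : Model k} (hy : y ∈ D) {e : ι → Model k}
    (he : ∀ u, ∑ i, G y u (e i) • e i = u) (X : Model k) :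
    fderiv ℝ (fun y ↦ √(gram G y).det) y X =
      √(gram G y).det * ((1 / 2) * ∑ i, fderiv ℝ G y X (e i) (e i)) := by
  have hpos := det_gram_pos hG hy
  have hd := differentiableAt_of_contDiffAt (contDiffAt_det_gram hG hy)
  have hline : HasDerivAt (fun s : ℝ ↦ y + s • X) X 0 := by
    simpa using ((hasDerivAt_id (0 : ℝ)).smul_const X).const_add y
  have hentry : ∀ a b, HasDerivAt (fun s : ℝ ↦ gram G (y + s • X) a b)
      (fderiv ℝ G y X (coordVec a) (coordVec b)) 0 := by
    intro a b
    have h1 := (differentiableAt_of_contDiffAt (contDiffAt_gram hG hy a b)).hasFDerivAt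
    have h2 : fderiv ℝ (fun y ↦ gram G y a b) y X = fderiv ℝ G y X (coordVec a) (coordVec b) :=
      fderiv_metric_apply hG hy _ _ _
    rw [← h2]
    exact HasFDerivAt.comp_hasDerivAt (0 : ℝ) (f := fun s : ℝ ↦ y + s • X)
      (by simpa using h1) hline
  have hdet := hasDerivAt_det (M := fun s ↦ gram G (y + s • X))
    (M' := Matrix.of fun a b ↦ fderiv ℝ G y X (coordVec a) (coordVec b)) hentry
  have hdet' : HasDerivAt (fun s : ℝ ↦ (gram G (y + s • X)).det)
      (fderiv ℝ (fun y ↦ (gram G y).det) y X) 0 :=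
    HasFDerivAt.comp_hasDerivAt (0 : ℝ) (f := fun s : ℝ ↦ y + s • X)
      (l := fun y ↦ (gram G y).det) (by simpa using hd.hasFDerivAt) hline
  have huniq := hdet'.unique hdet
  have hadj : (gram G y).adjugate = (gram G y).det • Matrix.of (invMetric G y) := by
    have h1 := Matrix.mul_adjugate (gram G y)
    calc (gram G y).adjugate
        = (Matrix.of (invMetric G y) * gram G y) * (gram G y).adjugate := by
          rw [invMetric_mul_gram hG hy, Matrix.one_mul]
      _ = (gram G y).det • Matrix.of (invMetric G y) := by
          rw [Matrix.mul_assoc, h1, Matrix.mul_smul, Matrix.mul_one]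
  have htr := sum_orthonormal_eq hG hy he
    (LinearMap.mk₂ ℝ (fun u v ↦ fderiv ℝ G y X u v) (by simp) (by simp) (by simp) (by simp))
  simp only [LinearMap.mk₂_apply, smul_eq_mul] at htr
  have hval : fderiv ℝ (fun y ↦ (gram G y).det) y X =
      (gram G y).det * ∑ i, fderiv ℝ G y X (e i) (e i) := by
    rw [huniq, htr]
    simp only [zero_smul, add_zero, hadj, Matrix.smul_mul, Matrix.trace_smul, smul_eq_mul]
    congr 1
    simp only [Matrix.trace, Matrix.diag_apply, Matrix.mul_apply, Matrix.of_apply]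
    refine Finset.sum_congr rfl fun a _ ↦ Finset.sum_congr rfl fun b _ ↦ ?_
    rw [fderiv_metric_symm hG hy]
  rw [fderiv_sqrt hd hpos.ne']
  simp only [smul_apply, smul_eq_mul, hval]
  have hs : √(gram G y).det ≠ 0 := (Real.sqrt_pos.2 hpos).ne'
  have hs2 : √(gram G y).det * √(gram G y).det = (gram G y).det := Real.mul_self_sqrt hpos.le
  field_simp
  rw [sq, hs2]

/-- The divergence of the vector field dual to a one-form `α`, in coordinates. -/
lemma divergence_formula (hG : IsMetricOn G D) {y : Model k} (hy : y ∈ D) {e : ι → Model k}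
    (he : ∀ u, ∑ i, G y u (e i) • e i = u) {α : Model k → Model k →L[ℝ] ℝ}
    (hα : DifferentiableAt ℝ α y) :
    ∑ b, fderiv ℝ (fun y ↦ √(gram G y).det * (G y).inverse (α y) b) y (coordVec b) =
      √(gram G y).det * (∑ i, fderiv ℝ α y (e i) (e i) - α y (∑ i, chr G y (e i) (e i))) := by
  set X : Model k → Model k := fun y ↦ (G y).inverse (α y) with hX
  have hXd : DifferentiableAt ℝ X y :=
    (differentiableAt_of_contDiffAt (hG.contDiffAt_inverse hy)).clm_apply hα
  have hsd : DifferentiableAt ℝ (fun y ↦ √(gram G y).det) y :=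
    (differentiableAt_of_contDiffAt (contDiffAt_det_gram hG hy)).sqrt (det_gram_pos hG hy).ne'
  have hGd := differentiableAt_of_contDiffAt (hG.contDiffAt hy)
  have hαd : ∀ u v, fderiv ℝ α y u v = fderiv ℝ G y u (X y) v + G y (fderiv ℝ X y u) v := by
    intro u v
    have h1 : α =ᶠ[nhds y] fun y ↦ G y (X y) := by
      filter_upwards [hG.isOpen.mem_nhds hy] with y' hy'
      ext w
      exact (hG.apply_inverse hy' _ _).symm
    rw [h1.fderiv_eq, fderiv_clm_apply hGd hXd]
    simp only [add_apply, ContinuousLinearMap.comp_apply, ContinuousLinearMap.flip_apply]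
    ring
  have hcomp : ∀ b u, fderiv ℝ (fun y ↦ X y b) y u = fderiv ℝ X y u b := by
    intro b u
    have := ((EuclideanSpace.proj (𝕜 := ℝ) b).hasFDerivAt.comp y hXd.hasFDerivAt).fderiv
    exact DFunLike.congr_fun this u
  have hXb : ∀ b, DifferentiableAt ℝ (fun y ↦ X y b) y := fun b ↦
    (EuclideanSpace.proj (𝕜 := ℝ) b).differentiableAt.comp y hXd
  have hprod : ∀ b, fderiv ℝ (fun y ↦ √(gram G y).det * X y b) y (coordVec b) =
      √(gram G y).det * fderiv ℝ X y (coordVec b) b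
        + X y b * fderiv ℝ (fun y ↦ √(gram G y).det) y (coordVec b) := by
    intro b
    rw [fderiv_fun_mul hsd (hXb b)]
    simp only [add_apply, smul_apply, smul_eq_mul, hcomp]
  have hXsum : ∑ b, X y b * fderiv ℝ (fun y ↦ √(gram G y).det) y (coordVec b) =
      fderiv ℝ (fun y ↦ √(gram G y).det) y (X y) := by
    conv_rhs => rw [← sum_coord_smul_coordVec (X y)]
    simp only [map_sum, map_smul, smul_eq_mul]
  rw [Finset.sum_congr rfl fun b _ ↦ hprod b, Finset.sum_add_distrib, ← Finset.mul_sum, hXsum,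
    fderiv_sqrt_det_gram hG hy he, sum_coord_eq_sum_metric he, ← mul_add]
  congr 1
  have hαX : ∀ w, α y w = G y w (X y) := fun w ↦ by
    rw [hG.symm y hy]; exact (hG.apply_inverse hy _ _).symm
  -- Since α = G(X, ·), the value α(Γ(e_i, e_i)) is ∂_{e_i}G(e_i, X) - ½ ∂_X G(e_i, e_i). The first
  -- part cancels the derivative of the metric in `hαd`; the second is the derivative of the volume
  -- density.
  simp only [hαd, hαX, map_sum, sum_apply, metric_chr hG hy, Finset.sum_add_distrib]
  have : ∀ i, fderiv ℝ G y (e i) (X y) (e i) = fderiv ℝ G y (e i) (e i) (X y) := fun i ↦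
    fderiv_metric_symm hG hy _ _ _
  simp only [this, ← Finset.mul_sum, Finset.sum_sub_distrib, Finset.sum_add_distrib]
  ring

end Divergence

/-! ### Tangent vectors and derivatives in charts. -/

section Charts

variable {k : ℕ} {N : Type*} [TopologicalSpace N] [ChartedSpace (Model k) N]

lemma chart_mem_target {q x : N} (hx : x ∈ (chartAt (Model k) q).source) :
    extChartAt (𝓡 k) q x ∈ (extChartAt (𝓡 k) q).target :=
  (extChartAt (𝓡 k) q).map_source (by simpa using hx)

lemma chart_symm_mem_source {q : N} {y : Model k} (hy : y ∈ (extChartAt (𝓡 k) q).target) :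
    (extChartAt (𝓡 k) q).symm y ∈ (chartAt (Model k) q).source := by
  have := (extChartAt (𝓡 k) q).map_target hy
  simpa using this

lemma chart_left_inv {q x : N} (hx : x ∈ (chartAt (Model k) q).source) :
    (extChartAt (𝓡 k) q).symm (extChartAt (𝓡 k) q x) = x :=
  (extChartAt (𝓡 k) q).left_inv (by simpa using hx)

lemma isOpen_target (q : N) : IsOpen (extChartAt (𝓡 k) q).target := isOpen_extChartAt_target q

lemma source_mem_nhds {q x : N} (hx : x ∈ (chartAt (Model k) q).source) :
    (chartAt (Model k) q).source ∈ nhds x := (chartAt (Model k) q).open_source.mem_nhds hx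

/-- The change of coordinates from the chart at `r` to the chart at `q`. -/
def trans (k : ℕ) {N : Type*} [TopologicalSpace N] [ChartedSpace (Model k) N] (r q : N)
    (y : Model k) : Model k :=
  extChartAt (𝓡 k) q ((extChartAt (𝓡 k) r).symm y)

lemma trans_chart {r q x : N} (hr : x ∈ (chartAt (Model k) r).source) :
    trans k r q (extChartAt (𝓡 k) r x) = extChartAt (𝓡 k) q x := by
  rw [trans, chart_left_inv hr]

variable [IsManifold (𝓡 k) ∞ N]

variable (k) in
/-- The components of a tangent vector at `x` in the preferred chart at `q`. -/
def crd (q x : N) : TangentSpace (𝓡 k) x →L[ℝ] Model k :=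
  (trivializationAt (Model k) (fun p : N ↦ TangentSpace (𝓡 k) p) q).continuousLinearMapAt ℝ x

variable (k) in
/-- The tangent vector at `x` with given components in the preferred chart at `q`. -/
def vec (q x : N) : Model k →L[ℝ] TangentSpace (𝓡 k) x :=
  (trivializationAt (Model k) (fun p : N ↦ TangentSpace (𝓡 k) p) q).symmL ℝ x

lemma crd_vec {q x : N} (hx : x ∈ (chartAt (Model k) q).source) (u : Model k) :
    crd k q x (vec k q x u) = u :=
  Trivialization.continuousLinearMapAt_symmL _ hx u

lemma vec_crd {q x : N} (hx : x ∈ (chartAt (Model k) q).source) (v : TangentSpace (𝓡 k) x) :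
    vec k q x (crd k q x v) = v :=
  Trivialization.symmL_continuousLinearMapAt _ hx v

lemma trivializationAt_snd {q x : N} (hx : x ∈ (chartAt (Model k) q).source)
    (v : TangentSpace (𝓡 k) x) :
    (trivializationAt (Model k) (fun p : N ↦ TangentSpace (𝓡 k) p) q ⟨x, v⟩).2 = crd k q x v :=
  (Trivialization.continuousLinearMapAt_apply_of_mem ℝ _ hx v).symm

lemma trivializationAt_symm {q x : N} (hx : x ∈ (chartAt (Model k) q).source) (u : Model k) :
    (trivializationAt (Model k) (fun p : N ↦ TangentSpace (𝓡 k) p) q).symm x u = vec k q x u :=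
  (Trivialization.symmL_apply _ hx u).symm

lemma constField_eq {q x : N} (u : TangentSpace (𝓡 k) q)
    (hx : x ∈ (chartAt (Model k) q).source) : constField u x = vec k q x (crd k q q u) := by
  rw [constField, FiberBundle.extend, trivializationAt_snd (mem_chart_source _ q),
    trivializationAt_symm hx]

lemma crd_constField {q x : N} (u : TangentSpace (𝓡 k) q)
    (hx : x ∈ (chartAt (Model k) q).source) : crd k q x (constField u x) = crd k q q u := by
  rw [constField_eq u hx, crd_vec hx]

lemma crd_eq_mvfderiv {q x : N} (hx : x ∈ (chartAt (Model k) q).source)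
    (v : TangentSpace (𝓡 k) x) : crd k q x v = mvfderiv (𝓡 k) (extChartAt (𝓡 k) q) x v := by
  rw [crd, TangentBundle.continuousLinearMapAt_trivializationAt hx]
  rfl

lemma contMDiffAt_chart {q x : N} (hx : x ∈ (chartAt (Model k) q).source) :
    ContMDiffAt (𝓡 k) 𝓘(ℝ, Model k) ∞ (extChartAt (𝓡 k) q) x :=
  contMDiffAt_extChartAt' hx

lemma contMDiffAt_chart_symm {q : N} {y : Model k} (hy : y ∈ (extChartAt (𝓡 k) q).target) :
    ContMDiffAt 𝓘(ℝ, Model k) (𝓡 k) ∞ (extChartAt (𝓡 k) q).symm y :=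
  (contMDiffOn_extChartAt_symm q).contMDiffAt ((isOpen_target q).mem_nhds hy)

/-- The derivative of a function on a manifold, computed in a chart. -/
lemma mvfderiv_eq_fderiv {F : Type*} [NormedAddCommGroup F] [NormedSpace ℝ F] {g : N → F}
    {q x : N} (hx : x ∈ (chartAt (Model k) q).source)
    (hg : DifferentiableAt ℝ (fun y ↦ g ((extChartAt (𝓡 k) q).symm y)) (extChartAt (𝓡 k) q x))
    (X : TangentSpace (𝓡 k) x) :
    mvfderiv (𝓡 k) g x X =
      fderiv ℝ (fun y ↦ g ((extChartAt (𝓡 k) q).symm y)) (extChartAt (𝓡 k) q x) (crd k q x X) := by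
  have h1 : HasMFDerivAt (𝓡 k) 𝓘(ℝ, Model k) (extChartAt (𝓡 k) q) x
      (mfderiv (𝓡 k) 𝓘(ℝ, Model k) (extChartAt (𝓡 k) q) x) :=
    ((contMDiffAt_chart hx).mdifferentiableAt (by simp)).hasMFDerivAt
  have h2 := HasMFDerivAt.comp x hg.hasFDerivAt.hasMFDerivAt h1
  have h3 : g =ᶠ[nhds x]
      (fun y ↦ g ((extChartAt (𝓡 k) q).symm y)) ∘ (extChartAt (𝓡 k) q) := by
    filter_upwards [source_mem_nhds hx] with x' hx'
    simp only [Function.comp_apply, chart_left_inv hx']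
  have h4 := (h2.congr_of_eventuallyEq h3).mfderiv
  rw [crd_eq_mvfderiv hx, mvfderiv, h4]
  rfl

lemma contDiffAt_trans {r q x : N} (hr : x ∈ (chartAt (Model k) r).source)
    (hq : x ∈ (chartAt (Model k) q).source) :
    ContDiffAt ℝ ∞ (trans k r q) (extChartAt (𝓡 k) r x) := by
  have h1 := contMDiffAt_chart_symm (chart_mem_target hr)
  have h2 : ContMDiffAt (𝓡 k) 𝓘(ℝ, Model k) ∞ (extChartAt (𝓡 k) q)
      ((extChartAt (𝓡 k) r).symm (extChartAt (𝓡 k) r x)) := by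
    rw [chart_left_inv hr]; exact contMDiffAt_chart hq
  exact (h2.comp _ h1).contDiffAt

lemma fderiv_trans_crd {r q x : N} (hr : x ∈ (chartAt (Model k) r).source)
    (hq : x ∈ (chartAt (Model k) q).source) (v : TangentSpace (𝓡 k) x) :
    fderiv ℝ (trans k r q) (extChartAt (𝓡 k) r x) (crd k r x v) = crd k q x v := by
  rw [crd_eq_mvfderiv hq]
  exact (mvfderiv_eq_fderiv hr (differentiableAt_of_contDiffAt (contDiffAt_trans hr hq)) v).symm

end Charts

/-! ### The Riemannian metric and its Christoffel symbols in charts. -/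

section MetricInCharts

variable {k : ℕ} {N : Type*} [TopologicalSpace N] [ChartedSpace (Model k) N]
  [IsManifold (𝓡 k) ∞ N] [RiemannianBundle (fun q : N ↦ TangentSpace (𝓡 k) q)]

variable (k) in
/-- The metric in the preferred chart at `q`. -/
def metricIn (q : N) (y : Model k) : Model k →L[ℝ] Model k →L[ℝ] ℝ :=
  (LinearMap.mk₂ ℝ (fun u v : Model k ↦
    (inner ℝ (vec k q ((extChartAt (𝓡 k) q).symm y) u)
      (vec k q ((extChartAt (𝓡 k) q).symm y) v) : ℝ))
    (fun u u' v ↦ by rw [map_add, inner_add_left])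
    (fun c u v ↦ by rw [map_smul, real_inner_smul_left, smul_eq_mul])
    (fun u v v' ↦ by rw [map_add, inner_add_right])
    (fun c u v ↦ by rw [map_smul, real_inner_smul_right, smul_eq_mul])).toContinuousBilinearMap

lemma metricIn_apply (q : N) (y u v : Model k) :
    metricIn k q y u v = inner ℝ (vec k q ((extChartAt (𝓡 k) q).symm y) u)
      (vec k q ((extChartAt (𝓡 k) q).symm y) v) := rfl

lemma inner_eq_metricIn {q x : N} (hx : x ∈ (chartAt (Model k) q).source)
    (v w : TangentSpace (𝓡 k) x) :
    inner ℝ v w = metricIn k q (extChartAt (𝓡 k) q x) (crd k q x v) (crd k q x w) := by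
  rw [metricIn_apply, chart_left_inv hx, vec_crd hx, vec_crd hx]

/-- The metrics in two charts correspond under the change of coordinates. -/
lemma metricIn_trans {r q x : N} (hr : x ∈ (chartAt (Model k) r).source)
    (hq : x ∈ (chartAt (Model k) q).source) (u v : Model k) :
    metricIn k r (extChartAt (𝓡 k) r x) u v =
      metricIn k q (trans k r q (extChartAt (𝓡 k) r x))
        (fderiv ℝ (trans k r q) (extChartAt (𝓡 k) r x) u)
        (fderiv ℝ (trans k r q) (extChartAt (𝓡 k) r x) v) := by
  rw [trans_chart hr, ← crd_vec hr u, ← crd_vec hr v, fderiv_trans_crd hr hq,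
    fderiv_trans_crd hr hq, ← inner_eq_metricIn hr, ← inner_eq_metricIn hq]

variable [IsContMDiffRiemannianBundle (𝓡 k) ∞ (Model k) (fun q : N ↦ TangentSpace (𝓡 k) q)]

/-- Fields with constant components in the chart are smooth sections of the tangent bundle, so their
inner products are smooth; evaluating on constant vectors suffices for smoothness of an
operator-valued map in finite dimension. -/
lemma isMetricOn_metricIn (q : N) :
    IsMetricOn (metricIn k q) (extChartAt (𝓡 k) q).target where
  isOpen := isOpen_target q
  contDiffOn := by
    refine contDiffOn_clm_apply.2 fun u ↦ contDiffOn_clm_apply.2 fun v ↦ ?_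
    intro y hy
    refine ContDiffAt.contDiffWithinAt ?_
    have hx := chart_symm_mem_source hy
    have hsec : ∀ u : Model k, ContMDiffAt (𝓡 k) ((𝓡 k).prod 𝓘(ℝ, Model k)) ∞
        (fun x : N ↦ (⟨x, vec k q x u⟩ : TotalSpace (Model k) (fun p : N ↦ TangentSpace (𝓡 k) p)))
        ((extChartAt (𝓡 k) q).symm y) := by
      intro u
      refine ((trivializationAt (Model k) (fun p : N ↦ TangentSpace (𝓡 k) p)
        q).contMDiffAt_section_iff hx).2 ?_
      refine contMDiffAt_const (c := u) |>.congr_of_eventuallyEq ?_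
      filter_upwards [source_mem_nhds hx] with x' hx'
      rw [trivializationAt_snd hx', crd_vec hx']
    have := ((hsec u).inner_bundle (hsec v)).comp y (contMDiffAt_chart_symm hy)
    exact this.contDiffAt
  symm y _ u v := by
    rw [metricIn_apply, metricIn_apply, real_inner_comm]
  pos y hy u hu := by
    rw [metricIn_apply]
    have hx := chart_symm_mem_source hy
    refine real_inner_self_pos.2 fun h ↦ hu ?_
    rw [← crd_vec hx u, h, map_zero]

variable (k) in
/-- The Christoffel symbols in the preferred chart at `q`. -/
def chrIn (q : N) : Model k → Model k →L[ℝ] Model k →L[ℝ] Model k := chr (metricIn k q)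

/-- The fields `constField` have constant components in the chart at `q`, so each derivative in the
definition is a derivative of metric coefficients. -/
lemma christoffelFirst_eq (q : N) (u v w : TangentSpace (𝓡 k) q) :
    christoffelFirst q u v w =
      koszul (metricIn k q) (extChartAt (𝓡 k) q q) (crd k q q u) (crd k q q v) (crd k q q w) := by
  have hq := mem_chart_source (Model k) q
  have hG := isMetricOn_metricIn (k := k) q
  have hy := chart_mem_target hq
  have key : ∀ a b c : TangentSpace (𝓡 k) q,
      mvfderiv (𝓡 k) (fun q' : N ↦ (inner ℝ (constField b q') (constField c q') : ℝ)) q a =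
        fderiv ℝ (metricIn k q) (extChartAt (𝓡 k) q q) (crd k q q a) (crd k q q b)
          (crd k q q c) := by
    intro a b c
    have heq : (fun y ↦ (inner ℝ (constField b ((extChartAt (𝓡 k) q).symm y))
        (constField c ((extChartAt (𝓡 k) q).symm y)) : ℝ)) =ᶠ[nhds (extChartAt (𝓡 k) q q)]
        fun y ↦ metricIn k q y (crd k q q b) (crd k q q c) := by
      filter_upwards [(isOpen_target q).mem_nhds hy] with y hy
      rw [constField_eq b (chart_symm_mem_source hy), constField_eq c (chart_symm_mem_source hy),
        metricIn_apply]
    have hd : ContDiffAt ℝ ∞ (fun y ↦ metricIn k q y (crd k q q b) (crd k q q c))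
        (extChartAt (𝓡 k) q q) :=
      ((hG.contDiffAt hy).clm_apply contDiffAt_const).clm_apply contDiffAt_const
    rw [mvfderiv_eq_fderiv hq ((differentiableAt_of_contDiffAt hd).congr_of_eventuallyEq heq),
      heq.fderiv_eq, fderiv_metric_apply hG hy]
  rw [christoffelFirst, key, key, key, koszul_apply]

/-- The defining sum is the orthonormal expansion of the one vector whose inner products are the
Christoffel symbols of the first kind. -/
lemma crd_christoffel (q : N) (u v : TangentSpace (𝓡 k) q) :
    crd k q q (christoffel q u v) =
      chrIn k q (extChartAt (𝓡 k) q q) (crd k q q u) (crd k q q v) := by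
  have hq := mem_chart_source (Model k) q
  have hG := isMetricOn_metricIn (k := k) q
  have hy := chart_mem_target hq
  set z : TangentSpace (𝓡 k) q :=
    vec k q q (chrIn k q (extChartAt (𝓡 k) q q) (crd k q q u) (crd k q q v)) with hz
  have h : ∀ w, christoffelFirst q u v w = inner ℝ w z := by
    intro w
    rw [christoffelFirst_eq, koszul_apply, real_inner_comm, inner_eq_metricIn hq, hz, crd_vec hq,
      chrIn, metric_chr hG hy]
  have hc : christoffel q u v = z := by
    rw [christoffel]
    simp only [h]
    exact (onb k q).sum_repr' z
  rw [hc, hz, crd_vec hq]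

end MetricInCharts

/-! ### Chain rule, product rule and coordinate change for covariant derivatives. -/

section CovariantCalculus

variable {F : Type*} [NormedAddCommGroup F] [NormedSpace ℝ F]
  {P : Type*} [NormedAddCommGroup P] [NormedSpace ℝ P]
  {Q : Type*} [NormedAddCommGroup Q] [NormedSpace ℝ Q]
  {Γ : F → F →L[ℝ] F →L[ℝ] F} {f W : P → F} {z : P}

lemma cov_congr_map {f' W' : P → F} (hf : f =ᶠ[nhds z] f') (hW : W =ᶠ[nhds z] W') (ξ : P) :
    cov Γ f W z ξ = cov Γ f' W' z ξ := by
  simp only [cov, hf.fderiv_eq, hW.fderiv_eq, hf.eq_of_nhds, hW.eq_of_nhds]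

lemma cov_comp {j : Q → P} {y : Q} (hj : DifferentiableAt ℝ j y)
    (hf : DifferentiableAt ℝ f (j y)) (hW : DifferentiableAt ℝ W (j y)) (u : Q) :
    cov Γ (fun y ↦ f (j y)) (fun y ↦ W (j y)) y u = cov Γ f W (j y) (fderiv ℝ j y u) := by
  have h1 : fderiv ℝ (fun y ↦ f (j y)) y = (fderiv ℝ f (j y)).comp (fderiv ℝ j y) :=
    fderiv_comp y hf hj
  have h2 : fderiv ℝ (fun y ↦ W (j y)) y = (fderiv ℝ W (j y)).comp (fderiv ℝ j y) :=
    fderiv_comp y hW hj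
  simp only [cov, h1, h2, ContinuousLinearMap.comp_apply]

/-- The covariant derivative as a linear map of the direction. -/
def covL (Γ : F → F →L[ℝ] F →L[ℝ] F) (f W : P → F) (z : P) : P →L[ℝ] F :=
  fderiv ℝ W z + ((Γ (f z)).flip (W z)).comp (fderiv ℝ f z)

lemma covL_apply (ξ : P) : covL Γ f W z ξ = cov Γ f W z ξ := rfl

lemma contDiffAt_covL (hΓ : ContDiffAt ℝ ∞ Γ (f z)) (hf : ContDiffAt ℝ ∞ f z)
    (hW : ContDiffAt ℝ ∞ W z) : ContDiffAt ℝ ∞ (covL Γ f W) z := by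
  have hΓf : ContDiffAt ℝ ∞ (fun z ↦ Γ (f z)) z := hΓ.comp z hf
  have hflip : ContDiffAt ℝ ∞ (fun z ↦ (Γ (f z)).flip) z :=
    ((ContinuousLinearMap.flipₗᵢ ℝ F F F).toContinuousLinearEquiv :
      (F →L[ℝ] F →L[ℝ] F) →L[ℝ] (F →L[ℝ] F →L[ℝ] F)).contDiff.contDiffAt.comp z hΓf
  exact (contDiffAt_fderiv hW).add ((hflip.clm_apply hW).clm_comp (contDiffAt_fderiv hf))

/-- The product rule for a vector-valued one-form evaluated on a field. The extra term is what
subtracting `A (∇_X Y)` removes, leaving an expression tensorial in `Y`. -/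
lemma cov_clm_apply {A : P → Q →L[ℝ] F} {Y : P → Q} (hA : DifferentiableAt ℝ A z)
    (hY : DifferentiableAt ℝ Y z) (ξ : P) :
    cov Γ f (fun z ↦ A z (Y z)) z ξ = cov Γ f (fun z' ↦ A z' (Y z)) z ξ + A z (fderiv ℝ Y z ξ) := by
  simp only [cov]
  rw [fderiv_clm_apply hA hY, fderiv_clm_apply hA (differentiableAt_const _)]
  simp only [add_apply, ContinuousLinearMap.comp_apply, ContinuousLinearMap.flip_apply,
    fderiv_fun_const, Pi.zero_apply, zero_apply, map_zero]
  abel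

/-- Covariant derivatives transform as vectors under a change of coordinates. -/
lemma cov_transform {F' : Type*} [NormedAddCommGroup F'] [NormedSpace ℝ F']
    [FiniteDimensional ℝ F] [FiniteDimensional ℝ F'] {G : F → F →L[ℝ] F →L[ℝ] ℝ} {D : Set F}
    {G' : F' → F' →L[ℝ] F' →L[ℝ] ℝ} {D' : Set F'}
    (hG : IsMetricOn G D) (hG' : IsMetricOn G' D') {ψ : F' → F} {f' W' : P → F'} (hy : f' z ∈ D')
    (hψy : ψ (f' z) ∈ D) (hψ : ContDiffAt ℝ ∞ ψ (f' z))
    (hsurj : Function.Surjective (fderiv ℝ ψ (f' z)))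
    (hpull : ∀ᶠ y' in nhds (f' z), ∀ u v,
      G' y' u v = G (ψ y') (fderiv ℝ ψ y' u) (fderiv ℝ ψ y' v))
    (hf' : DifferentiableAt ℝ f' z) (hW' : DifferentiableAt ℝ W' z)
    (hf : f =ᶠ[nhds z] fun z ↦ ψ (f' z)) (hW : W =ᶠ[nhds z] fun z ↦ fderiv ℝ ψ (f' z) (W' z))
    (ξ : P) :
    cov (chr G) f W z ξ = fderiv ℝ ψ (f' z) (cov (chr G') f' W' z ξ) := by
  have hd := differentiableAt_of_contDiffAt (contDiffAt_fderiv hψ)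
  have h1 : fderiv ℝ (fun z ↦ ψ (f' z)) z = (fderiv ℝ ψ (f' z)).comp (fderiv ℝ f' z) :=
    fderiv_comp z (differentiableAt_of_contDiffAt hψ) hf'
  have h2 : fderiv ℝ (fun z ↦ fderiv ℝ ψ (f' z)) z =
      (fderiv ℝ (fderiv ℝ ψ) (f' z)).comp (fderiv ℝ f' z) := fderiv_comp z hd hf'
  have hd2 : DifferentiableAt ℝ (fun z ↦ fderiv ℝ ψ (f' z)) z := hd.comp z hf'
  rw [cov_congr_map hf hW]
  simp only [cov]
  -- Differentiating `dψ(W')` produces a second derivative of `ψ`, exactly the inhomogeneous term in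
  -- the transformation law of the Christoffel symbols.
  rw [h1, fderiv_clm_apply hd2 hW', h2, map_add, chr_transform hG hG' hy hψy hψ hsurj hpull]
  simp only [add_apply, ContinuousLinearMap.comp_apply, ContinuousLinearMap.flip_apply]
  abel

end CovariantCalculus

/-! ### Independence of the target chart. -/

section ChangeOfCharts

variable {n : ℕ} {N : Type*} [TopologicalSpace N] [ChartedSpace (Model n) N]
  [IsManifold (𝓡 n) ∞ N]
  {P : Type*} [NormedAddCommGroup P] [NormedSpace ℝ P] {c : P → N}
  {W : ∀ z, TangentSpace (𝓡 n) (c z)} {z : P} {r q : N}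

lemma chart_comp_eventuallyEq (hc : ContinuousAt c z) (hr : c z ∈ (chartAt (Model n) r).source) :
    (fun z ↦ extChartAt (𝓡 n) q (c z)) =ᶠ[nhds z]
      fun z ↦ trans n r q (extChartAt (𝓡 n) r (c z)) := by
  filter_upwards [hc (source_mem_nhds hr)] with z' hz'
  rw [trans_chart hz']

lemma crd_comp_eventuallyEq (hc : ContinuousAt c z) (hr : c z ∈ (chartAt (Model n) r).source)
    (hq : c z ∈ (chartAt (Model n) q).source) :
    (fun z ↦ crd n q (c z) (W z)) =ᶠ[nhds z]
      fun z ↦ fderiv ℝ (trans n r q) (extChartAt (𝓡 n) r (c z)) (crd n r (c z) (W z)) := by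
  filter_upwards [hc (source_mem_nhds hr), hc (source_mem_nhds hq)] with z' hr' hq'
  rw [fderiv_trans_crd hr' hq']

lemma differentiableAt_crd_comp (hc : ContinuousAt c z)
    (hr : c z ∈ (chartAt (Model n) r).source) (hq : c z ∈ (chartAt (Model n) q).source)
    (hf : DifferentiableAt ℝ (fun z ↦ extChartAt (𝓡 n) r (c z)) z)
    (hW : DifferentiableAt ℝ (fun z ↦ crd n r (c z) (W z)) z) :
    DifferentiableAt ℝ (fun z ↦ crd n q (c z) (W z)) z := by
  have h1 : DifferentiableAt ℝ
      (fun z ↦ fderiv ℝ (trans n r q) (extChartAt (𝓡 n) r (c z))) z :=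
    (differentiableAt_of_contDiffAt (contDiffAt_fderiv (contDiffAt_trans hr hq))).comp z hf
  exact (h1.clm_apply hW).congr_of_eventuallyEq (crd_comp_eventuallyEq hc hr hq)

variable [RiemannianBundle (fun q : N ↦ TangentSpace (𝓡 n) q)]
  [IsContMDiffRiemannianBundle (𝓡 n) ∞ (Model n) (fun q : N ↦ TangentSpace (𝓡 n) q)]

/-- Independence of the chart of the covariant derivative along a map. -/
lemma cov_change_chart (hc : ContinuousAt c z) (hr : c z ∈ (chartAt (Model n) r).source)
    (hq : c z ∈ (chartAt (Model n) q).source)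
    (hf : DifferentiableAt ℝ (fun z ↦ extChartAt (𝓡 n) r (c z)) z)
    (hW : DifferentiableAt ℝ (fun z ↦ crd n r (c z) (W z)) z) (ξ : P) :
    vec n q (c z) (cov (chrIn n q) (fun z ↦ extChartAt (𝓡 n) q (c z))
        (fun z ↦ crd n q (c z) (W z)) z ξ) =
      vec n r (c z) (cov (chrIn n r) (fun z ↦ extChartAt (𝓡 n) r (c z))
        (fun z ↦ crd n r (c z) (W z)) z ξ) := by
  have hmem : extChartAt (𝓡 n) r (c z) ∈ (extChartAt (𝓡 n) r).target := chart_mem_target hr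
  have hmem' : (extChartAt (𝓡 n) r).symm (extChartAt (𝓡 n) r (c z)) ∈
      (chartAt (Model n) q).source := by rwa [chart_left_inv hr]
  have h := cov_transform (z := z) (isMetricOn_metricIn (k := n) q) (isMetricOn_metricIn (k := n) r)
    (ψ := trans n r q) (f' := fun z ↦ extChartAt (𝓡 n) r (c z))
    (W' := fun z ↦ crd n r (c z) (W z)) hmem
    (by rw [trans_chart hr]; exact chart_mem_target hq)
    (contDiffAt_trans hr hq)
    (fun v ↦ ⟨crd n r (c z) (vec n q (c z) v), by rw [fderiv_trans_crd hr hq, crd_vec hq]⟩)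
    (by
      have hcont : ContinuousAt (extChartAt (𝓡 n) r).symm (extChartAt (𝓡 n) r (c z)) :=
        (contMDiffAt_chart_symm hmem).continuousAt
      filter_upwards [(isOpen_target r).mem_nhds hmem, hcont (source_mem_nhds hmem')]
        with y hy hy' u v
      have := metricIn_trans (chart_symm_mem_source hy) hy' u v
      rwa [(extChartAt (𝓡 n) r).right_inv hy] at this)
    hf hW (chart_comp_eventuallyEq hc hr) (crd_comp_eventuallyEq hc hr hq) ξ
  rw [chrIn, h, ← crd_vec hr (cov (chr (metricIn n r)) _ _ z ξ), fderiv_trans_crd hr hq,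
    vec_crd hq]
  rfl

end ChangeOfCharts

/-! ### The induced connection of a single map in arbitrary charts. -/

section SingleMap

variable {m n : ℕ}
  {M : Type*} [TopologicalSpace M] [ChartedSpace (Model m) M] [IsManifold (𝓡 m) ∞ M]
  {N : Type*} [TopologicalSpace N] [ChartedSpace (Model n) N] [IsManifold (𝓡 n) ∞ N]

variable (m n) in
/-- A map in the preferred charts at `p` and `q`. -/
def mapIn (p : M) (q : N) (φ : M → N) (y : Model m) : Model n :=
  extChartAt (𝓡 n) q (φ ((extChartAt (𝓡 m) p).symm y))

variable (m n) in
/-- The components of a section along a map in the preferred charts at `p` and `q`. -/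
def secIn (p : M) (q : N) (φ : M → N) (W : ∀ x, TangentSpace (𝓡 n) (φ x)) (y : Model m) :
    Model n :=
  crd n q (φ ((extChartAt (𝓡 m) p).symm y)) (W ((extChartAt (𝓡 m) p).symm y))

variable {p x : M} {q : N} {φ : M → N} {W : ∀ x, TangentSpace (𝓡 n) (φ x)}

lemma mapIn_chart (hp : x ∈ (chartAt (Model m) p).source) :
    mapIn m n p q φ (extChartAt (𝓡 m) p x) = extChartAt (𝓡 n) q (φ x) := by
  rw [mapIn, chart_left_inv hp]

lemma secIn_chart (hp : x ∈ (chartAt (Model m) p).source) :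
    secIn m n p q φ W (extChartAt (𝓡 m) p x) = crd n q (φ x) (W x) := by
  rw [secIn, chart_left_inv hp]

lemma differentiableAt_mapIn (hp : x ∈ (chartAt (Model m) p).source)
    (hq : φ x ∈ (chartAt (Model n) q).source) (hφ : MDifferentiableAt (𝓡 m) (𝓡 n) φ x) :
    DifferentiableAt ℝ (mapIn m n p q φ) (extChartAt (𝓡 m) p x) := by
  have h1 := (contMDiffAt_chart_symm (chart_mem_target hp)).mdifferentiableAt
    (n := ∞) (by simp)
  have h2 : MDifferentiableAt (𝓡 m) 𝓘(ℝ, Model n) (fun x ↦ extChartAt (𝓡 n) q (φ x))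
      ((extChartAt (𝓡 m) p).symm (extChartAt (𝓡 m) p x)) := by
    rw [chart_left_inv hp]
    exact ((contMDiffAt_chart hq).mdifferentiableAt (by simp)).comp x hφ
  exact (h2.comp _ h1).differentiableAt

lemma contDiffAt_mapIn {y : Model m} (hy : y ∈ (extChartAt (𝓡 m) p).target)
    (hq : φ ((extChartAt (𝓡 m) p).symm y) ∈ (chartAt (Model n) q).source)
    (hφ : ContMDiff (𝓡 m) (𝓡 n) ∞ φ) : ContDiffAt ℝ ∞ (mapIn m n p q φ) y :=
  ((contMDiffAt_chart hq).comp y ((hφ _).comp y (contMDiffAt_chart_symm hy))).contDiffAt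

lemma crd_mfderiv (hp : x ∈ (chartAt (Model m) p).source)
    (hq : φ x ∈ (chartAt (Model n) q).source) (hφ : MDifferentiableAt (𝓡 m) (𝓡 n) φ x)
    (X : TangentSpace (𝓡 m) x) :
    crd n q (φ x) (mfderiv (𝓡 m) (𝓡 n) φ x X) =
      fderiv ℝ (mapIn m n p q φ) (extChartAt (𝓡 m) p x) (crd m p x X) := by
  have h1 := mvfderiv_eq_fderiv (g := fun x ↦ extChartAt (𝓡 n) q (φ x)) hp
    (differentiableAt_mapIn hp hq hφ) X
  rw [crd_eq_mvfderiv hq]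
  refine Eq.trans ?_ h1
  have h2 := mfderiv_comp x ((contMDiffAt_chart hq).mdifferentiableAt (n := ∞) (by simp)) hφ
  rw [mvfderiv, mvfderiv]
  change mfderiv (𝓡 n) 𝓘(ℝ, Model n) (extChartAt (𝓡 n) q) (φ x) (mfderiv (𝓡 m) (𝓡 n) φ x X) =
    mfderiv (𝓡 m) 𝓘(ℝ, Model n) (extChartAt (𝓡 n) q ∘ φ) x X
  rw [h2]
  rfl

lemma eventually_mem_charts {y : Model m} (hφ : Continuous φ)
    (hy : y ∈ (extChartAt (𝓡 m) p).target)
    (hq : φ ((extChartAt (𝓡 m) p).symm y) ∈ (chartAt (Model n) q).source) :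
    ∀ᶠ y in nhds y, y ∈ (extChartAt (𝓡 m) p).target ∧
      φ ((extChartAt (𝓡 m) p).symm y) ∈ (chartAt (Model n) q).source := by
  have hc : ContinuousAt (fun y ↦ φ ((extChartAt (𝓡 m) p).symm y)) y :=
    hφ.continuousAt.comp (contMDiffAt_chart_symm hy).continuousAt
  exact ((isOpen_target p).mem_nhds hy |> Filter.eventually_mem_set.2).and
    (hc (source_mem_nhds hq))

variable [RiemannianBundle (fun q : N ↦ TangentSpace (𝓡 n) q)]
  [IsContMDiffRiemannianBundle (𝓡 n) ∞ (Model n) (fun q : N ↦ TangentSpace (𝓡 n) q)]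

/-- The induced connection in arbitrary charts. -/
lemma crd_covAlong (hp : x ∈ (chartAt (Model m) p).source)
    (hq : φ x ∈ (chartAt (Model n) q).source) (hφ : MDifferentiableAt (𝓡 m) (𝓡 n) φ x)
    (hW : DifferentiableAt ℝ (secIn m n p q φ W) (extChartAt (𝓡 m) p x))
    (X : TangentSpace (𝓡 m) x) :
    crd n q (φ x) (covAlong m n φ W x X) =
      cov (chrIn n q) (mapIn m n p q φ) (secIn m n p q φ W) (extChartAt (𝓡 m) p x)
        (crd m p x X) := by
  have hr := mem_chart_source (Model n) (φ x)
  set y := extChartAt (𝓡 m) p x with hy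
  have hxy : (extChartAt (𝓡 m) p).symm y = x := chart_left_inv hp
  set c : Model m → N := fun y ↦ φ ((extChartAt (𝓡 m) p).symm y) with hcdef
  have hcy : c y = φ x := by rw [hcdef]; simp only [hxy]
  have hc : ContinuousAt c y := by
    refine ContinuousAt.comp (g := φ) (by rw [hxy]; exact hφ.continuousAt)
      (contMDiffAt_chart_symm (chart_mem_target hp)).continuousAt
  have hf : DifferentiableAt ℝ (fun y ↦ extChartAt (𝓡 n) q (c y)) y :=
    differentiableAt_mapIn hp hq hφ
  have hq' : c y ∈ (chartAt (Model n) q).source := by rwa [hcy]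
  have hr' : c y ∈ (chartAt (Model n) (φ x)).source := by rwa [hcy]
  have hWr : DifferentiableAt ℝ (secIn m n p (φ x) φ W) y :=
    differentiableAt_crd_comp (c := c) hc hq' hr' hf hW
  -- `covAlong` is defined in the target chart at `φ x`. `hcenter` computes it there, and `hchange`
  -- carries the result to the chart at `q`.
  have hchange := cov_change_chart (c := c) (z := y)
    (W := fun y ↦ W ((extChartAt (𝓡 m) p).symm y)) hc hq' hr' hf hW (crd m p x X)
  have hcenter : crd n (φ x) (φ x) (covAlong m n φ W x X) =
      cov (chrIn n (φ x)) (mapIn m n p (φ x) φ) (secIn m n p (φ x) φ W) y (crd m p x X) := by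
    have heq : (fun y ↦ (trivializationAt (Model n) (fun q : N ↦ TangentSpace (𝓡 n) q) (φ x)
        ⟨c y, W ((extChartAt (𝓡 m) p).symm y)⟩).2) =ᶠ[nhds y] secIn m n p (φ x) φ W := by
      filter_upwards [hc (source_mem_nhds hr')] with y' hy'
      exact trivializationAt_snd hy' _
    rw [covAlong, trivializationAt_symm hr, map_add, crd_vec hr, crd_christoffel,
      crd_mfderiv hp hr hφ, mvfderiv_eq_fderiv hp (hWr.congr_of_eventuallyEq heq), heq.fderiv_eq,
      cov]
    rw [hy, secIn_chart hp, mapIn_chart hp]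
  have hfin : vec n (φ x) (φ x) (crd n (φ x) (φ x) (covAlong m n φ W x X)) =
      vec n q (φ x) (cov (chrIn n q) (mapIn m n p q φ) (secIn m n p q φ W) y (crd m p x X)) := by
    rw [hcenter]
    -- `c y` and `φ x` are equal but not by definition, so the vectors compared lie in formally
    -- different tangent spaces.
    have h2 : ∀ r : N, ∀ u, ∀ x' : N, c y = x' → HEq (vec n r (c y) u) (vec n r x' u) := by
      rintro r u x' rfl; rfl
    exact eq_of_heq ((h2 _ _ _ hcy).symm.trans ((heq_of_eq hchange).trans (h2 _ _ _ hcy)))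
  rw [vec_crd hr] at hfin
  rw [hfin, crd_vec hq]

end SingleMap

/-! ### Levi-Civita connection and curvature of a manifold in charts. -/

section LeviCivitaInCharts

variable {m : ℕ} {M : Type*} [TopologicalSpace M] [ChartedSpace (Model m) M]
  [IsManifold (𝓡 m) ∞ M]

variable (m) in
/-- The components of a vector field in the preferred chart at `p`. -/
def fieldIn (p : M) (Y : ∀ x : M, TangentSpace (𝓡 m) x) (y : Model m) : Model m :=
  crd m p ((extChartAt (𝓡 m) p).symm y) (Y ((extChartAt (𝓡 m) p).symm y))

lemma fieldIn_chart {p x : M} (hp : x ∈ (chartAt (Model m) p).source)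
    (Y : ∀ x : M, TangentSpace (𝓡 m) x) :
    fieldIn m p Y (extChartAt (𝓡 m) p x) = crd m p x (Y x) := by
  rw [fieldIn, chart_left_inv hp]

/-- The components of `constField u` are constant only in the chart at `x`. In the chart at `p` they
are the derivative of the transition map applied to a constant vector. -/
lemma contDiffAt_fieldIn_constField {p x : M} (hp : x ∈ (chartAt (Model m) p).source)
    (u : TangentSpace (𝓡 m) x) :
    ContDiffAt ℝ ∞ (fieldIn m p (constField u)) (extChartAt (𝓡 m) p x) := by
  have hx := mem_chart_source (Model m) x
  have hy := chart_mem_target hp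
  have htr := contDiffAt_trans (k := m) hp hx
  have hd : ContDiffAt ℝ ∞ (fun y ↦ fderiv ℝ (trans m x p) (trans m p x y) (crd m x x u))
      (extChartAt (𝓡 m) p x) := by
    refine ContDiffAt.clm_apply (ContDiffAt.comp _ ?_ htr) contDiffAt_const
    rw [trans_chart hp]
    exact contDiffAt_fderiv (contDiffAt_trans hx hp)
  refine hd.congr_of_eventuallyEq ?_
  have hc : ContinuousAt (extChartAt (𝓡 m) p).symm (extChartAt (𝓡 m) p x) :=
    (contMDiffAt_chart_symm hy).continuousAt
  have hn : (chartAt (Model m) x).source ∈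
      nhds ((extChartAt (𝓡 m) p).symm (extChartAt (𝓡 m) p x)) := by
    rw [chart_left_inv hp]; exact source_mem_nhds hx
  filter_upwards [(isOpen_target p).mem_nhds hy, hc hn] with y hy hy'
  have hp' := chart_symm_mem_source hy
  rw [fieldIn, constField_eq u hy', ← fderiv_trans_crd hy' hp', crd_vec hy']
  rfl

variable [RiemannianBundle (fun x : M ↦ TangentSpace (𝓡 m) x)]
  [IsContMDiffRiemannianBundle (𝓡 m) ∞ (Model m) (fun x : M ↦ TangentSpace (𝓡 m) x)]

/-- The Levi-Civita connection in an arbitrary chart. -/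
lemma crd_lcConn {p x : M} (hp : x ∈ (chartAt (Model m) p).source)
    {Y : ∀ x : M, TangentSpace (𝓡 m) x}
    (hY : DifferentiableAt ℝ (fieldIn m p Y) (extChartAt (𝓡 m) p x)) (X : TangentSpace (𝓡 m) x) :
    crd m p x (lcConn Y x X) =
      fderiv ℝ (fieldIn m p Y) (extChartAt (𝓡 m) p x) (crd m p x X)
        + chrIn m p (extChartAt (𝓡 m) p x) (crd m p x X) (crd m p x (Y x)) := by
  have h := crd_covAlong (m := m) (n := m) (p := p) (q := p) (φ := fun x : M ↦ x) (W := Y) hp hp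
    mdifferentiableAt_id hY X
  have hid : mapIn m m p p (fun x : M ↦ x) =ᶠ[nhds (extChartAt (𝓡 m) p x)] fun y ↦ y := by
    filter_upwards [(isOpen_target p).mem_nhds (chart_mem_target hp)] with y hy
    exact (extChartAt (𝓡 m) p).right_inv hy
  rw [cov_congr_map hid Filter.EventuallyEq.rfl] at h
  rw [lcConn]
  refine h.trans ?_
  simp only [cov, fderiv_fun_id, ContinuousLinearMap.id_apply]
  rw [secIn_chart hp]
  rfl

/-- Pulled back to the chart at `q` both fields are constant, and constant fields commute. The
bracket term therefore drops out of the curvature. -/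
lemma mlieBracket_constField (q : M) (u v : TangentSpace (𝓡 m) q) :
    VectorField.mlieBracket (𝓡 m) (constField u) (constField v) q = 0 := by
  have hq := mem_chart_source (Model m) q
  have hy := chart_mem_target hq
  have hconst : ∀ w : TangentSpace (𝓡 m) q,
      VectorField.mpullbackWithin 𝓘(ℝ, Model m) (𝓡 m) (extChartAt (𝓡 m) q).symm (constField w)
        (range (𝓡 m)) =ᶠ[nhds (extChartAt (𝓡 m) q q)] fun _ ↦ crd m q q w := by
    intro w
    filter_upwards [(isOpen_target q).mem_nhds hy] with y hy
    have hx := chart_symm_mem_source hy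
    have hinv := isInvertible_mfderivWithin_extChartAt_symm (I := 𝓡 m) hy
    have hs := TangentBundle.symmL_trivializationAt (I := 𝓡 m) hx
    rw [(extChartAt (𝓡 m) q).right_inv hy] at hs
    rw [VectorField.mpullbackWithin_apply, constField_eq w hx, vec, hs]
    exact hinv.inverse_apply_eq.2 rfl
  rw [VectorField.mlieBracket, VectorField.mlieBracketWithin_apply]
  have hz : VectorField.lieBracketWithin ℝ
      (VectorField.mpullbackWithin 𝓘(ℝ, Model m) (𝓡 m) (extChartAt (𝓡 m) q).symm (constField u)
        (range (𝓡 m)))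
      (VectorField.mpullbackWithin 𝓘(ℝ, Model m) (𝓡 m) (extChartAt (𝓡 m) q).symm (constField v)
        (range (𝓡 m)))
      ((extChartAt (𝓡 m) q).symm ⁻¹' univ ∩ range (𝓡 m)) (extChartAt (𝓡 m) q q) = 0 := by
    rw [Filter.EventuallyEq.lieBracketWithin_vectorField_eq
      ((hconst u).filter_mono nhdsWithin_le_nhds) (hconst u).eq_of_nhds
      ((hconst v).filter_mono nhdsWithin_le_nhds) (hconst v).eq_of_nhds]
    simp [VectorField.lieBracketWithin_eq]
  rw [hz]
  exact (ContinuousLinearMap.inverse _).map_zero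

/-- The curvature tensor at the centre of a chart. -/
lemma crd_curvature (q : M) (u v w : TangentSpace (𝓡 m) q) :
    crd m q q (curvature q u v w) =
      curv (chrIn m q) (extChartAt (𝓡 m) q q) (crd m q q u) (crd m q q v) (crd m q q w) := by
  have hq := mem_chart_source (Model m) q
  have hy := chart_mem_target hq
  have hG := isMetricOn_metricIn (k := m) q
  have hΓ : ContDiffAt ℝ ∞ (chrIn m q) (extChartAt (𝓡 m) q q) := contDiffAt_chr hG hy
  have hfield : ∀ y ∈ (extChartAt (𝓡 m) q).target,
      fieldIn m q (constField w) =ᶠ[nhds y] fun _ ↦ crd m q q w := by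
    intro y hy
    filter_upwards [(isOpen_target q).mem_nhds hy] with y' hy'
    exact crd_constField w (chart_symm_mem_source hy')
  -- Fields with constant components have covariant derivative Γ(a, w), and this holds near the
  -- centre, so it may be differentiated again.
  have hfirst : ∀ a : TangentSpace (𝓡 m) q,
      fieldIn m q (fun q' ↦ lcConn (constField w) q' (constField a q'))
        =ᶠ[nhds (extChartAt (𝓡 m) q q)]
        fun y ↦ chrIn m q y (crd m q q a) (crd m q q w) := by
    intro a
    filter_upwards [(isOpen_target q).mem_nhds hy] with y hy
    have hx := chart_symm_mem_source hy
    have hyy : extChartAt (𝓡 m) q ((extChartAt (𝓡 m) q).symm y) = y :=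
      (extChartAt (𝓡 m) q).right_inv hy
    have hf := hfield y hy
    have hfd : DifferentiableAt ℝ (fieldIn m q (constField w))
        (extChartAt (𝓡 m) q ((extChartAt (𝓡 m) q).symm y)) := by
      rw [hyy]; exact (differentiableAt_const _).congr_of_eventuallyEq hf
    rw [fieldIn, crd_lcConn hx hfd, hyy, hf.fderiv_eq, crd_constField a hx, crd_constField w hx]
    simp
  have hd : ∀ a : TangentSpace (𝓡 m) q, ContDiffAt ℝ ∞
      (fun y ↦ chrIn m q y (crd m q q a) (crd m q q w)) (extChartAt (𝓡 m) q q) := fun a ↦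
    (hΓ.clm_apply contDiffAt_const).clm_apply contDiffAt_const
  have hder : ∀ a b : TangentSpace (𝓡 m) q,
      fderiv ℝ (fun y ↦ chrIn m q y (crd m q q a) (crd m q q w)) (extChartAt (𝓡 m) q q)
        (crd m q q b) =
      fderiv ℝ (chrIn m q) (extChartAt (𝓡 m) q q) (crd m q q b) (crd m q q a) (crd m q q w) := by
    intro a b
    have h1 : ContDiffAt ℝ ∞ (fun y ↦ chrIn m q y (crd m q q a)) (extChartAt (𝓡 m) q q) :=
      hΓ.clm_apply contDiffAt_const
    rw [fderiv_clm_apply (differentiableAt_of_contDiffAt h1) (differentiableAt_const _),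
      fderiv_clm_apply (differentiableAt_of_contDiffAt hΓ) (differentiableAt_const _)]
    simp
  have hsecond : ∀ a b : TangentSpace (𝓡 m) q,
      crd m q q (lcConn (fun q' ↦ lcConn (constField w) q' (constField a q')) q b) =
      fderiv ℝ (chrIn m q) (extChartAt (𝓡 m) q q) (crd m q q b) (crd m q q a) (crd m q q w)
        + chrIn m q (extChartAt (𝓡 m) q q) (crd m q q b)
          (chrIn m q (extChartAt (𝓡 m) q q) (crd m q q a) (crd m q q w)) := by
    intro a b
    rw [crd_lcConn hq ((differentiableAt_of_contDiffAt (hd a)).congr_of_eventuallyEq (hfirst a)),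
      (hfirst a).fderiv_eq, hder]
    congr 2
    rw [← (hfirst a).eq_of_nhds, fieldIn_chart hq]
  have hzero : lcConn (constField w) q (0 : TangentSpace (𝓡 m) q) = 0 := by
    have hf := hfield _ hy
    rw [← vec_crd hq (lcConn (constField w) q 0),
      crd_lcConn hq ((differentiableAt_const _).congr_of_eventuallyEq hf)]
    simp
  rw [curvature, mlieBracket_constField, hzero, map_sub, map_sub, hsecond, hsecond, curv]
  simp only [map_zero]
  abel

end LeviCivitaInCharts

/-! ### Tensoriality of the second fundamental form and of second covariant derivatives. -/

section SecondOrder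

variable {m n : ℕ}
  {M : Type*} [TopologicalSpace M] [ChartedSpace (Model m) M] [IsManifold (𝓡 m) ∞ M]
  [RiemannianBundle (fun x : M ↦ TangentSpace (𝓡 m) x)]
  [IsContMDiffRiemannianBundle (𝓡 m) ∞ (Model m) (fun x : M ↦ TangentSpace (𝓡 m) x)]
  {N : Type*} [TopologicalSpace N] [ChartedSpace (Model n) N] [IsManifold (𝓡 n) ∞ N]
  [RiemannianBundle (fun q : N ↦ TangentSpace (𝓡 n) q)]
  [IsContMDiffRiemannianBundle (𝓡 n) ∞ (Model n) (fun q : N ↦ TangentSpace (𝓡 n) q)]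
  {p x : M} {q : N} {φ : M → N} {W : ∀ x, TangentSpace (𝓡 n) (φ x)}

/-- The second fundamental form of a smooth map in arbitrary charts. -/
lemma crd_secondFundamentalForm (hφ : ContMDiff (𝓡 m) (𝓡 n) ∞ φ)
    (hp : x ∈ (chartAt (Model m) p).source) (hq : φ x ∈ (chartAt (Model n) q).source)
    (X Y : TangentSpace (𝓡 m) x) :
    crd n q (φ x) (secondFundamentalForm m n φ x X Y) =
      cov (chrIn n q) (mapIn m n p q φ) (fun y ↦ fderiv ℝ (mapIn m n p q φ) y (crd m p x Y))
          (extChartAt (𝓡 m) p x) (crd m p x X)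
        - fderiv ℝ (mapIn m n p q φ) (extChartAt (𝓡 m) p x)
          (chrIn m p (extChartAt (𝓡 m) p x) (crd m p x X) (crd m p x Y)) := by
  have hy := chart_mem_target hp
  have hφd : ∀ x, MDifferentiableAt (𝓡 m) (𝓡 n) φ x := fun x ↦ (hφ x).mdifferentiableAt (by simp)
  have hq' : φ ((extChartAt (𝓡 m) p).symm (extChartAt (𝓡 m) p x)) ∈
      (chartAt (Model n) q).source := by rwa [chart_left_inv hp]
  have hf := contDiffAt_mapIn hy hq' hφ
  have hY := contDiffAt_fieldIn_constField hp Y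
  have hsec : secIn m n p q φ (fun x' ↦ mfderiv (𝓡 m) (𝓡 n) φ x' (constField Y x'))
      =ᶠ[nhds (extChartAt (𝓡 m) p x)]
      fun y ↦ fderiv ℝ (mapIn m n p q φ) y (fieldIn m p (constField Y) y) := by
    filter_upwards [eventually_mem_charts hφ.continuous hy hq'] with y hy
    have hx := chart_symm_mem_source hy.1
    rw [secIn, crd_mfderiv hx hy.2 (hφd _), (extChartAt (𝓡 m) p).right_inv hy.1]
    rfl
  have hA := differentiableAt_of_contDiffAt (contDiffAt_fderiv hf)
  have hYd := differentiableAt_of_contDiffAt hY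
  have hYx : constField Y x = Y := FiberBundle.extend_apply_self _ Y
  -- The derivative of the components of `constField Y` arises once from ∇̄_X(dφ(Y)) and once from
  -- dφ(∇_X Y), and cancels. The choice of extension is therefore immaterial in the chart at `p`.
  rw [secondFundamentalForm, map_sub,
    crd_covAlong hp hq (hφd x) ((hA.clm_apply hYd).congr_of_eventuallyEq hsec),
    crd_mfderiv hp hq (hφd x), crd_lcConn hp hYd, cov_congr hsec, cov_clm_apply hA hYd,
    fieldIn_chart hp, hYx, map_add]
  abel

/-- The second covariant derivative of a smooth section in arbitrary charts. -/
lemma crd_secondCovariantDerivative (hφ : ContMDiff (𝓡 m) (𝓡 n) ∞ φ)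
    (hp : x ∈ (chartAt (Model m) p).source) (hq : φ x ∈ (chartAt (Model n) q).source)
    (hW : ∀ᶠ y in nhds (extChartAt (𝓡 m) p x), ContDiffAt ℝ ∞ (secIn m n p q φ W) y)
    (X Y : TangentSpace (𝓡 m) x) :
    crd n q (φ x) (covAlong m n φ (fun x' ↦ covAlong m n φ W x' (constField Y x')) x X
        - covAlong m n φ W x (lcConn (constField Y) x X)) =
      cov (chrIn n q) (mapIn m n p q φ)
          (fun y ↦ cov (chrIn n q) (mapIn m n p q φ) (secIn m n p q φ W) y (crd m p x Y))
          (extChartAt (𝓡 m) p x) (crd m p x X)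
        - cov (chrIn n q) (mapIn m n p q φ) (secIn m n p q φ W) (extChartAt (𝓡 m) p x)
          (chrIn m p (extChartAt (𝓡 m) p x) (crd m p x X) (crd m p x Y)) := by
  have hy := chart_mem_target hp
  have hφd : ∀ x, MDifferentiableAt (𝓡 m) (𝓡 n) φ x := fun x ↦ (hφ x).mdifferentiableAt (by simp)
  have hq' : φ ((extChartAt (𝓡 m) p).symm (extChartAt (𝓡 m) p x)) ∈
      (chartAt (Model n) q).source := by rwa [chart_left_inv hp]
  have hf := contDiffAt_mapIn hy hq' hφ
  have hΓ : ContDiffAt ℝ ∞ (chrIn n q) (mapIn m n p q φ (extChartAt (𝓡 m) p x)) := by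
    rw [mapIn_chart hp]
    exact contDiffAt_chr (isMetricOn_metricIn q) (chart_mem_target hq)
  have hY := contDiffAt_fieldIn_constField hp Y
  have hsec : secIn m n p q φ (fun x' ↦ covAlong m n φ W x' (constField Y x'))
      =ᶠ[nhds (extChartAt (𝓡 m) p x)]
      fun y ↦ covL (chrIn n q) (mapIn m n p q φ) (secIn m n p q φ W) y
        (fieldIn m p (constField Y) y) := by
    filter_upwards [eventually_mem_charts hφ.continuous hy hq', hW] with y hy hW
    have hx := chart_symm_mem_source hy.1
    have hyy := (extChartAt (𝓡 m) p).right_inv hy.1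
    rw [secIn, crd_covAlong hx hy.2 (hφd _) (by
      rw [hyy]; exact differentiableAt_of_contDiffAt hW), hyy]
    rfl
  have hA := differentiableAt_of_contDiffAt (contDiffAt_covL hΓ hf hW.self_of_nhds)
  have hYd := differentiableAt_of_contDiffAt hY
  have hYx : constField Y x = Y := FiberBundle.extend_apply_self _ Y
  -- The same cancellation, with ∇̄W in place of dφ.
  rw [map_sub,
    crd_covAlong hp hq (hφd x) ((hA.clm_apply hYd).congr_of_eventuallyEq hsec),
    crd_covAlong hp hq (hφd x) (differentiableAt_of_contDiffAt hW.self_of_nhds),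
    crd_lcConn hp hYd, cov_congr hsec, cov_clm_apply hA hYd,
    fieldIn_chart hp, hYx, cov_add_direction, covL_apply]
  simp only [covL_apply]
  abel

end SecondOrder

/-! ### Smoothness of traces over pointwise chosen orthonormal bases. -/

section Trace

variable {m : ℕ} {F : Type*} [NormedAddCommGroup F] [NormedSpace ℝ F]

/-- The covariant derivative of a one-form `A` on the slices of `ℝ × Model m` with values in the
vector fields along `f`, for the connections with Christoffel symbols `Γ` and `γ`. -/
def covOneForm (Γ : F → F →L[ℝ] F →L[ℝ] F) (f : ℝ × Model m → F)
    (A : ℝ × Model m → (ℝ × Model m) →L[ℝ] F) (γ : Model m → Model m →L[ℝ] Model m →L[ℝ] Model m)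
    (z : ℝ × Model m) : Model m →ₗ[ℝ] Model m →ₗ[ℝ] F :=
  LinearMap.mk₂ ℝ (fun u v ↦ fderiv ℝ A z (ContinuousLinearMap.inr ℝ ℝ (Model m) u)
        (ContinuousLinearMap.inr ℝ ℝ (Model m) v)
      + Γ (f z) (fderiv ℝ f z (ContinuousLinearMap.inr ℝ ℝ (Model m) u))
        (A z (ContinuousLinearMap.inr ℝ ℝ (Model m) v))
      - A z (ContinuousLinearMap.inr ℝ ℝ (Model m) (γ z.2 u v)))
    (fun u u' v ↦ by simp only [map_add, add_apply]; abel)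
    (fun c u v ↦ by simp only [map_smul, smul_apply, smul_add, smul_sub])
    (fun u v v' ↦ by simp only [map_add]; abel)
    (fun c u v ↦ by simp only [map_smul, smul_add, smul_sub])

variable {Γ : F → F →L[ℝ] F →L[ℝ] F} {f : ℝ × Model m → F}
  {A : ℝ × Model m → (ℝ × Model m) →L[ℝ] F} {γ : Model m → Model m →L[ℝ] Model m →L[ℝ] Model m}
  {z : ℝ × Model m}

lemma covOneForm_apply (hA : DifferentiableAt ℝ A z) (u v : Model m) :
    covOneForm Γ f A γ z u v = cov Γ f (fun z ↦ A z (0, v)) z (0, u) - A z (0, γ z.2 u v) := by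
  rw [cov, fderiv_clm_apply hA (differentiableAt_const _)]
  simp [covOneForm]

/-- The trace of the covariant derivative of a smooth one-form is smooth. -/
lemma contDiffAt_trace_covOneForm {G : Model m → Model m →L[ℝ] Model m →L[ℝ] ℝ}
    {D : Set (Model m)} (hG : IsMetricOn G D) (hz : z.2 ∈ D) (hΓ : ContDiffAt ℝ ∞ Γ (f z))
    (hf : ContDiffAt ℝ ∞ f z) (hA : ContDiffAt ℝ ∞ A z) {τ : ℝ × Model m → F}
    (hτ : ∀ᶠ z in nhds z, ∃ (k : ℕ) (e : Fin k → Model m), (∀ u, ∑ i, G z.2 u (e i) • e i = u) ∧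
      τ z = ∑ i, covOneForm Γ f A (chr G) z (e i) (e i)) : ContDiffAt ℝ ∞ τ z := by
  have hsnd : ContDiffAt ℝ ∞ (fun z : ℝ × Model m ↦ z.2) z := contDiffAt_snd
  have hD : ∀ᶠ z : ℝ × Model m in nhds z, z.2 ∈ D :=
    continuousAt_snd.eventually (hG.isOpen.mem_nhds hz)
  -- Neither the vectors `e` nor their number are assumed to depend regularly on the point. The
  -- inverse metric coefficients, which are smooth, replace them.
  have heq : τ =ᶠ[nhds z] fun z ↦ ∑ a, ∑ b, invMetric G z.2 a b •
      covOneForm Γ f A (chr G) z (coordVec a) (coordVec b) := by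
    filter_upwards [hτ, hD] with z' hz' hD'
    obtain ⟨k, e, he, hτ⟩ := hz'
    rw [hτ, sum_orthonormal_eq hG hD' he]
  refine ContDiffAt.congr_of_eventuallyEq ?_ heq
  refine ContDiffAt.sum fun a _ ↦ ContDiffAt.sum fun b _ ↦
    ContDiffAt.smul ((contDiffAt_invMetric hG hz a b).comp z hsnd) ?_
  simp only [covOneForm, LinearMap.mk₂_apply]
  have hc : ∀ u v, ContDiffAt ℝ ∞ (fun z : ℝ × Model m ↦ chr G z.2 u v) z := fun u v ↦
    (((contDiffAt_chr hG hz).comp z hsnd).clm_apply contDiffAt_const).clm_apply contDiffAt_const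
  exact ((((contDiffAt_fderiv hA).clm_apply contDiffAt_const).clm_apply contDiffAt_const).add
    (((hΓ.comp z hf).clm_apply (contDiffAt_fderiv_apply hf _)).clm_apply
      (hA.clm_apply contDiffAt_const))).sub
    (hA.clm_apply ((ContinuousLinearMap.inr ℝ ℝ (Model m)).contDiff.contDiffAt.comp z (hc _ _)))

end Trace

/-! ### Families of maps: smoothness of the tension field and the rough Laplacian. -/

section Variation

variable {m n : ℕ}
  {M : Type*} [TopologicalSpace M] [ChartedSpace (Model m) M] [IsManifold (𝓡 m) ∞ M]
  {N : Type*} [TopologicalSpace N] [ChartedSpace (Model n) N] [IsManifold (𝓡 n) ∞ N]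

variable (m n) in
/-- A smooth family of maps `φ_t`, `-ε < t < ε`. -/
abbrev IsVariation (φ : ℝ → M → N) (ε : ℝ) : Prop :=
  ContMDiffOn (𝓘(ℝ, ℝ).prod (𝓡 m)) (𝓡 n) ∞ (fun z : ℝ × M ↦ φ z.1 z.2) (Ioo (-ε) ε ×ˢ univ)

variable (m n) in
/-- A family of maps in the preferred charts at `p` and `q`. -/
def famIn (p : M) (q : N) (φ : ℝ → M → N) (z : ℝ × Model m) : Model n :=
  extChartAt (𝓡 n) q (φ z.1 ((extChartAt (𝓡 m) p).symm z.2))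

variable (m n) in
/-- The components of a section along a family of maps. -/
def famSec (p : M) (q : N) (φ : ℝ → M → N) (W : ∀ t x, TangentSpace (𝓡 n) (φ t x))
    (z : ℝ × Model m) : Model n :=
  crd n q (φ z.1 ((extChartAt (𝓡 m) p).symm z.2)) (W z.1 ((extChartAt (𝓡 m) p).symm z.2))

variable (m n) in
/-- The domain of a family of maps in the preferred charts at `p` and `q`. -/
def famDom (p : M) (q : N) (φ : ℝ → M → N) (ε : ℝ) : Set (ℝ × Model m) :=
  {z | z.1 ∈ Ioo (-ε) ε ∧ z.2 ∈ (extChartAt (𝓡 m) p).target ∧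
    φ z.1 ((extChartAt (𝓡 m) p).symm z.2) ∈ (chartAt (Model n) q).source}

variable (m n) in
/-- A smooth section along a family of maps. -/
def SmoothFam (φ : ℝ → M → N) (ε : ℝ) (W : ∀ t x, TangentSpace (𝓡 n) (φ t x)) : Prop :=
  ∀ (p : M) (q : N), ∀ z ∈ famDom m n p q φ ε, ContDiffAt ℝ ∞ (famSec m n p q φ W) z

variable {φ : ℝ → M → N} {ε : ℝ} {p : M} {q : N} {z : ℝ × Model m}
  {W : ∀ t x, TangentSpace (𝓡 n) (φ t x)}

lemma contMDiffAt_fam (hφ : IsVariation m n φ ε) (ht : z.1 ∈ Ioo (-ε) ε)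
    (hy : z.2 ∈ (extChartAt (𝓡 m) p).target) :
    ContMDiffAt 𝓘(ℝ, ℝ × Model m) (𝓡 n) ∞
      (fun z : ℝ × Model m ↦ φ z.1 ((extChartAt (𝓡 m) p).symm z.2)) z := by
  have h1 : ContMDiffAt 𝓘(ℝ, ℝ × Model m) (𝓘(ℝ, ℝ).prod (𝓡 m)) ∞
      (fun z : ℝ × Model m ↦ (z.1, (extChartAt (𝓡 m) p).symm z.2)) z :=
    ContMDiffAt.prodMk contDiff_fst.contMDiff.contMDiffAt
      (ContMDiffAt.comp z (contMDiffAt_chart_symm hy) contDiff_snd.contMDiff.contMDiffAt)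
  have h2 : ContMDiffAt (𝓘(ℝ, ℝ).prod (𝓡 m)) (𝓡 n) ∞ (fun z : ℝ × M ↦ φ z.1 z.2)
      (z.1, (extChartAt (𝓡 m) p).symm z.2) :=
    hφ.contMDiffAt ((isOpen_Ioo.prod isOpen_univ).mem_nhds ⟨ht, mem_univ _⟩)
  exact ContMDiffAt.comp z h2 h1

lemma contDiffAt_famIn (hφ : IsVariation m n φ ε) (hz : z ∈ famDom m n p q φ ε) :
    ContDiffAt ℝ ∞ (famIn m n p q φ) z :=
  ((contMDiffAt_chart hz.2.2).comp z (contMDiffAt_fam hφ hz.1 hz.2.1)).contDiffAt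

lemma famDom_mem_nhds (hφ : IsVariation m n φ ε) (hz : z ∈ famDom m n p q φ ε) :
    famDom m n p q φ ε ∈ nhds z := by
  have h1 : ∀ᶠ z' : ℝ × Model m in nhds z, z'.1 ∈ Ioo (-ε) ε :=
    continuousAt_fst.eventually (isOpen_Ioo.mem_nhds hz.1)
  have h2 : ∀ᶠ z' : ℝ × Model m in nhds z, z'.2 ∈ (extChartAt (𝓡 m) p).target :=
    continuousAt_snd.eventually ((isOpen_target p).mem_nhds hz.2.1)
  have h3 := (contMDiffAt_fam hφ hz.1 hz.2.1).continuousAt.eventually (source_mem_nhds hz.2.2)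
  filter_upwards [h1, h2, h3] with z' h1 h2 h3 using ⟨h1, h2, h3⟩

lemma contMDiff_slice (hφ : IsVariation m n φ ε) {t : ℝ} (ht : t ∈ Ioo (-ε) ε) :
    ContMDiff (𝓡 m) (𝓡 n) ∞ (φ t) := by
  intro x
  have h2 : ContMDiffAt (𝓘(ℝ, ℝ).prod (𝓡 m)) (𝓡 n) ∞ (fun z : ℝ × M ↦ φ z.1 z.2) (t, x) :=
    hφ.contMDiffAt ((isOpen_Ioo.prod isOpen_univ).mem_nhds ⟨ht, mem_univ _⟩)
  exact ContMDiffAt.comp (f := fun x : M ↦ (t, x)) x h2 (contMDiffAt_const.prodMk contMDiffAt_id)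

lemma famIn_mem_target (hz : z ∈ famDom m n p q φ ε) :
    famIn m n p q φ z ∈ (extChartAt (𝓡 n) q).target := chart_mem_target hz.2.2

lemma hasFDerivAt_slice (t : ℝ) (y : Model m) :
    HasFDerivAt (fun y : Model m ↦ (t, y)) (ContinuousLinearMap.inr ℝ ℝ (Model m)) y :=
  hasFDerivAt_prodMk_right t y

lemma hasFDerivAt_time (t : ℝ) (y : Model m) :
    HasFDerivAt (fun t : ℝ ↦ (t, y)) (ContinuousLinearMap.inl ℝ ℝ (Model m)) t :=
  hasFDerivAt_prodMk_left t y

/-- Derivatives along one map `φ t` become derivatives in the directions `(0, u)` of the product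
with time. There they can be commuted with the direction `(1, 0)`. -/
lemma cov_slice {F : Type*} [NormedAddCommGroup F] [NormedSpace ℝ F]
    {Γ : F → F →L[ℝ] F →L[ℝ] F} {f W : ℝ × Model m → F} (hf : DifferentiableAt ℝ f z)
    (hW : DifferentiableAt ℝ W z) (u : Model m) :
    cov Γ (fun y ↦ f (z.1, y)) (fun y ↦ W (z.1, y)) z.2 u = cov Γ f W z (0, u) := by
  rw [cov_comp (j := fun y ↦ (z.1, y)) (hasFDerivAt_slice z.1 z.2).differentiableAt hf hW,
    (hasFDerivAt_slice z.1 z.2).fderiv]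
  rfl

lemma cov_time {F : Type*} [NormedAddCommGroup F] [NormedSpace ℝ F]
    {Γ : F → F →L[ℝ] F →L[ℝ] F} {f W : ℝ × Model m → F} (hf : DifferentiableAt ℝ f z)
    (hW : DifferentiableAt ℝ W z) :
    cov Γ (fun t ↦ f (t, z.2)) (fun t ↦ W (t, z.2)) z.1 1 = cov Γ f W z (1, 0) := by
  rw [cov_comp (j := fun t ↦ (t, z.2)) (hasFDerivAt_time z.1 z.2).differentiableAt hf hW,
    (hasFDerivAt_time z.1 z.2).fderiv]
  rfl

lemma fderiv_slice {F : Type*} [NormedAddCommGroup F] [NormedSpace ℝ F] {f : ℝ × Model m → F}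
    (hf : DifferentiableAt ℝ f z) (u : Model m) :
    fderiv ℝ (fun y ↦ f (z.1, y)) z.2 u = fderiv ℝ f z (0, u) := by
  have h : HasFDerivAt (fun y ↦ f (z.1, y))
      ((fderiv ℝ f z).comp (ContinuousLinearMap.inr ℝ ℝ (Model m))) z.2 :=
    HasFDerivAt.comp (g := f) z.2 hf.hasFDerivAt (hasFDerivAt_slice z.1 z.2)
  rw [h.fderiv]
  rfl

lemma fderiv_time {F : Type*} [NormedAddCommGroup F] [NormedSpace ℝ F] {f : ℝ × Model m → F}
    (hf : DifferentiableAt ℝ f z) :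
    fderiv ℝ (fun t ↦ f (t, z.2)) z.1 1 = fderiv ℝ f z (1, 0) := by
  have h : HasFDerivAt (fun t ↦ f (t, z.2))
      ((fderiv ℝ f z).comp (ContinuousLinearMap.inl ℝ ℝ (Model m))) z.1 :=
    HasFDerivAt.comp (g := f) z.1 hf.hasFDerivAt (hasFDerivAt_time z.1 z.2)
  rw [h.fderiv]
  rfl

/-- The velocity field of a family of maps. -/
def velocity (n : ℕ) {M N : Type*} [TopologicalSpace N] [ChartedSpace (Model n) N]
    (φ : ℝ → M → N) (t : ℝ) (x : M) : TangentSpace (𝓡 n) (φ t x) :=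
  mfderiv 𝓘(ℝ, ℝ) (𝓡 n) (fun t ↦ φ t x) t (1 : ℝ)

lemma crd_velocity (hφ : IsVariation m n φ ε) (hz : z ∈ famDom m n p q φ ε) :
    famSec m n p q φ (velocity n φ) z = fderiv ℝ (famIn m n p q φ) z (1, 0) := by
  have hcurve : MDifferentiableAt 𝓘(ℝ, ℝ) (𝓡 n)
      (fun t ↦ φ t ((extChartAt (𝓡 m) p).symm z.2)) z.1 := by
    have h2 : ContMDiffAt (𝓘(ℝ, ℝ).prod (𝓡 m)) (𝓡 n) ∞ (fun z : ℝ × M ↦ φ z.1 z.2)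
        (z.1, (extChartAt (𝓡 m) p).symm z.2) :=
      hφ.contMDiffAt ((isOpen_Ioo.prod isOpen_univ).mem_nhds ⟨hz.1, mem_univ _⟩)
    have h3 : ContMDiffAt 𝓘(ℝ, ℝ) (𝓡 n) ∞ (fun t ↦ φ t ((extChartAt (𝓡 m) p).symm z.2)) z.1 :=
      ContMDiffAt.comp z.1 h2 (contMDiffAt_id.prodMk contMDiffAt_const)
    exact h3.mdifferentiableAt (by simp)
  have h2 := mfderiv_comp z.1
    ((contMDiffAt_chart hz.2.2).mdifferentiableAt (n := ∞) (by simp)) hcurve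
  rw [← fderiv_time (differentiableAt_of_contDiffAt (contDiffAt_famIn hφ hz)), famSec,
    crd_eq_mvfderiv hz.2.2, mvfderiv, velocity]
  change mfderiv (𝓡 n) 𝓘(ℝ, Model n) (extChartAt (𝓡 n) q)
      (φ z.1 ((extChartAt (𝓡 m) p).symm z.2))
      (mfderiv 𝓘(ℝ, ℝ) (𝓡 n) (fun t ↦ φ t ((extChartAt (𝓡 m) p).symm z.2)) z.1 (1 : ℝ)) =
    fderiv ℝ (extChartAt (𝓡 n) q ∘ fun t ↦ φ t ((extChartAt (𝓡 m) p).symm z.2)) z.1 1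
  rw [← mfderiv_eq_fderiv, h2]
  rfl

lemma smoothFam_velocity (hφ : IsVariation m n φ ε) : SmoothFam m n φ ε (velocity n φ) := by
  intro p q z hz
  refine (contDiffAt_fderiv_apply (contDiffAt_famIn hφ hz) (1, 0)).congr_of_eventuallyEq ?_
  filter_upwards [famDom_mem_nhds hφ hz] with z' hz' using crd_velocity hφ hz'

lemma SmoothFam.eventually_secIn (hφ : IsVariation m n φ ε) (hW : SmoothFam m n φ ε W)
    (hz : z ∈ famDom m n p q φ ε) :
    ∀ᶠ y in nhds z.2, ContDiffAt ℝ ∞ (secIn m n p q (φ z.1) (W z.1)) y := by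
  have hc : ContinuousAt (fun y : Model m ↦ (z.1, y)) z.2 := by fun_prop
  filter_upwards [hc.eventually (famDom_mem_nhds hφ hz)] with y hy
  exact ContDiffAt.comp (g := famSec m n p q φ W) y (hW p q _ hy)
    (contDiffAt_const.prodMk contDiffAt_id)

variable [RiemannianBundle (fun q : N ↦ TangentSpace (𝓡 n) q)]
  [IsContMDiffRiemannianBundle (𝓡 n) ∞ (Model n) (fun q : N ↦ TangentSpace (𝓡 n) q)]

lemma contDiffAt_chrIn_famIn (hz : z ∈ famDom m n p q φ ε) :
    ContDiffAt ℝ ∞ (chrIn n q) (famIn m n p q φ z) :=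
  contDiffAt_chr (isMetricOn_metricIn q) (famIn_mem_target hz)

lemma crd_covAlong_fam (hφ : IsVariation m n φ ε) (hW : SmoothFam m n φ ε W)
    (hz : z ∈ famDom m n p q φ ε)
    (X : TangentSpace (𝓡 m) ((extChartAt (𝓡 m) p).symm z.2)) :
    crd n q (φ z.1 ((extChartAt (𝓡 m) p).symm z.2))
        (covAlong m n (φ z.1) (W z.1) ((extChartAt (𝓡 m) p).symm z.2) X) =
      cov (chrIn n q) (famIn m n p q φ) (famSec m n p q φ W) z
        (0, crd m p ((extChartAt (𝓡 m) p).symm z.2) X) := by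
  have hyy := (extChartAt (𝓡 m) p).right_inv hz.2.1
  have hW' := differentiableAt_of_contDiffAt (hW.eventually_secIn hφ hz).self_of_nhds
  rw [crd_covAlong (chart_symm_mem_source hz.2.1) hz.2.2
    ((contMDiff_slice hφ hz.1 _).mdifferentiableAt (by simp)) (by rwa [hyy]), hyy]
  exact cov_slice (f := famIn m n p q φ) (W := famSec m n p q φ W)
    (differentiableAt_of_contDiffAt (contDiffAt_famIn hφ hz))
    (differentiableAt_of_contDiffAt (hW p q z hz)) _

variable (n) in
/-- The covariant derivative at time `t` of a section along a family of maps in the direction of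
the time. -/
def covTime (φ : ℝ → M → N) (W : ∀ t x, TangentSpace (𝓡 n) (φ t x)) (t : ℝ) (x : M) :
    TangentSpace (𝓡 n) (φ t x) :=
  vec n (φ t x) (φ t x) (cov (chrIn n (φ t x)) (fun s ↦ extChartAt (𝓡 n) (φ t x) (φ s x))
    (fun s ↦ crd n (φ t x) (φ s x) (W s x)) t 1)

/-- `covTime` is defined in the chart at its own base point `φ t x`. Independence of the target
chart turns it into a derivative in the direction `(1, 0)` in a fixed chart. -/
lemma crd_covTime (hφ : IsVariation m n φ ε) (hW : SmoothFam m n φ ε W)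
    (hz : z ∈ famDom m n p q φ ε) :
    famSec m n p q φ (covTime n φ W) z =
      cov (chrIn n q) (famIn m n p q φ) (famSec m n p q φ W) z (1, 0) := by
  set x := (extChartAt (𝓡 m) p).symm z.2 with hx
  have hf := differentiableAt_of_contDiffAt (contDiffAt_famIn hφ hz)
  have hWd := differentiableAt_of_contDiffAt (hW p q z hz)
  have ht : DifferentiableAt ℝ (fun t : ℝ ↦ (t, z.2)) z.1 :=
    (hasFDerivAt_time z.1 z.2).differentiableAt
  have hc : ContinuousAt (fun s ↦ φ s x) z.1 :=
    ContinuousAt.comp (f := fun t : ℝ ↦ (t, z.2))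
      (g := fun z : ℝ × Model m ↦ φ z.1 ((extChartAt (𝓡 m) p).symm z.2))
      (contMDiffAt_fam hφ hz.1 hz.2.1).continuousAt ht.continuousAt
  have h := cov_change_chart (c := fun s ↦ φ s x) (z := z.1) (r := q) (q := φ z.1 x)
    (W := fun s ↦ W s x) hc hz.2.2 (mem_chart_source _ _)
    (DifferentiableAt.comp (g := famIn m n p q φ) z.1 hf ht)
    (DifferentiableAt.comp (g := famSec m n p q φ W) z.1 hWd ht) (1 : ℝ)
  rw [famSec, ← hx, covTime, h, crd_vec hz.2.2]
  exact cov_time (f := famIn m n p q φ) (W := famSec m n p q φ W) hf hWd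

variable [RiemannianBundle (fun x : M ↦ TangentSpace (𝓡 m) x)]

variable (m) in
/-- The components of the orthonormal basis at `x` in the preferred chart at `p`. -/
def onbIn (p x : M) (i : Fin (Module.finrank ℝ (TangentSpace (𝓡 m) x))) : Model m :=
  crd m p x (onb m x i)

/-- Transports the basis expansion to coordinates, the form of orthonormality that the local lemmas
require. -/
lemma sum_onbIn {p x : M} (hp : x ∈ (chartAt (Model m) p).source) (u : Model m) :
    ∑ i, metricIn m p (extChartAt (𝓡 m) p x) u (onbIn m p x i) • onbIn m p x i = u := by
  have h := (onb m x).sum_repr' (vec m p x u)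
  have h2 := congrArg (crd m p x) h
  rw [crd_vec hp, map_sum] at h2
  conv_rhs => rw [← h2]
  refine Finset.sum_congr rfl fun i _ ↦ ?_
  rw [map_smul, real_inner_comm, inner_eq_metricIn hp, crd_vec hp]
  rfl

variable [IsContMDiffRiemannianBundle (𝓡 m) ∞ (Model m) (fun x : M ↦ TangentSpace (𝓡 m) x)]

/-- Writes the tension field as the trace of a bilinear map depending smoothly on the point, ready
for `contDiffAt_trace_covOneForm`. -/
lemma crd_tension_fam (hφ : IsVariation m n φ ε) (hz : z ∈ famDom m n p q φ ε) :
    famSec m n p q φ (fun t ↦ tension m n (φ t)) z =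
      ∑ i, covOneForm (chrIn n q) (famIn m n p q φ) (fderiv ℝ (famIn m n p q φ))
        (chr (metricIn m p)) z (onbIn m p ((extChartAt (𝓡 m) p).symm z.2) i)
        (onbIn m p ((extChartAt (𝓡 m) p).symm z.2) i) := by
  have hyy := (extChartAt (𝓡 m) p).right_inv hz.2.1
  have hf := contDiffAt_famIn hφ hz
  rw [famSec, tension, map_sum]
  refine Finset.sum_congr rfl fun i _ ↦ ?_
  rw [crd_secondFundamentalForm (contMDiff_slice hφ hz.1) (chart_symm_mem_source hz.2.1) hz.2.2,
    hyy, covOneForm_apply (differentiableAt_of_contDiffAt (contDiffAt_fderiv hf)),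
    ← cov_slice (differentiableAt_of_contDiffAt hf)
      (differentiableAt_of_contDiffAt (contDiffAt_fderiv_apply hf _)),
    ← fderiv_slice (differentiableAt_of_contDiffAt hf)]
  have hc : ContinuousAt (fun y : Model m ↦ (z.1, y)) z.2 := by fun_prop
  congr 1
  refine cov_congr_map Filter.EventuallyEq.rfl ?_ _
  filter_upwards [hc.eventually (famDom_mem_nhds hφ hz)] with y hy
  exact fderiv_slice (f := famIn m n p q φ) (z := (z.1, y))
    (differentiableAt_of_contDiffAt (contDiffAt_famIn hφ hy)) _

lemma smoothFam_tension (hφ : IsVariation m n φ ε) :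
    SmoothFam m n φ ε (fun t ↦ tension m n (φ t)) := by
  intro p q z hz
  have hf := contDiffAt_famIn hφ hz
  refine contDiffAt_trace_covOneForm (isMetricOn_metricIn p) hz.2.1 (contDiffAt_chrIn_famIn hz) hf
    (contDiffAt_fderiv hf) ?_
  filter_upwards [famDom_mem_nhds hφ hz] with z' hz'
  refine ⟨_, onbIn m p ((extChartAt (𝓡 m) p).symm z'.2), fun u ↦ ?_, crd_tension_fam hφ hz'⟩
  have := sum_onbIn (chart_symm_mem_source hz'.2.1) u
  rwa [(extChartAt (𝓡 m) p).right_inv hz'.2.1] at this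

lemma crd_roughLaplacian_fam (hφ : IsVariation m n φ ε) (hW : SmoothFam m n φ ε W)
    (hz : z ∈ famDom m n p q φ ε) :
    famSec m n p q φ (fun t ↦ roughLaplacian m n (φ t) (W t)) z =
      -∑ i, covOneForm (chrIn n q) (famIn m n p q φ)
        (covL (chrIn n q) (famIn m n p q φ) (famSec m n p q φ W))
        (chr (metricIn m p)) z (onbIn m p ((extChartAt (𝓡 m) p).symm z.2) i)
        (onbIn m p ((extChartAt (𝓡 m) p).symm z.2) i) := by
  have hyy := (extChartAt (𝓡 m) p).right_inv hz.2.1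
  have hf := contDiffAt_famIn hφ hz
  have hΓ := contDiffAt_chrIn_famIn hz
  have hA := contDiffAt_covL hΓ hf (hW p q z hz)
  rw [famSec, roughLaplacian, map_neg, map_sum]
  congr 1
  refine Finset.sum_congr rfl fun i _ ↦ ?_
  rw [crd_secondCovariantDerivative (contMDiff_slice hφ hz.1) (chart_symm_mem_source hz.2.1) hz.2.2
    (by rw [hyy]; exact hW.eventually_secIn hφ hz),
    hyy, covOneForm_apply (differentiableAt_of_contDiffAt hA),
    ← cov_slice (differentiableAt_of_contDiffAt hf)
      (differentiableAt_of_contDiffAt (hA.clm_apply contDiffAt_const)), covL_apply,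
    ← cov_slice (differentiableAt_of_contDiffAt hf) (differentiableAt_of_contDiffAt (hW p q z hz))]
  have hc : ContinuousAt (fun y : Model m ↦ (z.1, y)) z.2 := by fun_prop
  congr 1
  refine cov_congr_map Filter.EventuallyEq.rfl ?_ _
  filter_upwards [hc.eventually (famDom_mem_nhds hφ hz)] with y hy
  exact cov_slice (f := famIn m n p q φ) (z := (z.1, y)) (W := famSec m n p q φ W)
    (differentiableAt_of_contDiffAt (contDiffAt_famIn hφ hy))
    (differentiableAt_of_contDiffAt (hW p q _ hy)) _

/-- Δ̄W is minus the trace of the covariant derivative of the one-form ∇̄W, so the argument for the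
tension field applies with `covL` in place of the derivative of the map. Applied to the tension
field, it gives the smoothness of Δ̄τ. -/
lemma smoothFam_roughLaplacian (hφ : IsVariation m n φ ε) (hW : SmoothFam m n φ ε W) :
    SmoothFam m n φ ε (fun t ↦ roughLaplacian m n (φ t) (W t)) := by
  intro p q z hz
  have hf := contDiffAt_famIn hφ hz
  suffices h : ContDiffAt ℝ ∞
      (fun z ↦ -famSec m n p q φ (fun t ↦ roughLaplacian m n (φ t) (W t)) z) z by
    simpa using h.neg
  refine contDiffAt_trace_covOneForm (isMetricOn_metricIn p) hz.2.1 (contDiffAt_chrIn_famIn hz) hf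
    (contDiffAt_covL (contDiffAt_chrIn_famIn hz) hf (hW p q z hz)) ?_
  filter_upwards [famDom_mem_nhds hφ hz] with z' hz'
  refine ⟨_, onbIn m p ((extChartAt (𝓡 m) p).symm z'.2), fun u ↦ ?_, ?_⟩
  · have := sum_onbIn (chart_symm_mem_source hz'.2.1) u
    rwa [(extChartAt (𝓡 m) p).right_inv hz'.2.1] at this
  · rw [crd_roughLaplacian_fam hφ hW hz', neg_neg]

end Variation

/-! ### The Riemannian measure. -/

section Volume

variable {k : ℕ} {N : Type*} [TopologicalSpace N] [ChartedSpace (Model k) N]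
  [IsManifold (𝓡 k) ∞ N] [RiemannianBundle (fun q : N ↦ TangentSpace (𝓡 k) q)]
  [IsContMDiffRiemannianBundle (𝓡 k) ∞ (Model k) (fun q : N ↦ TangentSpace (𝓡 k) q)]

variable (k) in
/-- The density `√(det g_ij)` in the preferred chart at `q`. -/
def density (q : N) (y : Model k) : ℝ := √(gram (metricIn k q) y).det

lemma density_pos {q : N} {y : Model k} (hy : y ∈ (extChartAt (𝓡 k) q).target) :
    0 < density k q y := Real.sqrt_pos.2 (det_gram_pos (isMetricOn_metricIn q) hy)

lemma contDiffAt_density {q : N} {y : Model k} (hy : y ∈ (extChartAt (𝓡 k) q).target) :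
    ContDiffAt ℝ ∞ (density k q) y :=
  (contDiffAt_det_gram (isMetricOn_metricIn q) hy).sqrt
    (det_gram_pos (isMetricOn_metricIn q) hy).ne'

lemma continuousOn_density (q : N) : ContinuousOn (density k q) (extChartAt (𝓡 k) q).target :=
  fun _ hy ↦ (contDiffAt_density hy).continuousAt.continuousWithinAt

/-- The determinants of the Gram matrices of two metrics that correspond under a linear map. -/
lemma det_gram_pullback {G G' : Model k → Model k →L[ℝ] Model k →L[ℝ] ℝ} {y y' : Model k}
    (L : Model k →L[ℝ] Model k) (h : ∀ u v, G' y' u v = G y (L u) (L v)) :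
    (gram G' y').det = L.det ^ 2 * (gram G y).det := by
  set J : Matrix (Fin k) (Fin k) ℝ := Matrix.of fun c a ↦ L (coordVec a) c with hJ
  have hdet : J.det = L.det := by
    rw [ContinuousLinearMap.det,
      ← LinearMap.det_toMatrix (EuclideanSpace.basisFun (Fin k) ℝ).toBasis]
    congr 1
  have hmul : gram G' y' = J.transpose * gram G y * J := by
    ext a b
    rw [gram, Matrix.of_apply, h, metric_eq_sum_gram, Matrix.mul_apply]
    simp only [Matrix.mul_apply, Matrix.transpose_apply, hJ, Matrix.of_apply, Finset.sum_mul]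
    rw [Finset.sum_comm]
  rw [hmul, Matrix.det_mul, Matrix.det_mul, Matrix.det_transpose, hdet]
  ring

/-- The Gram determinant picks up the square of the Jacobian determinant, so its root picks up the
factor of the change of variables formula. This makes the chart measures agree on overlaps. -/
lemma density_trans {r q x : N} (hr : x ∈ (chartAt (Model k) r).source)
    (hq : x ∈ (chartAt (Model k) q).source) :
    density k r (extChartAt (𝓡 k) r x) =
      |(fderiv ℝ (trans k r q) (extChartAt (𝓡 k) r x)).det|
        * density k q (trans k r q (extChartAt (𝓡 k) r x)) := by
  rw [density, density, det_gram_pullback _ (metricIn_trans hr hq), Real.sqrt_mul (sq_nonneg _),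
    Real.sqrt_sq_eq_abs]

variable [MeasurableSpace N] [BorelSpace N]

lemma aemeasurable_chart_symm (q : N) {μ : Measure (Model k)}
    (hμ : μ ≪ volume.restrict (extChartAt (𝓡 k) q).target) :
    AEMeasurable (extChartAt (𝓡 k) q).symm μ :=
  ((continuousOn_extChartAt_symm q).aemeasurable (isOpen_target q).measurableSet).mono_ac hμ

lemma chartVolume_eq (q : N) : chartVolume k q =
    ((volume.restrict (extChartAt (𝓡 k) q).target).withDensity fun y ↦
      ENNReal.ofReal (density k q y)).map (extChartAt (𝓡 k) q).symm := by
  rw [chartVolume]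
  congr 1
  refine withDensity_congr_ae ?_
  filter_upwards [ae_restrict_mem (isOpen_target q).measurableSet] with y hy
  have hx := chart_symm_mem_source hy
  simp only [density, gram, metricIn_apply, coordField, trivializationAt_symm hx]

/-- The inverse chart is known to be continuous only on its target, so measurability is checked on
the subtype and then pushed forward. -/
lemma measurableSet_chart_preimage (q : N) {A : Set N} (hA : MeasurableSet A) :
    MeasurableSet ((extChartAt (𝓡 k) q).symm ⁻¹' A ∩ (extChartAt (𝓡 k) q).target) := by
  have h : Measurable ((extChartAt (𝓡 k) q).target.domRestrict (extChartAt (𝓡 k) q).symm) :=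
    (continuousOn_iff_continuous_domRestrict.1 (continuousOn_extChartAt_symm q)).measurable
  have h2 := (isOpen_target q).measurableSet.subtype_image (h hA)
  convert h2 using 1
  ext y
  constructor
  · rintro ⟨hyA, hy⟩
    exact ⟨⟨y, hy⟩, hyA, rfl⟩
  · rintro ⟨⟨y, hy⟩, h, rfl⟩
    exact ⟨h, hy⟩

lemma chartVolume_apply (q : N) {A : Set N} (hA : MeasurableSet A) :
    chartVolume k q A =
      ∫⁻ y in (extChartAt (𝓡 k) q).symm ⁻¹' A ∩ (extChartAt (𝓡 k) q).target,
        ENNReal.ofReal (density k q y) := by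
  rw [chartVolume_eq, Measure.map_apply_of_aemeasurable
    (aemeasurable_chart_symm q (withDensity_absolutelyContinuous _ _)) hA, withDensity_apply',
    Measure.restrict_restrict' (isOpen_target q).measurableSet]

lemma chartVolume_compl_source (q : N) : chartVolume k q (chartAt (Model k) q).sourceᶜ = 0 := by
  rw [chartVolume_apply q (chartAt (Model k) q).open_source.measurableSet.compl]
  have : (extChartAt (𝓡 k) q).symm ⁻¹' (chartAt (Model k) q).sourceᶜ ∩ (extChartAt (𝓡 k) q).target
      = ∅ := by
    ext y
    simp only [mem_inter_iff, mem_preimage, mem_compl_iff, mem_empty_iff_false, iff_false, not_and]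
    exact fun h hy ↦ h (chart_symm_mem_source hy)
  rw [this]
  simp

/-- The Riemannian measures of two charts agree on the overlap. -/
lemma chartVolume_overlap (r q : N) {A : Set N} (hA : MeasurableSet A)
    (hr : A ⊆ (chartAt (Model k) r).source) (hq : A ⊆ (chartAt (Model k) q).source) :
    chartVolume k r A = chartVolume k q A := by
  rw [chartVolume_apply r hA, chartVolume_apply q hA]
  set S := (extChartAt (𝓡 k) r).symm ⁻¹' A ∩ (extChartAt (𝓡 k) r).target with hS
  have himage : (extChartAt (𝓡 k) q).symm ⁻¹' A ∩ (extChartAt (𝓡 k) q).target =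
      trans k r q '' S := by
    ext y
    constructor
    · rintro ⟨hyA, hy⟩
      refine ⟨extChartAt (𝓡 k) r ((extChartAt (𝓡 k) q).symm y), ⟨?_, ?_⟩, ?_⟩
      · rw [mem_preimage, chart_left_inv (hr hyA)]; exact hyA
      · exact chart_mem_target (hr hyA)
      · rw [trans_chart (hr hyA), (extChartAt (𝓡 k) q).right_inv hy]
    · rintro ⟨y, ⟨hyA, hy⟩, rfl⟩
      refine ⟨?_, chart_mem_target (hq hyA)⟩
      rw [mem_preimage, trans, chart_left_inv (hq hyA)]; exact hyA
  have hmeas : MeasurableSet S := measurableSet_chart_preimage r hA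
  have hder : ∀ y ∈ S, HasFDerivWithinAt (trans k r q) (fderiv ℝ (trans k r q) y) S y := by
    rintro y ⟨hyA, hy⟩
    have h := contDiffAt_trans (k := k) (hr hyA) (hq hyA)
    rw [(extChartAt (𝓡 k) r).right_inv hy] at h
    exact (differentiableAt_of_contDiffAt h).hasFDerivAt.hasFDerivWithinAt
  have hinj : InjOn (trans k r q) S := by
    rintro y ⟨hyA, hy⟩ y' ⟨hyA', hy'⟩ h
    have h2 := congrArg (extChartAt (𝓡 k) q).symm h
    rw [trans, trans, chart_left_inv (hq hyA), chart_left_inv (hq hyA')] at h2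
    rw [← (extChartAt (𝓡 k) r).right_inv hy, h2, (extChartAt (𝓡 k) r).right_inv hy']
  rw [himage, lintegral_image_eq_lintegral_abs_det_fderiv_mul volume hmeas hder hinj]
  refine setLIntegral_congr_fun hmeas ?_
  rintro y ⟨hyA, hy⟩
  have h := density_trans (k := k) (hr hyA) (hq hyA)
  rw [(extChartAt (𝓡 k) r).right_inv hy] at h
  simp only [h, ENNReal.ofReal_mul (abs_nonneg _)]

/-- The Riemannian measure restricts to the Riemannian measure of each chart. -/
lemma riemannianVolume_restrict (p : N) :
    (riemannianVolume k N).restrict (chartAt (Model k) p).source = chartVolume k p := by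
  have hU : MeasurableSet (chartAt (Model k) p).source :=
    (chartAt (Model k) p).open_source.measurableSet
  -- A supremum of measures is not computed set by set. Instead, one measure that equals
  -- `chartVolume k p` on the chart domain is shown to dominate every chart measure.
  have hle : riemannianVolume k N ≤
      chartVolume k p + (riemannianVolume k N).restrict (chartAt (Model k) p).sourceᶜ := by
    refine iSup_le fun q ↦ Measure.le_iff.2 fun A hA ↦ ?_
    have hV : MeasurableSet (chartAt (Model k) q).source :=
      (chartAt (Model k) q).open_source.measurableSet
    rw [Measure.add_apply, Measure.restrict_apply hA,
      ← measure_inter_add_sdiff A hU, sdiff_eq]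
    refine add_le_add ?_ (Measure.le_iff'.1 (le_iSup (fun q ↦ chartVolume k q) q) _)
    have h1 : chartVolume k q (A ∩ (chartAt (Model k) p).source) =
        chartVolume k q (A ∩ (chartAt (Model k) p).source ∩ (chartAt (Model k) q).source) := by
      have h0 : chartVolume k q ((A ∩ (chartAt (Model k) p).source) \ (chartAt (Model k) q).source)
          = 0 := measure_mono_null (fun x hx ↦ hx.2) (chartVolume_compl_source q)
      rw [← measure_inter_add_sdiff (A ∩ (chartAt (Model k) p).source) hV, h0, add_zero]
    rw [h1, chartVolume_overlap q p ((hA.inter hU).inter hV) inter_subset_right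
      (inter_subset_left.trans inter_subset_right)]
    exact measure_mono (inter_subset_left.trans inter_subset_left)
  refine le_antisymm (Measure.le_iff.2 fun A hA ↦ ?_) (Measure.le_iff.2 fun A hA ↦ ?_)
  · rw [Measure.restrict_apply hA]
    refine (Measure.le_iff'.1 hle _).trans ?_
    rw [Measure.add_apply, Measure.restrict_apply (hA.inter hU)]
    have : A ∩ (chartAt (Model k) p).source ∩ (chartAt (Model k) p).sourceᶜ = ∅ := by
      rw [inter_assoc, inter_compl_self, inter_empty]
    rw [this, measure_empty, add_zero]
    exact measure_mono inter_subset_left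
  · have h0 : chartVolume k p (A \ (chartAt (Model k) p).source) = 0 :=
      measure_mono_null (fun x hx ↦ hx.2) (chartVolume_compl_source p)
    rw [Measure.restrict_apply hA, ← measure_inter_add_sdiff A hU, h0, add_zero]
    exact Measure.le_iff'.1 (le_iSup (fun q ↦ chartVolume k q) p) _

/-- Integration of functions supported in the domain of a chart. -/
lemma integral_eq_integral_chart (p : N) {f : N → ℝ} (hf : Continuous f)
    (hsupp : ∀ x ∉ (chartAt (Model k) p).source, f x = 0) :
    ∫ x, f x ∂(riemannianVolume k N) =
      ∫ y in (extChartAt (𝓡 k) p).target,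
        density k p y * f ((extChartAt (𝓡 k) p).symm y) := by
  rw [← setIntegral_eq_integral_of_forall_compl_eq_zero hsupp, riemannianVolume_restrict,
    chartVolume_eq, integral_map (aemeasurable_chart_symm p (withDensity_absolutelyContinuous _ _))
      hf.aestronglyMeasurable]
  have hm : AEMeasurable (fun y ↦ ENNReal.ofReal (density k p y))
      (volume.restrict (extChartAt (𝓡 k) p).target) :=
    ((continuousOn_density p).aemeasurable (isOpen_target p).measurableSet).ennreal_ofReal
  rw [integral_withDensity_eq_integral_toReal_smul₀ hm (by simp)]
  refine setIntegral_congr_fun (isOpen_target p).measurableSet fun y hy ↦ ?_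
  simp only [ENNReal.toReal_ofReal (density_pos hy).le, smul_eq_mul]

/-- Every point has a neighbourhood with bounded density and bounded chart image; compactness passes
from local to global finiteness. -/
instance isFiniteMeasure_riemannianVolume [CompactSpace N] :
    IsFiniteMeasure (riemannianVolume k N) := by
  have hloc : ∀ x : N, ∃ U ∈ nhds x, riemannianVolume k N U < ⊤ := by
    intro x
    have hx := mem_chart_source (Model k) x
    have hy := chart_mem_target hx
    set y₀ := extChartAt (𝓡 k) x x with hy₀
    -- The constants are arbitrary: any bound above the density at the centre and any bounded ball
    -- would do.
    set B : Set (Model k) := {y | density k x y < density k x y₀ + 1} ∩ Metric.ball y₀ 1 with hB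
    have hBn : B ∈ nhds y₀ := by
      refine Filter.inter_mem ?_ (Metric.ball_mem_nhds _ one_pos)
      exact (contDiffAt_density hy).continuousAt.eventually (gt_mem_nhds (lt_add_one _))
    obtain ⟨O, hOB, hO, hyO⟩ := mem_nhds_iff.1 hBn
    set U : Set N := (chartAt (Model k) x).source ∩ extChartAt (𝓡 k) x ⁻¹' O with hU
    have hUo : IsOpen U := by
      have := (continuousOn_extChartAt (I := 𝓡 k) x).isOpen_inter_preimage
        (isOpen_extChartAt_source x) hO
      simpa [hU] using this
    refine ⟨U, hUo.mem_nhds ⟨hx, hyO⟩, ?_⟩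
    have h1 : riemannianVolume k N U = chartVolume k x U := by
      rw [← riemannianVolume_restrict x, Measure.restrict_apply hUo.measurableSet,
        inter_eq_left.2 inter_subset_left]
    rw [h1, chartVolume_apply x hUo.measurableSet]
    have hsub : ∀ y ∈ (extChartAt (𝓡 k) x).symm ⁻¹' U ∩ (extChartAt (𝓡 k) x).target, y ∈ B := by
      rintro y ⟨hyU, hy⟩
      have := hyU.2
      rw [mem_preimage, (extChartAt (𝓡 k) x).right_inv hy] at this
      exact hOB this
    calc ∫⁻ y in (extChartAt (𝓡 k) x).symm ⁻¹' U ∩ (extChartAt (𝓡 k) x).target,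
          ENNReal.ofReal (density k x y)
        ≤ ∫⁻ _ in (extChartAt (𝓡 k) x).symm ⁻¹' U ∩ (extChartAt (𝓡 k) x).target,
          ENNReal.ofReal (density k x y₀ + 1) :=
          setLIntegral_mono' (measurableSet_chart_preimage x hUo.measurableSet) fun y hy ↦
            ENNReal.ofReal_le_ofReal (hsub y hy).1.le
      _ ≤ ENNReal.ofReal (density k x y₀ + 1) * volume (Metric.ball y₀ 1) := by
          rw [setLIntegral_const]
          gcongr
          exact fun y hy ↦ (hsub y hy).2
      _ < ⊤ := ENNReal.mul_lt_top ENNReal.ofReal_lt_top measure_ball_lt_top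
  have : IsLocallyFiniteMeasure (riemannianVolume k N) := ⟨hloc⟩
  infer_instance

end Volume

/-! ### The divergence theorem. -/

section Divergence

variable {m : ℕ} {M : Type*} [TopologicalSpace M] [ChartedSpace (Model m) M]
  [IsManifold (𝓡 m) ∞ M] [RiemannianBundle (fun x : M ↦ TangentSpace (𝓡 m) x)]
  [IsContMDiffRiemannianBundle (𝓡 m) ∞ (Model m) (fun x : M ↦ TangentSpace (𝓡 m) x)]

variable (m) in
/-- A one-form in the preferred chart at `p`. -/
def formIn (p : M) (α : ∀ x : M, TangentSpace (𝓡 m) x →ₗ[ℝ] ℝ) (y : Model m) : Model m →L[ℝ] ℝ :=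
  LinearMap.toContinuousLinearMap
    ((α ((extChartAt (𝓡 m) p).symm y)).comp (vec m p ((extChartAt (𝓡 m) p).symm y)).toLinearMap)

lemma formIn_apply (p : M) (α : ∀ x : M, TangentSpace (𝓡 m) x →ₗ[ℝ] ℝ) (y u : Model m) :
    formIn m p α y u =
      α ((extChartAt (𝓡 m) p).symm y) (vec m p ((extChartAt (𝓡 m) p).symm y) u) := rfl

lemma formIn_onbIn {p x : M} (hx : x ∈ (chartAt (Model m) p).source)
    (α : ∀ x : M, TangentSpace (𝓡 m) x →ₗ[ℝ] ℝ) (i) :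
    formIn m p α (extChartAt (𝓡 m) p x) (onbIn m p x i) = α x (onb m x i) := by
  rw [formIn_apply, chart_left_inv hx, onbIn, vec_crd hx]

variable (m) in
/-- The trace of the covariant derivative of a one-form, computed in the preferred chart at `p`. -/
def divIn (p : M) (α : ∀ x : M, TangentSpace (𝓡 m) x →ₗ[ℝ] ℝ) (x : M) : ℝ :=
  ∑ i, fderiv ℝ (formIn m p α) (extChartAt (𝓡 m) p x) (onbIn m p x i) (onbIn m p x i)
    - formIn m p α (extChartAt (𝓡 m) p x)
        (∑ i, chrIn m p (extChartAt (𝓡 m) p x) (onbIn m p x i) (onbIn m p x i))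

/-- Integrals of derivatives of compactly supported functions vanish. -/
lemma integral_fderiv_eq_zero {E : Type*} [NormedAddCommGroup E] [NormedSpace ℝ E]
    [FiniteDimensional ℝ E] [MeasurableSpace E] [BorelSpace E] (μ : Measure E) [μ.IsAddHaarMeasure]
    {w : E → ℝ} (hw : ContDiff ℝ ∞ w) (hc : HasCompactSupport w) (v : E) :
    Integrable (fun y ↦ fderiv ℝ w y v) μ ∧ ∫ y, fderiv ℝ w y v ∂μ = 0 := by
  have hcont : Continuous fun y ↦ fderiv ℝ w y v :=
    (hw.continuous_fderiv (by simp)).clm_apply continuous_const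
  have hwi : Integrable (fun y ↦ fderiv ℝ w y v) μ :=
    hcont.integrable_of_hasCompactSupport (hc.fderiv_apply (𝕜 := ℝ) v)
  refine ⟨hwi, ?_⟩
  -- Integration by parts against the constant function 1.
  have h := integral_mul_fderiv_eq_neg_fderiv_mul_of_integrable (μ := μ) (f := w)
    (g := fun _ ↦ (1 : ℝ)) (v := v) (by simpa using hwi) (by simp)
    (by simpa using hw.continuous.integrable_of_hasCompactSupport hc)
    (fun x _ ↦ (hw.differentiable (by simp)) x) (fun x _ ↦ differentiableAt_const _)
  simpa using h.symm

variable [T2Space M] [CompactSpace M] [MeasurableSpace M] [BorelSpace M]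

/-- The divergence theorem for a one-form multiplied by a function supported in a chart. -/
lemma integral_divIn_mul (p : M) {α : ∀ x : M, TangentSpace (𝓡 m) x →ₗ[ℝ] ℝ}
    (hα : ∀ y ∈ (extChartAt (𝓡 m) p).target, ContDiffAt ℝ ∞ (formIn m p α) y)
    {ρ : M → ℝ} (hρ : ContMDiff (𝓡 m) 𝓘(ℝ, ℝ) ∞ ρ)
    (hsupp : tsupport ρ ⊆ (chartAt (Model m) p).source) :
    Continuous (fun x ↦ ρ x * divIn m p α x
      + ∑ i, mvfderiv (𝓡 m) ρ x (onb m x i) * α x (onb m x i)) ∧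
    ∫ x, (ρ x * divIn m p α x + ∑ i, mvfderiv (𝓡 m) ρ x (onb m x i) * α x (onb m x i))
      ∂(riemannianVolume m M) = 0 := by
  set f : M → ℝ := fun x ↦ ρ x * divIn m p α x
      + ∑ i, mvfderiv (𝓡 m) ρ x (onb m x i) * α x (onb m x i) with hf
  set T := (extChartAt (𝓡 m) p).target with hT
  set r : Model m → ℝ := fun y ↦ ρ ((extChartAt (𝓡 m) p).symm y) with hr
  set K : Set (Model m) := extChartAt (𝓡 m) p '' tsupport ρ with hK
  have hG := isMetricOn_metricIn (k := m) p
  have hKc : IsCompact K := (isClosed_tsupport ρ).isCompact.image_of_continuousOn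
    ((continuousOn_extChartAt p).mono (by simpa using hsupp))
  have hrK : ∀ y ∈ T, y ∉ K → r y = 0 := by
    intro y hy hyK
    by_contra h
    exact hyK ⟨_, subset_tsupport ρ h, (extChartAt (𝓡 m) p).right_inv hy⟩
  have hrd : ∀ y ∈ T, ContDiffAt ℝ ∞ r y := fun y hy ↦
    (hρ.contMDiffAt.comp y (contMDiffAt_chart_symm hy)).contDiffAt
  -- √g times the components of the vector field dual to ρα; by `divergence_formula` their
  -- coordinate divergence is √g · div(ρα).
  set w₀ : Fin m → Model m → ℝ := fun b y ↦
    density m p y * (metricIn m p y).inverse (r y • formIn m p α y) b with hw₀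
  have hw₀d : ∀ b, ∀ y ∈ T, ContDiffAt ℝ ∞ (w₀ b) y := fun b y hy ↦
    (contDiffAt_density hy).mul ((EuclideanSpace.proj (𝕜 := ℝ) b).contDiff.contDiffAt.comp y
      ((hG.contDiffAt_inverse hy).clm_apply ((hrd y hy).smul (hα y hy))))
  -- `w₀` is uncontrolled outside the chart image, but inside it vanishes off the compact set `K`.
  -- Cutting it off by zero thus yields a smooth compactly supported function on the whole model
  -- space.
  set w : Fin m → Model m → ℝ := fun b ↦ T.indicator (w₀ b) with hw
  have hwK : ∀ b, ∀ y ∉ K, w b y = 0 := by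
    intro b y hyK
    by_cases hy : y ∈ T
    · simp [hw, hw₀, indicator_of_mem hy, hrK y hy hyK]
    · exact indicator_of_notMem hy _
  have hwT : ∀ b, ∀ y ∈ T, w b =ᶠ[nhds y] w₀ b := fun b y hy ↦ by
    filter_upwards [(isOpen_target p).mem_nhds hy] with y' hy' using indicator_of_mem hy' _
  have hKT : K ⊆ T := by
    rintro _ ⟨x, hx, rfl⟩
    exact chart_mem_target (hsupp hx)
  have hw0 : ∀ b, ∀ y ∉ K, w b =ᶠ[nhds y] fun _ ↦ 0 := fun b y hy ↦ by
    filter_upwards [hKc.isClosed.isOpen_compl.mem_nhds hy] with y' hy' using hwK b y' hy'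
  have hwd : ∀ b, ContDiff ℝ ∞ (w b) := by
    refine fun b ↦ contDiff_iff_contDiffAt.2 fun y ↦ ?_
    by_cases hy : y ∈ T
    · exact (hw₀d b y hy).congr_of_eventuallyEq (hwT b y hy)
    · exact contDiffAt_const.congr_of_eventuallyEq (hw0 b y fun h ↦ hy (hKT h))
  have hwc : ∀ b, HasCompactSupport (w b) := fun b ↦ HasCompactSupport.intro hKc (hwK b)
  set h : Model m → ℝ := fun y ↦ ∑ b, fderiv ℝ (w b) y (coordVec b) with hh
  have hhc : Continuous h := continuous_finsetSum _ fun b _ ↦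
    ((hwd b).continuous_fderiv (by simp)).clm_apply continuous_const
  have hh0 : ∀ y ∉ T, h y = 0 := by
    intro y hy
    refine Finset.sum_eq_zero fun b _ ↦ ?_
    rw [(hw0 b y fun h ↦ hy (hKT h)).fderiv_eq]
    simp
  have key : ∀ x ∈ (chartAt (Model m) p).source, h (extChartAt (𝓡 m) p x) =
      density m p (extChartAt (𝓡 m) p x) * f x := by
    intro x hx
    have hy := chart_mem_target hx
    have hrx : r (extChartAt (𝓡 m) p x) = ρ x := by rw [hr]; simp only [chart_left_inv hx]
    have hrd' := differentiableAt_of_contDiffAt (hrd _ hy)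
    have hαd' := differentiableAt_of_contDiffAt (hα _ hy)
    have h1 : h (extChartAt (𝓡 m) p x) =
        ∑ b, fderiv ℝ (w₀ b) (extChartAt (𝓡 m) p x) (coordVec b) :=
      Finset.sum_congr rfl fun b _ ↦ by rw [(hwT b _ hy).fderiv_eq]
    rw [h1]
    have h2 := divergence_formula hG hy (sum_onbIn hx) (hrd'.fun_smul hαd')
    simp only [hw₀, density]
    rw [h2]
    congr 1
    rw [fderiv_fun_smul hrd' hαd']
    simp only [hf, divIn, hrx, add_apply, smul_apply, ContinuousLinearMap.smulRight_apply,
      smul_eq_mul, formIn_onbIn hx, Finset.sum_add_distrib, ← Finset.mul_sum]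
    have h3 : ∀ i, mvfderiv (𝓡 m) ρ x (onb m x i) =
        fderiv ℝ r (extChartAt (𝓡 m) p x) (onbIn m p x i) := fun i ↦
      mvfderiv_eq_fderiv hx hrd' _
    simp only [h3, chrIn]
    ring
  have hoff : ∀ x ∉ tsupport ρ, f x = 0 := by
    intro x hx
    have h0 : ρ =ᶠ[nhds x] fun _ ↦ 0 := by
      filter_upwards [(isClosed_tsupport ρ).isOpen_compl.mem_nhds hx] with x' hx'
      exact image_eq_zero_of_notMem_tsupport hx'
    have h1 : ∀ X, mvfderiv (𝓡 m) ρ x X = 0 := by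
      intro X
      rw [mvfderiv, h0.mfderiv_eq, mfderiv_const]
      rfl
    simp [hf, h0.self_of_nhds, h1]
  -- The bases in `f` may jump, so continuity is read off the coordinate expression `h / density` in
  -- the chart, and off the vanishing of `f` outside the support of `ρ`.
  have hfc : Continuous f := by
    refine continuous_iff_continuousAt.2 fun x ↦ ?_
    by_cases hx : x ∈ (chartAt (Model m) p).source
    · have heq : f =ᶠ[nhds x] fun x ↦
          h (extChartAt (𝓡 m) p x) / density m p (extChartAt (𝓡 m) p x) := by
        filter_upwards [source_mem_nhds hx] with x' hx'
        rw [key x' hx', mul_div_cancel_left₀ _ (density_pos (chart_mem_target hx')).ne']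
      refine ContinuousAt.congr ?_ heq.symm
      have hc := (contMDiffAt_chart (k := m) hx).continuousAt
      exact (hhc.continuousAt.comp hc).div (ContinuousAt.comp (g := density m p)
        (contDiffAt_density (chart_mem_target hx)).continuousAt hc)
        (density_pos (chart_mem_target hx)).ne'
    · have heq : f =ᶠ[nhds x] fun _ ↦ 0 := by
        have hx' : x ∉ tsupport ρ := fun h ↦ hx (hsupp h)
        filter_upwards [(isClosed_tsupport ρ).isOpen_compl.mem_nhds hx'] with x' hx'
        exact hoff x' hx'
      exact continuousAt_const.congr heq.symm
  refine ⟨hfc, ?_⟩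
  rw [integral_eq_integral_chart p hfc fun x hx ↦ hoff x fun h ↦ hx (hsupp h)]
  have h1 : ∫ y in T, density m p y * f ((extChartAt (𝓡 m) p).symm y) = ∫ y in T, h y := by
    refine setIntegral_congr_fun (isOpen_target p).measurableSet fun y hy ↦ ?_
    have := key _ (chart_symm_mem_source hy)
    rw [(extChartAt (𝓡 m) p).right_inv hy] at this
    exact this.symm
  rw [h1, setIntegral_eq_integral_of_forall_compl_eq_zero hh0,
    integral_finsetSum _ fun b _ ↦ (integral_fderiv_eq_zero volume (hwd b) (hwc b) _).1]
  exact Finset.sum_eq_zero fun b _ ↦ (integral_fderiv_eq_zero volume (hwd b) (hwc b) _).2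

/-- The divergence theorem on a closed Riemannian manifold. -/
theorem integral_divergence_eq_zero {α : ∀ x : M, TangentSpace (𝓡 m) x →ₗ[ℝ] ℝ}
    (hα : ∀ p : M, ∀ y ∈ (extChartAt (𝓡 m) p).target, ContDiffAt ℝ ∞ (formIn m p α) y)
    {D : M → ℝ} (hD : ∀ p x : M, x ∈ (chartAt (Model m) p).source → D x = divIn m p α x) :
    Continuous D ∧ ∫ x, D x ∂(riemannianVolume m M) = 0 := by
  obtain ⟨t, -, ht⟩ := isCompact_univ.elim_nhds_subcover
    (fun p : M ↦ (chartAt (Model m) p).source) fun p _ ↦ source_mem_nhds (mem_chart_source _ p)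
  obtain ⟨ρ, hρ⟩ := SmoothPartitionOfUnity.exists_isSubordinate (𝓡 m) (isClosed_univ (X := M))
    (fun p : t ↦ (chartAt (Model m) (p : M)).source) (fun p ↦ (chartAt (Model m) _).open_source)
    (fun x hx ↦ by
      obtain ⟨p, hp, hx⟩ := mem_iUnion₂.1 (ht hx)
      exact mem_iUnion.2 ⟨⟨p, hp⟩, hx⟩)
  have hsum : ∀ x, ∑ p : t, ρ p x = 1 := fun x ↦ by
    rw [← finsum_eq_sum_of_fintype]; exact ρ.sum_eq_one (mem_univ x)
  have hmain := fun p : t ↦ integral_divIn_mul (p : M) (hα p) (ρ p).contMDiff (hρ p)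
  -- Because ∑ ρ_p = 1 and therefore ∑ dρ_p = 0, the divergence of α is the sum of the divergences
  -- of the forms ρ_p α, each supported in a chart.
  have hDsum : D = fun x ↦ ∑ p : t, (ρ p x * divIn m (p : M) α x
      + ∑ i, mvfderiv (𝓡 m) (ρ p) x (onb m x i) * α x (onb m x i)) := by
    funext x
    -- Outside the chart at `p` the value of `divIn` is meaningless, but there `ρ p` vanishes.
    have h1 : ∀ p : t, ρ p x * divIn m (p : M) α x = ρ p x * D x := by
      intro p
      by_cases hx : x ∈ (chartAt (Model m) (p : M)).source
      · rw [hD p x hx]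
      · rw [image_eq_zero_of_notMem_tsupport fun h ↦ hx (hρ p h), zero_mul, zero_mul]
    have hx := mem_chart_source (Model m) x
    have hd : ∀ p : t, DifferentiableAt ℝ (fun y ↦ ρ p ((extChartAt (𝓡 m) x).symm y))
        (extChartAt (𝓡 m) x x) := fun p ↦ differentiableAt_of_contDiffAt
      ((ρ p).contMDiff.contMDiffAt.comp _
        (contMDiffAt_chart_symm (chart_mem_target hx))).contDiffAt
    have h2 : ∀ X, ∑ p : t, mvfderiv (𝓡 m) (ρ p) x X = 0 := by
      intro X
      simp only [mvfderiv_eq_fderiv hx (hd _)]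
      rw [← sum_apply, ← fderiv_fun_sum fun p _ ↦ hd p]
      simp only [hsum]
      simp
    rw [Finset.sum_add_distrib, Finset.sum_congr rfl fun p _ ↦ h1 p, ← Finset.sum_mul, hsum,
      one_mul, Finset.sum_comm]
    simp only [← Finset.sum_mul, h2, zero_mul, Finset.sum_const_zero, add_zero]
  refine ⟨hDsum ▸ continuous_finsetSum _ fun p _ ↦ (hmain p).1, ?_⟩
  rw [hDsum, integral_finsetSum _ fun p _ ↦
    (hmain p).1.integrable_of_hasCompactSupport (HasCompactSupport.of_compactSpace _)]
  exact Finset.sum_eq_zero fun p _ ↦ (hmain p).2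

end Divergence

/-! ### The Hodge-type operator d + δ and the trienergy density. -/

section Energy

variable {m n : ℕ}
  {M : Type*} [TopologicalSpace M] [ChartedSpace (Model m) M] [IsManifold (𝓡 m) ∞ M]
  [RiemannianBundle (fun x : M ↦ TangentSpace (𝓡 m) x)]
  [IsContMDiffRiemannianBundle (𝓡 m) ∞ (Model m) (fun x : M ↦ TangentSpace (𝓡 m) x)]
  {N : Type*} [TopologicalSpace N] [ChartedSpace (Model n) N] [IsManifold (𝓡 n) ∞ N]
  [RiemannianBundle (fun q : N ↦ TangentSpace (𝓡 n) q)]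
  [IsContMDiffRiemannianBundle (𝓡 n) ∞ (Model n) (fun q : N ↦ TangentSpace (𝓡 n) q)]
  {φ : M → N}

lemma eq_of_crd_eq {q x : N} (hx : x ∈ (chartAt (Model n) q).source)
    {v w : TangentSpace (𝓡 n) x} (h : crd n q x v = crd n q x w) : v = w := by
  rw [← vec_crd hx v, h, vec_crd hx]

/-- Serves to discard the sign of δ(dφ) = -τ under the norm. -/
lemma covAlong_neg {x : M} (hφ : MDifferentiableAt (𝓡 m) (𝓡 n) φ x)
    {W : ∀ x, TangentSpace (𝓡 n) (φ x)}
    (hW : DifferentiableAt ℝ (secIn m n x (φ x) φ W) (extChartAt (𝓡 m) x x))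
    (X : TangentSpace (𝓡 m) x) :
    covAlong m n φ (fun x ↦ -W x) x X = -covAlong m n φ W x X := by
  have hp := mem_chart_source (Model m) x
  have hq := mem_chart_source (Model n) (φ x)
  have hneg : secIn m n x (φ x) φ (fun x ↦ -W x) = fun y ↦ -secIn m n x (φ x) φ W y := by
    funext y; rw [secIn, map_neg, secIn]
  refine eq_of_crd_eq hq ?_
  rw [map_neg, crd_covAlong hp hq hφ hW, crd_covAlong hp hq hφ (by rw [hneg]; exact hW.fun_neg),
    hneg]
  simp only [cov, fderiv_fun_neg, neg_apply, map_neg]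
  abel

lemma covAlong_zero {x : M} (hφ : MDifferentiableAt (𝓡 m) (𝓡 n) φ x)
    (X : TangentSpace (𝓡 m) x) :
    covAlong m n φ (fun x ↦ (0 : TangentSpace (𝓡 n) (φ x))) x X = 0 := by
  have hp := mem_chart_source (Model m) x
  have hq := mem_chart_source (Model n) (φ x)
  have h0 : secIn m n x (φ x) φ (fun x ↦ (0 : TangentSpace (𝓡 n) (φ x))) = fun _ ↦ 0 := by
    funext y; rw [secIn, map_zero]
  refine eq_of_crd_eq hq ?_
  rw [map_zero, crd_covAlong hp hq hφ (by rw [h0]; exact differentiableAt_const _), h0]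
  simp [cov]

/-- The second fundamental form is symmetric. -/
lemma secondFundamentalForm_symm (hφ : ContMDiff (𝓡 m) (𝓡 n) ∞ φ) (x : M)
    (X Y : TangentSpace (𝓡 m) x) :
    secondFundamentalForm m n φ x X Y = secondFundamentalForm m n φ x Y X := by
  have hp := mem_chart_source (Model m) x
  have hq := mem_chart_source (Model n) (φ x)
  refine eq_of_crd_eq hq ?_
  have hq' : φ ((extChartAt (𝓡 m) x).symm (extChartAt (𝓡 m) x x)) ∈
      (chartAt (Model n) (φ x)).source := by rwa [chart_left_inv hp]
  rw [crd_secondFundamentalForm hφ hp hq, crd_secondFundamentalForm hφ hp hq,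
    cov_fderiv_comm (Γ := chrIn n (φ x)) (f := mapIn m n x (φ x) φ)
      (chr_symm (isMetricOn_metricIn _) (chart_mem_target hq'))
      (contDiffAt_mapIn (chart_mem_target hp) hq' hφ)]
  congr 2
  exact chr_symm (isMetricOn_metricIn _) (chart_mem_target hp) _ _

lemma covForm_zero (hφ : ContMDiff (𝓡 m) (𝓡 n) ∞ φ) {p : ℕ} (x : M) (X : TangentSpace (𝓡 m) x)
    (Y : Fin p → TangentSpace (𝓡 m) x) :
    covForm m n φ (fun x _ ↦ (0 : TangentSpace (𝓡 n) (φ x))) x X Y = 0 := by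
  rw [covForm, covAlong_zero ((hφ x).mdifferentiableAt (by simp))]
  simp

lemma extD_zero (hφ : ContMDiff (𝓡 m) (𝓡 n) ∞ φ) (p : ℕ) :
    extD m n φ (p := p) (fun x _ ↦ (0 : TangentSpace (𝓡 n) (φ x))) = fun _ _ ↦ 0 := by
  funext x Y
  simp [extD, covForm_zero hφ]

lemma codiff_zero (hφ : ContMDiff (𝓡 m) (𝓡 n) ∞ φ) (p : ℕ) :
    codiff m n φ (p := p) (fun x _ ↦ (0 : TangentSpace (𝓡 n) (φ x))) = fun _ _ ↦ 0 := by
  funext x Y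
  simp [codiff, covForm_zero hφ]

lemma covForm_differential (x : M) (X : TangentSpace (𝓡 m) x)
    (Y : Fin 1 → TangentSpace (𝓡 m) x) :
    covForm m n φ (differentialForm m n φ 1) x X Y = secondFundamentalForm m n φ x X (Y 0) := by
  simp [covForm, secondFundamentalForm, differentialForm]

/-- `δ(dφ) = -τ(φ)`. -/
lemma codiff_differential :
    codiff m n φ (differentialForm m n φ 1) = fun x _ ↦ -tension m n φ x := by
  funext x Y
  simp only [codiff, covForm_differential, tension, Fin.cons_zero]

/-- `d(dφ) = 0`. -/
lemma extD_differential (hφ : ContMDiff (𝓡 m) (𝓡 n) ∞ φ) :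
    extD m n φ (differentialForm m n φ 1) = fun _ _ ↦ 0 := by
  funext x Y
  have h := Fin.sum_univ_two fun i : Fin 2 ↦ (-1 : ℝ) ^ (i : ℕ) •
    covForm m n φ (differentialForm m n φ 1) x (Y i) (i.removeNth Y)
  refine h.trans ?_
  rw [covForm_differential, covForm_differential, secondFundamentalForm_symm hφ x (Y 1)]
  simp [Fin.removeNth]

variable (m n) in
/-- A section of `φ⁻¹TN` as a form of mixed degree. -/
def sectionForm (φ : M → N) (W : ∀ x, TangentSpace (𝓡 n) (φ x)) : ∀ p, FormAlong m n φ p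
  | 0 => fun x _ ↦ W x
  | _ + 1 => fun _ _ ↦ 0

/-- `(d + δ)dφ = -τ(φ)`. -/
lemma dPlusDelta_differential (hφ : ContMDiff (𝓡 m) (𝓡 n) ∞ φ) :
    dPlusDelta m n φ (differentialForm m n φ) = sectionForm m n φ fun x ↦ -tension m n φ x := by
  funext p
  match p with
  | 0 => exact codiff_differential
  | 1 =>
    funext x Y
    change extD m n φ (fun _ _ ↦ 0) x Y + codiff m n φ (fun _ _ ↦ 0) x Y = 0
    rw [extD_zero hφ, codiff_zero hφ, add_zero]
  | 2 =>
    funext x Y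
    change extD m n φ (differentialForm m n φ 1) x Y + codiff m n φ (fun _ _ ↦ 0) x Y = 0
    rw [extD_differential hφ, codiff_zero hφ, add_zero]
  | p + 3 =>
    funext x Y
    change extD m n φ (fun _ _ ↦ 0) x Y + codiff m n φ (fun _ _ ↦ 0) x Y = 0
    rw [extD_zero hφ, codiff_zero hφ, add_zero]

/-- `|(d + δ)W|² = |∇̄W|²` for a section `W` of `φ⁻¹TN`. -/
lemma formNormSq_dPlusDelta_sectionForm (hφ : ContMDiff (𝓡 m) (𝓡 n) ∞ φ)
    (W : ∀ x, TangentSpace (𝓡 n) (φ x)) (x : M) :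
    formNormSq m n φ (dPlusDelta m n φ (sectionForm m n φ W)) x = covNormSq m n φ W x := by
  have h0 : dPlusDelta m n φ (sectionForm m n φ W) 0 = fun _ _ ↦ 0 := codiff_zero hφ 0
  have h1 : dPlusDelta m n φ (sectionForm m n φ W) 1 =
      fun x Y ↦ covAlong m n φ W x (Y 0) := by
    funext x Y
    change extD m n φ (fun x _ ↦ W x) x Y + codiff m n φ (fun _ _ ↦ 0) x Y = _
    rw [codiff_zero hφ, add_zero]
    simp [extD, covForm]
  have h2 : ∀ p, dPlusDelta m n φ (sectionForm m n φ W) (p + 2) = fun _ _ ↦ 0 := by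
    intro p
    funext x Y
    change extD m n φ (fun _ _ ↦ 0) x Y + codiff m n φ (fun _ _ ↦ 0) x Y = 0
    rw [extD_zero hφ, codiff_zero hφ, add_zero]
  have hne : ∀ p, p ≠ 1 → dPlusDelta m n φ (sectionForm m n φ W) p = fun _ _ ↦ 0 := by
    intro p hp
    match p with
    | 0 => exact h0
    | 1 => exact absurd rfl hp
    | p + 2 => exact h2 p
  rw [formNormSq, covNormSq]
  -- Only degree one contributes, with factor 1/1!. If `m = 0` degree one is absent from the range
  -- of summation, but then the basis is empty and the other side vanishes as well.
  rcases Nat.eq_zero_or_pos m with rfl | hm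
  · have : IsEmpty (Fin (Module.finrank ℝ (TangentSpace (𝓡 0) x))) := by
      have h : Module.finrank ℝ (TangentSpace (𝓡 0) x) = 0 :=
        (finrank_euclideanSpace_fin : Module.finrank ℝ (Model 0) = 0)
      rw [h]; infer_instance
    rw [Finset.univ_eq_empty (α := Fin (Module.finrank ℝ (TangentSpace (𝓡 0) x)))]
    simp [h0]
  · rw [Finset.sum_eq_single_of_mem 1 (Finset.mem_range.2 (by omega))
      (fun p _ hp ↦ by rw [hne p hp]; simp), h1]
    simp only [Nat.factorial_one, Nat.cast_one, div_one, one_mul]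
    exact Fintype.sum_equiv (Equiv.funUnique (Fin 1) _) _ _ fun i ↦ rfl

end Energy

section FamDom

variable {m n : ℕ} {M : Type*} [TopologicalSpace M] [ChartedSpace (Model m) M]
  {N : Type*} [TopologicalSpace N] [ChartedSpace (Model n) N]

lemma mem_famDom {φ : ℝ → M → N} {ε t : ℝ} (ht : t ∈ Ioo (-ε) ε) {p x : M} {q : N}
    (hp : x ∈ (chartAt (Model m) p).source) (hq : φ t x ∈ (chartAt (Model n) q).source) :
    (t, extChartAt (𝓡 m) p x) ∈ famDom m n p q φ ε :=
  ⟨ht, chart_mem_target hp, by rwa [chart_left_inv hp]⟩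

end FamDom

/-! ### The trienergy density along a variation. -/

section EnergyFamily

variable {m n : ℕ}
  {M : Type*} [TopologicalSpace M] [ChartedSpace (Model m) M] [IsManifold (𝓡 m) ∞ M]
  [RiemannianBundle (fun x : M ↦ TangentSpace (𝓡 m) x)]
  [IsContMDiffRiemannianBundle (𝓡 m) ∞ (Model m) (fun x : M ↦ TangentSpace (𝓡 m) x)]
  {N : Type*} [TopologicalSpace N] [ChartedSpace (Model n) N] [IsManifold (𝓡 n) ∞ N]
  [RiemannianBundle (fun q : N ↦ TangentSpace (𝓡 n) q)]
  [IsContMDiffRiemannianBundle (𝓡 n) ∞ (Model n) (fun q : N ↦ TangentSpace (𝓡 n) q)]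
  {φ : ℝ → M → N} {ε : ℝ}

/-- `|(d + δ)(d + δ)(d + δ)φ_t|² = |∇̄τ(φ_t)|²`. -/
lemma trienergyDensity_eq (hφ : IsVariation m n φ ε) {t : ℝ} (ht : t ∈ Ioo (-ε) ε) :
    trienergyDensity m n (φ t) = covNormSq m n (φ t) (tension m n (φ t)) := by
  funext x
  have hs := contMDiff_slice hφ ht
  rw [trienergyDensity, dPlusDelta_differential hs, formNormSq_dPlusDelta_sectionForm hs,
    covNormSq, covNormSq]
  refine Finset.sum_congr rfl fun i _ ↦ ?_
  rw [covAlong_neg ((hs x).mdifferentiableAt (by simp)), norm_neg]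
  exact differentiableAt_of_contDiffAt ((smoothFam_tension hφ).eventually_secIn hφ
    (mem_famDom ht (mem_chart_source _ x) (mem_chart_source _ _))).self_of_nhds

end EnergyFamily

/-! ### Differentiation under the integral sign. -/

section Leibniz

variable {m : ℕ} {M : Type*} [TopologicalSpace M] [ChartedSpace (Model m) M]
  [IsManifold (𝓡 m) ∞ M] [CompactSpace M] [MeasurableSpace M] [BorelSpace M]

/-- Differentiation of the integral of a smooth family of functions on a compact manifold. -/
lemma hasDerivAt_integral_of_smooth (μ : Measure M) [IsFiniteMeasure μ] {ε : ℝ} (hε : 0 < ε)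
    {E : ℝ → M → ℝ}
    (hE : ∀ (p : M) (z : ℝ × Model m), z.1 ∈ Ioo (-ε) ε → z.2 ∈ (extChartAt (𝓡 m) p).target →
      ContDiffAt ℝ ∞ (fun z : ℝ × Model m ↦ E z.1 ((extChartAt (𝓡 m) p).symm z.2)) z) :
    (∀ t ∈ Ioo (-ε) ε, Continuous (E t)) ∧ Continuous (fun x ↦ deriv (fun t ↦ E t x) 0) ∧
      HasDerivAt (fun t ↦ ∫ x, E t x ∂μ) (∫ x, deriv (fun t ↦ E t x) 0 ∂μ) 0 := by
  have hline : ∀ p x : M, x ∈ (chartAt (Model m) p).source → ∀ t ∈ Ioo (-ε) ε,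
      HasDerivAt (fun t ↦ E t x) (fderiv ℝ (fun z : ℝ × Model m ↦
        E z.1 ((extChartAt (𝓡 m) p).symm z.2)) (t, extChartAt (𝓡 m) p x) (1, 0)) t := by
    intro p x hp t ht
    have h1 := (differentiableAt_of_contDiffAt
      (hE p (t, extChartAt (𝓡 m) p x) ht (chart_mem_target hp))).hasFDerivAt
    have h2 : HasDerivAt (fun s : ℝ ↦ (s, extChartAt (𝓡 m) p x)) ((1 : ℝ), (0 : Model m)) t :=
      (hasDerivAt_id t).prodMk (hasDerivAt_const t _)
    have h3 := h1.comp_hasDerivAt t h2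
    simpa only [Function.comp_def, chart_left_inv hp] using h3
  have hchart : ∀ (t : ℝ) (x : M), ContinuousAt (fun w : ℝ × M ↦ (w.1, extChartAt (𝓡 m) x w.2))
      (t, x) := fun t x ↦ continuousAt_fst.prodMk
    (ContinuousAt.comp (f := Prod.snd) (continuousAt_extChartAt x) continuousAt_snd)
  have hder : ∀ t ∈ Ioo (-ε) ε, ∀ x : M,
      ContinuousAt (fun w : ℝ × M ↦ deriv (fun t ↦ E t w.2) w.1) (t, x) := by
    intro t ht x
    have hx := mem_chart_source (Model m) x
    have heq : (fun w : ℝ × M ↦ deriv (fun t ↦ E t w.2) w.1) =ᶠ[nhds (t, x)] fun w ↦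
        fderiv ℝ (fun z : ℝ × Model m ↦ E z.1 ((extChartAt (𝓡 m) x).symm z.2))
          (w.1, extChartAt (𝓡 m) x w.2) (1, 0) := by
      filter_upwards [continuousAt_fst.eventually (isOpen_Ioo.mem_nhds ht),
        continuousAt_snd.eventually (source_mem_nhds hx)] with w hw1 hw2
      exact (hline x w.2 hw2 w.1 hw1).deriv
    refine ContinuousAt.congr ?_ heq.symm
    exact ContinuousAt.comp (f := fun w : ℝ × M ↦ (w.1, extChartAt (𝓡 m) x w.2)) (x := (t, x))
      (contDiffAt_fderiv_apply (hE x (t, extChartAt (𝓡 m) x x) ht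
        (chart_mem_target hx)) (1, 0)).continuousAt (hchart t x)
  have hcont : ∀ t ∈ Ioo (-ε) ε, Continuous (E t) := by
    intro t ht
    refine continuous_iff_continuousAt.2 fun x ↦ ?_
    have hx := mem_chart_source (Model m) x
    have h1 := (hE x (t, extChartAt (𝓡 m) x x) ht (chart_mem_target hx)).continuousAt
    have h2 : ContinuousAt (fun x' : M ↦ (t, extChartAt (𝓡 m) x x')) x :=
      continuousAt_const.prodMk (continuousAt_extChartAt x)
    refine (ContinuousAt.comp (f := fun x' : M ↦ (t, extChartAt (𝓡 m) x x')) h1 h2).congr ?_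
    filter_upwards [source_mem_nhds hx] with x' hx'
    simp only [Function.comp_apply, chart_left_inv hx']
  have h0 : (0 : ℝ) ∈ Ioo (-ε) ε := ⟨by linarith, hε⟩
  have hder0 : Continuous (fun x ↦ deriv (fun t ↦ E t x) 0) :=
    continuous_iff_continuousAt.2 fun x ↦ ContinuousAt.comp (f := fun x : M ↦ ((0 : ℝ), x))
      (hder 0 h0 x) (continuousAt_const.prodMk continuousAt_id)
  refine ⟨hcont, hder0, ?_⟩
  have hsub : Icc (-(ε / 2)) (ε / 2) ⊆ Ioo (-ε) ε := fun t ht ↦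
    ⟨by linarith [ht.1], by linarith [ht.2]⟩
  -- Halving the time interval makes it compact. The time derivative is jointly continuous on the
  -- compact product with `M`, so a constant dominates it.
  obtain ⟨C, hC⟩ := ((isCompact_Icc (a := -(ε / 2)) (b := ε / 2)).prod
    (isCompact_univ (X := M))).exists_bound_of_continuousOn
    (f := fun w : ℝ × M ↦ deriv (fun t ↦ E t w.2) w.1)
    fun w hw ↦ (hder w.1 (hsub hw.1) w.2).continuousWithinAt
  refine (hasDerivAt_integral_of_dominated_loc_of_deriv_le (bound := fun _ ↦ C)
    (F' := fun t x ↦ deriv (fun t ↦ E t x) t)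
    (Icc_mem_nhds (by linarith : -(ε / 2) < 0) (by linarith : 0 < ε / 2)) ?_ ?_ ?_ ?_ ?_ ?_).2
  · filter_upwards [isOpen_Ioo.mem_nhds h0] with t ht using (hcont t ht).aestronglyMeasurable
  · exact (hcont 0 h0).integrable_of_hasCompactSupport (HasCompactSupport.of_compactSpace _)
  · exact hder0.aestronglyMeasurable
  · exact Filter.Eventually.of_forall fun x t ht ↦ hC (t, x) ⟨ht, mem_univ _⟩
  · exact integrable_const C
  · exact Filter.Eventually.of_forall fun x t ht ↦
      (hline x x (mem_chart_source _ x) t (hsub ht)).differentiableAt.hasDerivAt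

end Leibniz

/-! ### The boundary one-form and the chart expressions entering the first variation. -/

section FirstVariation

variable {m n : ℕ}
  {M : Type*} [TopologicalSpace M] [ChartedSpace (Model m) M] [IsManifold (𝓡 m) ∞ M]
  {N : Type*} [TopologicalSpace N] [ChartedSpace (Model n) N] [IsManifold (𝓡 n) ∞ N]
  [RiemannianBundle (fun q : N ↦ TangentSpace (𝓡 n) q)]
  [IsContMDiffRiemannianBundle (𝓡 n) ∞ (Model n) (fun q : N ↦ TangentSpace (𝓡 n) q)]

variable (m n) in
/-- The induced connection `X ↦ ∇̄_X W` at `x` as a linear map. -/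
def covAlongLinear (φ : M → N) (W : ∀ x, TangentSpace (𝓡 n) (φ x)) (x : M) :
    TangentSpace (𝓡 m) x →ₗ[ℝ] TangentSpace (𝓡 n) (φ x) :=
  -- `christoffel` is a sum over an orthonormal basis and not visibly linear in `X`; in the chart at
  -- `φ x` it is the bilinear map `chrIn`.
  have key : ∀ X, covAlong m n φ W x X = vec n (φ x) (φ x) (mvfderiv (𝓡 m) (fun x' : M ↦
        (trivializationAt (Model n) (fun q : N ↦ TangentSpace (𝓡 n) q) (φ x)
          ⟨φ x', W x'⟩).2) x X)
      + vec n (φ x) (φ x) (chrIn n (φ x) (extChartAt (𝓡 n) (φ x) (φ x))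
        (crd n (φ x) (φ x) (mfderiv (𝓡 m) (𝓡 n) φ x X)) (crd n (φ x) (φ x) (W x))) := fun X ↦ by
    have hq := mem_chart_source (Model n) (φ x)
    rw [covAlong, trivializationAt_symm hq, ← crd_christoffel, vec_crd hq]
  { toFun := covAlong m n φ W x
    map_add' := fun X Y ↦ by
      simp only [key, map_add, add_apply]
      abel
    map_smul' := fun c X ↦ by
      simp only [key, map_smul, smul_apply, smul_add, RingHom.id_apply] }

variable {φ : ℝ → M → N} {ε t : ℝ} {p x : M} {q : N} {W : ∀ t x, TangentSpace (𝓡 n) (φ t x)}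

lemma famSec_chart (hp : x ∈ (chartAt (Model m) p).source) :
    famSec m n p q φ W (t, extChartAt (𝓡 m) p x) = crd n q (φ t x) (W t x) := by
  rw [famSec, chart_left_inv hp]

lemma famIn_chart (hp : x ∈ (chartAt (Model m) p).source) :
    famIn m n p q φ (t, extChartAt (𝓡 m) p x) = extChartAt (𝓡 n) q (φ t x) := by
  rw [famIn, chart_left_inv hp]

lemma crd_mfderiv_fam (hφ : IsVariation m n φ ε) (ht : t ∈ Ioo (-ε) ε)
    (hp : x ∈ (chartAt (Model m) p).source) (hq : φ t x ∈ (chartAt (Model n) q).source)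
    (X : TangentSpace (𝓡 m) x) :
    crd n q (φ t x) (mfderiv (𝓡 m) (𝓡 n) (φ t) x X) =
      fderiv ℝ (famIn m n p q φ) (t, extChartAt (𝓡 m) p x) (0, crd m p x X) := by
  rw [crd_mfderiv hp hq ((contMDiff_slice hφ ht x).mdifferentiableAt (by simp)),
    ← fderiv_slice (differentiableAt_of_contDiffAt (contDiffAt_famIn hφ (mem_famDom ht hp hq)))]
  rfl

lemma crd_covAlong_chart (hφ : IsVariation m n φ ε) (hW : SmoothFam m n φ ε W)
    (ht : t ∈ Ioo (-ε) ε) (hp : x ∈ (chartAt (Model m) p).source)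
    (hq : φ t x ∈ (chartAt (Model n) q).source) (X : TangentSpace (𝓡 m) x) :
    crd n q (φ t x) (covAlong m n (φ t) (W t) x X) =
      cov (chrIn n q) (famIn m n p q φ) (famSec m n p q φ W) (t, extChartAt (𝓡 m) p x)
        (0, crd m p x X) := by
  have hz := mem_famDom ht hp hq
  rw [crd_covAlong hp hq ((contMDiff_slice hφ ht x).mdifferentiableAt (by simp))
      (differentiableAt_of_contDiffAt (hW.eventually_secIn hφ hz).self_of_nhds),
    ← cov_slice (differentiableAt_of_contDiffAt (contDiffAt_famIn hφ hz))
      (differentiableAt_of_contDiffAt (hW p q _ hz))]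
  rfl

variable [RiemannianBundle (fun x : M ↦ TangentSpace (𝓡 m) x)]
  [IsContMDiffRiemannianBundle (𝓡 m) ∞ (Model m) (fun x : M ↦ TangentSpace (𝓡 m) x)]

/-- The sum of the vectors `∇_{e_i} e_i` for the extensions of `e_i` with constant components. -/
def sumChr (p x : M) : Model m :=
  ∑ i, chrIn m p (extChartAt (𝓡 m) p x) (onbIn m p x i) (onbIn m p x i)

lemma sum_apply_chr {F : Type*} [NormedAddCommGroup F] [NormedSpace ℝ F] (p x : M)
    (A : (ℝ × Model m) →L[ℝ] F) :
    ∑ i, A (0, chr (metricIn m p) (extChartAt (𝓡 m) p x) (onbIn m p x i) (onbIn m p x i)) =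
      A (0, sumChr p x) := by
  have h : ((0 : ℝ), sumChr p x) = ContinuousLinearMap.inr ℝ ℝ (Model m) (sumChr p x) := rfl
  rw [h, sumChr, map_sum, map_sum]
  rfl

/-- The vectors `onbIn m p x i` depend on `x` but not on `t`. The formula therefore holds with the
same vectors at all times near a given one for which φ_t(x) stays in the chart, and may be
differentiated in `t`. -/
lemma crd_tension_chart (hφ : IsVariation m n φ ε) (ht : t ∈ Ioo (-ε) ε)
    (hp : x ∈ (chartAt (Model m) p).source) (hq : φ t x ∈ (chartAt (Model n) q).source) :
    famSec m n p q φ (fun t ↦ tension m n (φ t)) (t, extChartAt (𝓡 m) p x) =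
      ∑ i, cov (chrIn n q) (famIn m n p q φ)
          (fun z ↦ fderiv ℝ (famIn m n p q φ) z (0, onbIn m p x i))
          (t, extChartAt (𝓡 m) p x) (0, onbIn m p x i)
        - fderiv ℝ (famIn m n p q φ) (t, extChartAt (𝓡 m) p x) (0, sumChr p x) := by
  have hz := mem_famDom ht hp hq
  have hA := differentiableAt_of_contDiffAt (contDiffAt_fderiv (contDiffAt_famIn hφ hz))
  rw [crd_tension_fam hφ hz]
  simp only [covOneForm_apply hA]
  rw [chart_left_inv hp, Finset.sum_sub_distrib, sum_apply_chr]

lemma crd_roughLaplacian_chart (hφ : IsVariation m n φ ε) (hW : SmoothFam m n φ ε W)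
    (ht : t ∈ Ioo (-ε) ε) (hp : x ∈ (chartAt (Model m) p).source)
    (hq : φ t x ∈ (chartAt (Model n) q).source) :
    famSec m n p q φ (fun t ↦ roughLaplacian m n (φ t) (W t)) (t, extChartAt (𝓡 m) p x) =
      -(∑ i, cov (chrIn n q) (famIn m n p q φ)
          (fun z ↦ cov (chrIn n q) (famIn m n p q φ) (famSec m n p q φ W) z (0, onbIn m p x i))
          (t, extChartAt (𝓡 m) p x) (0, onbIn m p x i)
        - cov (chrIn n q) (famIn m n p q φ) (famSec m n p q φ W) (t, extChartAt (𝓡 m) p x)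
            (0, sumChr p x)) := by
  have hz := mem_famDom ht hp hq
  have hA := differentiableAt_of_contDiffAt
    (contDiffAt_covL (contDiffAt_chrIn_famIn hz) (contDiffAt_famIn hφ hz) (hW p q _ hz))
  rw [crd_roughLaplacian_fam hφ hW hz]
  simp only [covOneForm_apply hA]
  rw [chart_left_inv hp, Finset.sum_sub_distrib, sum_apply_chr]
  rfl

/-- The energy density in charts. -/
lemma covNormSq_chart (hφ : IsVariation m n φ ε) (hW : SmoothFam m n φ ε W)
    (ht : t ∈ Ioo (-ε) ε) (hp : x ∈ (chartAt (Model m) p).source)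
    (hq : φ t x ∈ (chartAt (Model n) q).source) :
    covNormSq m n (φ t) (W t) x = ∑ i, metricIn n q (famIn m n p q φ (t, extChartAt (𝓡 m) p x))
      (cov (chrIn n q) (famIn m n p q φ) (famSec m n p q φ W) (t, extChartAt (𝓡 m) p x)
        (0, onbIn m p x i))
      (cov (chrIn n q) (famIn m n p q φ) (famSec m n p q φ W) (t, extChartAt (𝓡 m) p x)
        (0, onbIn m p x i)) := by
  rw [covNormSq]
  refine Finset.sum_congr rfl fun i _ ↦ ?_
  rw [← real_inner_self_eq_norm_sq, inner_eq_metricIn hq, crd_covAlong_chart hφ hW ht hp hq,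
    famIn_chart hp]
  rfl

/-- The energy density of a smooth family is smooth. -/
lemma contDiffAt_covNormSq (hφ : IsVariation m n φ ε) (hW : SmoothFam m n φ ε W) (p : M)
    (z : ℝ × Model m) (ht : z.1 ∈ Ioo (-ε) ε) (hy : z.2 ∈ (extChartAt (𝓡 m) p).target) :
    ContDiffAt ℝ ∞ (fun z : ℝ × Model m ↦
      covNormSq m n (φ z.1) (W z.1) ((extChartAt (𝓡 m) p).symm z.2)) z := by
  set q := φ z.1 ((extChartAt (𝓡 m) p).symm z.2) with hq
  have hz : z ∈ famDom m n p q φ ε := ⟨ht, hy, mem_chart_source _ _⟩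
  have hG := isMetricOn_metricIn (k := m) p
  let B : ℝ × Model m → Model m →ₗ[ℝ] Model m →ₗ[ℝ] ℝ := fun z ↦
    LinearMap.mk₂ ℝ (fun u v ↦ metricIn n q (famIn m n p q φ z)
      (covL (chrIn n q) (famIn m n p q φ) (famSec m n p q φ W) z
        (ContinuousLinearMap.inr ℝ ℝ (Model m) u))
      (covL (chrIn n q) (famIn m n p q φ) (famSec m n p q φ W) z
        (ContinuousLinearMap.inr ℝ ℝ (Model m) v)))
      (fun u u' v ↦ by simp only [map_add, add_apply])
      (fun c u v ↦ by simp only [map_smul, smul_apply])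
      (fun u v v' ↦ by simp only [map_add])
      (fun c u v ↦ by simp only [map_smul])
  have heq : (fun z : ℝ × Model m ↦
      covNormSq m n (φ z.1) (W z.1) ((extChartAt (𝓡 m) p).symm z.2)) =ᶠ[nhds z]
      fun z ↦ ∑ a, ∑ b, invMetric (metricIn m p) z.2 a b • B z (coordVec a) (coordVec b) := by
    filter_upwards [famDom_mem_nhds hφ hz] with z' hz'
    have hx := chart_symm_mem_source hz'.2.1
    have hyy := (extChartAt (𝓡 m) p).right_inv hz'.2.1
    have hon := sum_onbIn hx
    rw [hyy] at hon
    rw [covNormSq_chart hφ hW hz'.1 hx hz'.2.2, ← sum_orthonormal_eq hG hz'.2.1 hon, hyy]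
    rfl
  refine ContDiffAt.congr_of_eventuallyEq ?_ heq
  have hc : ∀ u, ContDiffAt ℝ ∞ (fun z ↦ cov (chrIn n q) (famIn m n p q φ) (famSec m n p q φ W) z
      (0, u)) z := fun u ↦
    contDiffAt_cov (contDiffAt_chrIn_famIn hz) (contDiffAt_famIn hφ hz) (hW p q z hz) _
  refine ContDiffAt.sum fun a _ ↦ ContDiffAt.sum fun b _ ↦ ContDiffAt.smul
    ((contDiffAt_invMetric hG hy a b).comp z contDiffAt_snd) ?_
  exact ((((isMetricOn_metricIn q).contDiffAt (famIn_mem_target hz)).comp z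
    (contDiffAt_famIn hφ hz)).clm_apply (hc _)).clm_apply (hc _)

variable (m n) in
/-- The one-form whose divergence enters the first variation of the trienergy. -/
def boundaryForm (φ : ℝ → M → N) (x : M) : TangentSpace (𝓡 m) x →ₗ[ℝ] ℝ :=
  (innerₗ _ (covTime n φ (fun t ↦ tension m n (φ t)) 0 x)).comp
      (covAlongLinear m n (φ 0) (tension m n (φ 0)) x)
    + (innerₗ _ (roughLaplacian m n (φ 0) (tension m n (φ 0)) x)).comp
      (covAlongLinear m n (φ 0) (variationField n φ) x)
    - (innerₗ _ (variationField n φ x)).comp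
      (covAlongLinear m n (φ 0) (roughLaplacian m n (φ 0) (tension m n (φ 0))) x)

variable (m n) in
/-- The form of the first variation in charts. -/
def boundaryFormIn (p : M) (q : N) (φ : ℝ → M → N) (z : ℝ × Model m) (ξ : ℝ × Model m) : ℝ :=
  variationForm (metricIn n q) (famIn m n p q φ)
    (famSec m n p q φ fun t ↦ tension m n (φ t))
    (famSec m n p q φ fun t ↦ roughLaplacian m n (φ t) (tension m n (φ t))) (1, 0) z ξ

/-- The left side does not involve `q`: the target chart is auxiliary, and any chart around the
image point may be used. -/
lemma formIn_boundaryForm (hφ : IsVariation m n φ ε) {y : Model m}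
    (hz : (0, y) ∈ famDom m n p q φ ε) (u : Model m) :
    formIn m p (boundaryForm m n φ) y u = boundaryFormIn m n p q φ (0, y) (0, u) := by
  have hx := chart_symm_mem_source hz.2.1
  have hτ := smoothFam_tension (m := m) hφ
  have hΛ := smoothFam_roughLaplacian hφ hτ
  have hV := smoothFam_velocity (m := m) hφ
  set x := (extChartAt (𝓡 m) p).symm y with hxy
  have h1 : ∀ X : TangentSpace (𝓡 m) x,
      crd n q (φ 0 x) (covAlong m n (φ 0) (tension m n (φ 0)) x X) =
        cov (chrIn n q) (famIn m n p q φ) (famSec m n p q φ fun t ↦ tension m n (φ t)) (0, y)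
          (0, crd m p x X) := fun X ↦ crd_covAlong_fam hφ hτ hz X
  have h2 : ∀ X : TangentSpace (𝓡 m) x,
      crd n q (φ 0 x) (covAlong m n (φ 0) (roughLaplacian m n (φ 0) (tension m n (φ 0))) x X) =
        cov (chrIn n q) (famIn m n p q φ)
          (famSec m n p q φ fun t ↦ roughLaplacian m n (φ t) (tension m n (φ t))) (0, y)
          (0, crd m p x X) := fun X ↦ crd_covAlong_fam hφ hΛ hz X
  have h6 : famSec m n p q φ (velocity n φ) =ᶠ[nhds (0, y)]
      fun z ↦ fderiv ℝ (famIn m n p q φ) z (1, 0) := by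
    filter_upwards [famDom_mem_nhds hφ hz] with z' hz' using crd_velocity hφ hz'
  have h3 : ∀ X : TangentSpace (𝓡 m) x,
      crd n q (φ 0 x) (covAlong m n (φ 0) (variationField n φ) x X) =
        cov (chrIn n q) (famIn m n p q φ) (fun z ↦ fderiv ℝ (famIn m n p q φ) z (1, 0)) (0, y)
          (0, crd m p x X) := fun X ↦ (crd_covAlong_fam hφ hV hz X).trans (cov_congr h6 _)
  have h4 : crd n q (φ 0 x) (variationField n φ x) = fderiv ℝ (famIn m n p q φ) (0, y) (1, 0) :=
    crd_velocity hφ hz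
  have h5 : crd n q (φ 0 x) (covTime n φ (fun t ↦ tension m n (φ t)) 0 x) =
      cov (chrIn n q) (famIn m n p q φ) (famSec m n p q φ fun t ↦ tension m n (φ t)) (0, y)
        (1, 0) := crd_covTime hφ hτ hz
  have h7 : crd n q (φ 0 x) (roughLaplacian m n (φ 0) (tension m n (φ 0)) x) =
      famSec m n p q φ (fun t ↦ roughLaplacian m n (φ t) (tension m n (φ t))) (0, y) := rfl
  have hin : ∀ v w : TangentSpace (𝓡 n) (φ 0 x),
      inner ℝ v w = metricIn n q (famIn m n p q φ (0, y)) (crd n q _ v) (crd n q _ w) :=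
    fun v w ↦ inner_eq_metricIn hz.2.2 v w
  have happ : ∀ X, boundaryForm m n φ x X =
      inner ℝ (covTime n φ (fun t ↦ tension m n (φ t)) 0 x)
        (covAlong m n (φ 0) (tension m n (φ 0)) x X)
      + inner ℝ (covAlong m n (φ 0) (variationField n φ) x X)
        (roughLaplacian m n (φ 0) (tension m n (φ 0)) x)
      - inner ℝ (variationField n φ x)
        (covAlong m n (φ 0) (roughLaplacian m n (φ 0) (tension m n (φ 0))) x X) := fun X ↦ by
    rw [real_inner_comm (roughLaplacian m n (φ 0) (tension m n (φ 0)) x)]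
    rfl
  rw [formIn_apply, ← hxy, happ, hin, hin, hin, h1, h2, h3, h4, h5, h7, crd_vec hx]
  rfl

lemma contDiffAt_boundaryFormIn (hφ : IsVariation m n φ ε) {z : ℝ × Model m}
    (hz : z ∈ famDom m n p q φ ε) (ξ : ℝ × Model m) :
    ContDiffAt ℝ ∞ (fun z ↦ boundaryFormIn m n p q φ z ξ) z := by
  have hτ := smoothFam_tension (m := m) hφ
  have hf := contDiffAt_famIn hφ hz
  have hΓ := contDiffAt_chrIn_famIn hz
  have hΛ := smoothFam_roughLaplacian hφ hτ p q z hz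
  have hG : ∀ {A B : ℝ × Model m → Model n}, ContDiffAt ℝ ∞ A z → ContDiffAt ℝ ∞ B z →
      ContDiffAt ℝ ∞ (fun z ↦ metricIn n q (famIn m n p q φ z) (A z) (B z)) z := fun hA hB ↦
    ((((isMetricOn_metricIn q).contDiffAt (famIn_mem_target hz)).comp z hf).clm_apply
      hA).clm_apply hB
  have hV := contDiffAt_fderiv_apply hf (1, 0)
  exact ((hG (contDiffAt_cov hΓ hf (hτ p q z hz) _) (contDiffAt_cov hΓ hf (hτ p q z hz) _)).add
    (hG (contDiffAt_cov hΓ hf hV _) hΛ)).sub (hG hV (contDiffAt_cov hΓ hf hΛ _))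

lemma eventually_formIn_boundaryForm (hφ : IsVariation m n φ ε) {y : Model m}
    (hz : (0, y) ∈ famDom m n p q φ ε) (u : Model m) :
    (fun y ↦ formIn m p (boundaryForm m n φ) y u) =ᶠ[nhds y]
      fun y ↦ boundaryFormIn m n p q φ (0, y) (0, u) := by
  have hc : ContinuousAt (fun y : Model m ↦ ((0 : ℝ), y)) y := by fun_prop
  filter_upwards [hc.eventually (famDom_mem_nhds hφ hz)] with y' hy'
  exact formIn_boundaryForm hφ hy' u

lemma contDiffAt_formIn_boundaryForm (hφ : IsVariation m n φ ε) (hε : 0 < ε) (p : M) (y : Model m)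
    (hy : y ∈ (extChartAt (𝓡 m) p).target) :
    ContDiffAt ℝ ∞ (formIn m p (boundaryForm m n φ)) y := by
  refine ContDiffOn.contDiffAt (s := (extChartAt (𝓡 m) p).target) ?_ ((isOpen_target p).mem_nhds hy)
  refine contDiffOn_clm_apply.2 fun u y hy ↦ ContDiffAt.contDiffWithinAt ?_
  -- The target chart is taken at the image of the point under consideration, so it changes with
  -- `y`; smoothness is a local statement.
  have hz : ((0 : ℝ), y) ∈ famDom m n p (φ 0 ((extChartAt (𝓡 m) p).symm y)) φ ε :=
    ⟨⟨neg_lt_zero.2 hε, hε⟩, hy, mem_chart_source _ _⟩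
  refine ContDiffAt.congr_of_eventuallyEq ?_ (eventually_formIn_boundaryForm hφ hz u)
  exact ContDiffAt.comp (f := fun y : Model m ↦ ((0 : ℝ), y)) y
    (contDiffAt_boundaryFormIn hφ hz (0, u)) (contDiffAt_const.prodMk contDiffAt_id)

end FirstVariation

/-! ### The first variation integrand as a divergence. -/

section Identity

variable {m n : ℕ}
  {M : Type*} [TopologicalSpace M] [ChartedSpace (Model m) M] [IsManifold (𝓡 m) ∞ M]
  [RiemannianBundle (fun x : M ↦ TangentSpace (𝓡 m) x)]
  [IsContMDiffRiemannianBundle (𝓡 m) ∞ (Model m) (fun x : M ↦ TangentSpace (𝓡 m) x)]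
  {N : Type*} [TopologicalSpace N] [ChartedSpace (Model n) N] [IsManifold (𝓡 n) ∞ N]
  [RiemannianBundle (fun q : N ↦ TangentSpace (𝓡 n) q)]
  [IsContMDiffRiemannianBundle (𝓡 n) ∞ (Model n) (fun q : N ↦ TangentSpace (𝓡 n) q)]
  {φ : ℝ → M → N} {ε : ℝ} {p x : M}

/-- The time derivative of the tension field in charts. -/
lemma cov_time_tension (hφ : IsVariation m n φ ε) (hε : 0 < ε)
    (hp : x ∈ (chartAt (Model m) p).source) {q : N}
    (hq : φ 0 x ∈ (chartAt (Model n) q).source) :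
    cov (chrIn n q) (famIn m n p q φ) (famSec m n p q φ fun t ↦ tension m n (φ t))
        (0, extChartAt (𝓡 m) p x) (1, 0) =
      ∑ i, cov (chrIn n q) (famIn m n p q φ) (fun z ↦ cov (chrIn n q) (famIn m n p q φ)
          (fun z ↦ fderiv ℝ (famIn m n p q φ) z (1, 0)) z (0, onbIn m p x i))
          (0, extChartAt (𝓡 m) p x) (0, onbIn m p x i)
        - cov (chrIn n q) (famIn m n p q φ) (fun z ↦ fderiv ℝ (famIn m n p q φ) z (1, 0))
            (0, extChartAt (𝓡 m) p x) (0, sumChr p x)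
        + ∑ i, curv (chrIn n q) (famIn m n p q φ (0, extChartAt (𝓡 m) p x))
            (fderiv ℝ (famIn m n p q φ) (0, extChartAt (𝓡 m) p x) (1, 0))
            (fderiv ℝ (famIn m n p q φ) (0, extChartAt (𝓡 m) p x) (0, onbIn m p x i))
            (fderiv ℝ (famIn m n p q φ) (0, extChartAt (𝓡 m) p x) (0, onbIn m p x i)) := by
  have h0 : (0 : ℝ) ∈ Ioo (-ε) ε := ⟨neg_lt_zero.2 hε, hε⟩
  have hz := mem_famDom h0 hp hq
  have hf := contDiffAt_famIn hφ hz
  have hΓ := contDiffAt_chrIn_famIn hz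
  have hfn : ∀ᶠ z' in nhds ((0 : ℝ), extChartAt (𝓡 m) p x),
      famIn m n p q φ z' ∈ (extChartAt (𝓡 n) q).target ∧ ContDiffAt ℝ ∞ (famIn m n p q φ) z' := by
    filter_upwards [famDom_mem_nhds hφ hz] with z' hz'
    exact ⟨famIn_mem_target hz', contDiffAt_famIn hφ hz'⟩
  refine Eq.trans ?_ (cov_tension (isMetricOn_metricIn q) (famIn_mem_target hz) hf hfn (1, 0)
    (0, sumChr p x) fun i ↦ (0, onbIn m p x i))
  have hS : ContDiffAt ℝ ∞ (fun z ↦ ∑ i, cov (chrIn n q) (famIn m n p q φ)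
      (fun z ↦ fderiv ℝ (famIn m n p q φ) z (0, onbIn m p x i)) z (0, onbIn m p x i)
        - fderiv ℝ (famIn m n p q φ) z (0, sumChr p x)) (0, extChartAt (𝓡 m) p x) :=
    (ContDiffAt.sum fun i _ ↦ contDiffAt_cov hΓ hf (contDiffAt_fderiv_apply hf _) _).sub
      (contDiffAt_fderiv_apply hf _)
  have hfd := differentiableAt_of_contDiffAt hf
  -- The right-hand section is built from the basis at `x` alone and is matched with the tension
  -- field only on the time line through `x`. That suffices, since the derivative in the direction
  -- `(1, 0)` depends only on this line.
  refine (cov_time hfd (differentiableAt_of_contDiffAt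
    (smoothFam_tension hφ p q _ hz))).symm.trans (Eq.trans ?_
      (cov_time hfd (differentiableAt_of_contDiffAt hS)))
  refine cov_congr ?_ _
  have hc : ContinuousAt (fun t : ℝ ↦ (t, extChartAt (𝓡 m) p x)) 0 := by fun_prop
  filter_upwards [hc.eventually (famDom_mem_nhds hφ hz)] with t ht
  have hq' := ht.2.2
  simp only [chart_left_inv hp] at hq'
  exact crd_tension_chart hφ ht.1 hp hq'

/-- The components of the tritension field. -/
lemma crd_tritension (hφ : IsVariation m n φ ε) (hε : 0 < ε)
    (hp : x ∈ (chartAt (Model m) p).source) :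
    crd n (φ 0 x) (φ 0 x) (tritension m n (φ 0) x) =
      -(∑ i, cov (chrIn n (φ 0 x)) (famIn m n p (φ 0 x) φ)
          (fun z ↦ cov (chrIn n (φ 0 x)) (famIn m n p (φ 0 x) φ) (famSec m n p (φ 0 x) φ
            fun t ↦ roughLaplacian m n (φ t) (tension m n (φ t))) z (0, onbIn m p x i))
          (0, extChartAt (𝓡 m) p x) (0, onbIn m p x i)
        - cov (chrIn n (φ 0 x)) (famIn m n p (φ 0 x) φ) (famSec m n p (φ 0 x) φ
            fun t ↦ roughLaplacian m n (φ t) (tension m n (φ t))) (0, extChartAt (𝓡 m) p x)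
            (0, sumChr p x))
      - ∑ i, curv (chrIn n (φ 0 x)) (famIn m n p (φ 0 x) φ (0, extChartAt (𝓡 m) p x))
          (famSec m n p (φ 0 x) φ (fun t ↦ roughLaplacian m n (φ t) (tension m n (φ t)))
            (0, extChartAt (𝓡 m) p x))
          (fderiv ℝ (famIn m n p (φ 0 x) φ) (0, extChartAt (𝓡 m) p x) (0, onbIn m p x i))
          (fderiv ℝ (famIn m n p (φ 0 x) φ) (0, extChartAt (𝓡 m) p x) (0, onbIn m p x i))
      - ∑ i, curv (chrIn n (φ 0 x)) (famIn m n p (φ 0 x) φ (0, extChartAt (𝓡 m) p x))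
          (cov (chrIn n (φ 0 x)) (famIn m n p (φ 0 x) φ) (famSec m n p (φ 0 x) φ
            fun t ↦ tension m n (φ t)) (0, extChartAt (𝓡 m) p x) (0, onbIn m p x i))
          (famSec m n p (φ 0 x) φ (fun t ↦ tension m n (φ t)) (0, extChartAt (𝓡 m) p x))
          (fderiv ℝ (famIn m n p (φ 0 x) φ) (0, extChartAt (𝓡 m) p x) (0, onbIn m p x i)) := by
  have h0 : (0 : ℝ) ∈ Ioo (-ε) ε := ⟨neg_lt_zero.2 hε, hε⟩
  have hq := mem_chart_source (Model n) (φ 0 x)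
  have hτ := smoothFam_tension (m := m) hφ
  have hΛ := smoothFam_roughLaplacian hφ hτ
  have e0 : crd n (φ 0 x) (φ 0 x)
      (roughLaplacian m n (φ 0) (roughLaplacian m n (φ 0) (tension m n (φ 0))) x) = _ :=
    (famSec_chart (t := 0) (W := fun t ↦ roughLaplacian m n (φ t)
      (roughLaplacian m n (φ t) (tension m n (φ t)))) hp).symm.trans
      (crd_roughLaplacian_chart hφ hΛ h0 hp hq)
  have eΛ : famSec m n p (φ 0 x) φ (fun t ↦ roughLaplacian m n (φ t) (tension m n (φ t)))
      (0, extChartAt (𝓡 m) p x) =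
        crd n (φ 0 x) (φ 0 x) (roughLaplacian m n (φ 0) (tension m n (φ 0)) x) := famSec_chart hp
  have eτ : famSec m n p (φ 0 x) φ (fun t ↦ tension m n (φ t)) (0, extChartAt (𝓡 m) p x) =
      crd n (φ 0 x) (φ 0 x) (tension m n (φ 0) x) := famSec_chart hp
  have eD : ∀ i, fderiv ℝ (famIn m n p (φ 0 x) φ) (0, extChartAt (𝓡 m) p x) (0, onbIn m p x i) =
      crd n (φ 0 x) (φ 0 x) (mfderiv (𝓡 m) (𝓡 n) (φ 0) x (onb m x i)) := fun i ↦
    (crd_mfderiv_fam hφ h0 hp hq _).symm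
  have eC : ∀ i, cov (chrIn n (φ 0 x)) (famIn m n p (φ 0 x) φ) (famSec m n p (φ 0 x) φ
      fun t ↦ tension m n (φ t)) (0, extChartAt (𝓡 m) p x) (0, onbIn m p x i) =
      crd n (φ 0 x) (φ 0 x) (covAlong m n (φ 0) (tension m n (φ 0)) x (onb m x i)) := fun i ↦
    (crd_covAlong_chart hφ hτ h0 hp hq _).symm
  rw [← e0, eΛ, eτ, famIn_chart hp, tritension, jacobiOperator, map_sub, map_sub, map_sum, map_sum]
  congr 1
  · congr 1
    refine Finset.sum_congr rfl fun i _ ↦ ?_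
    rw [crd_curvature, eD]
  · refine Finset.sum_congr rfl fun i _ ↦ ?_
    rw [crd_curvature, eD, eC]

/-- Converts the spatial derivatives in `divIn` into the derivatives on the product with time that
occur in `variation_identity`. -/
lemma fderiv_formIn_boundaryForm (hφ : IsVariation m n φ ε) (hε : 0 < ε)
    (hp : x ∈ (chartAt (Model m) p).source) (u : Model m) :
    fderiv ℝ (formIn m p (boundaryForm m n φ)) (extChartAt (𝓡 m) p x) u u =
      fderiv ℝ (fun z ↦ boundaryFormIn m n p (φ 0 x) φ z (0, u)) (0, extChartAt (𝓡 m) p x)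
        (0, u) := by
  have h0 : (0 : ℝ) ∈ Ioo (-ε) ε := ⟨neg_lt_zero.2 hε, hε⟩
  have hz := mem_famDom h0 hp (mem_chart_source (Model n) (φ 0 x))
  have hd := differentiableAt_of_contDiffAt
    (contDiffAt_formIn_boundaryForm hφ hε p _ (chart_mem_target hp))
  have h1 : fderiv ℝ (fun y ↦ formIn m p (boundaryForm m n φ) y u) (extChartAt (𝓡 m) p x) u =
      fderiv ℝ (formIn m p (boundaryForm m n φ)) (extChartAt (𝓡 m) p x) u u := by
    rw [fderiv_clm_apply hd (differentiableAt_const _)]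
    simp
  rw [← h1, (eventually_formIn_boundaryForm hφ hz u).fderiv_eq]
  exact fderiv_slice (f := fun z ↦ boundaryFormIn m n p (φ 0 x) φ z (0, u))
    (differentiableAt_of_contDiffAt (contDiffAt_boundaryFormIn hφ hz (0, u))) u

/-- The time derivative of the energy density in charts. -/
lemma deriv_covNormSq (hφ : IsVariation m n φ ε) (hε : 0 < ε)
    {W : ∀ t x, TangentSpace (𝓡 n) (φ t x)} (hW : SmoothFam m n φ ε W)
    (hp : x ∈ (chartAt (Model m) p).source) {q : N}
    (hq : φ 0 x ∈ (chartAt (Model n) q).source) :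
    deriv (fun t ↦ covNormSq m n (φ t) (W t) x) 0 =
      fderiv ℝ (fun z ↦ ∑ i, metricIn n q (famIn m n p q φ z)
        (cov (chrIn n q) (famIn m n p q φ) (famSec m n p q φ W) z (0, onbIn m p x i))
        (cov (chrIn n q) (famIn m n p q φ) (famSec m n p q φ W) z (0, onbIn m p x i)))
        (0, extChartAt (𝓡 m) p x) (1, 0) := by
  have h0 : (0 : ℝ) ∈ Ioo (-ε) ε := ⟨neg_lt_zero.2 hε, hε⟩
  have hz := mem_famDom h0 hp hq
  have hf := contDiffAt_famIn hφ hz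
  have hΓ := contDiffAt_chrIn_famIn hz
  have hcov : ∀ i, ContDiffAt ℝ ∞ (fun z ↦ cov (chrIn n q) (famIn m n p q φ)
      (famSec m n p q φ W) z (0, onbIn m p x i)) (0, extChartAt (𝓡 m) p x) :=
    fun i ↦ contDiffAt_cov hΓ hf (hW p _ _ hz) _
  have hH : ContDiffAt ℝ ∞ (fun z ↦ ∑ i, metricIn n q (famIn m n p q φ z)
        (cov (chrIn n q) (famIn m n p q φ) (famSec m n p q φ W) z (0, onbIn m p x i))
        (cov (chrIn n q) (famIn m n p q φ) (famSec m n p q φ W) z (0, onbIn m p x i)))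
        (0, extChartAt (𝓡 m) p x) :=
    ContDiffAt.sum fun i _ ↦ ((((isMetricOn_metricIn q).contDiffAt
      (famIn_mem_target hz)).comp _ hf).clm_apply (hcov i)).clm_apply (hcov i)
  -- Again only the time line through `x` matters, on which the basis vectors are fixed.
  rw [← fderiv_time (differentiableAt_of_contDiffAt hH), fderiv_apply_one_eq_deriv]
  refine Filter.EventuallyEq.deriv_eq ?_
  have hc : ContinuousAt (fun t : ℝ ↦ (t, extChartAt (𝓡 m) p x)) 0 := by fun_prop
  filter_upwards [hc.eventually (famDom_mem_nhds hφ hz)] with t ht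
  have ht1 : t ∈ Ioo (-ε) ε := ht.1
  have hq' : φ t x ∈ (chartAt (Model n) q).source := by
    have h := ht.2.2
    simp only [chart_left_inv hp] at h
    exact h
  exact covNormSq_chart hφ hW ht1 hp hq'

/-- The integrand of the first variation is a divergence up to the Euler-Lagrange term. -/
lemma deriv_covNormSq_add_inner (hφ : IsVariation m n φ ε) (hε : 0 < ε)
    (hp : x ∈ (chartAt (Model m) p).source) :
    (1 / 2) * deriv (fun t ↦ covNormSq m n (φ t) (tension m n (φ t)) x) 0
        + inner ℝ (tritension m n (φ 0) x) (variationField n φ x) =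
      divIn m p (boundaryForm m n φ) x := by
  have h0 : (0 : ℝ) ∈ Ioo (-ε) ε := ⟨neg_lt_zero.2 hε, hε⟩
  have hq := mem_chart_source (Model n) (φ 0 x)
  have hz := mem_famDom h0 hp hq
  have hτ := smoothFam_tension (m := m) hφ
  have hΛ := smoothFam_roughLaplacian hφ hτ
  have hf := contDiffAt_famIn hφ hz
  -- The left side of the goal does not mention `p`. Since the identity holds in every chart around
  -- `x`, it also supplies the chart independence demanded by the divergence theorem.
  have key := variation_identity (isMetricOn_metricIn (φ 0 x)) (famIn_mem_target hz) hf
    (hτ p _ _ hz) (hΛ p _ _ hz) (1, 0) (0, sumChr p x) (fun i ↦ (0, onbIn m p x i))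
    (cov_time_tension hφ hε hp hq) (crd_roughLaplacian_chart hφ hτ h0 hp hq)
  have hV : crd n (φ 0 x) (φ 0 x) (variationField n φ x) =
      fderiv ℝ (famIn m n p (φ 0 x) φ) (0, extChartAt (𝓡 m) p x) (1, 0) := by
    rw [← crd_velocity hφ hz, famSec_chart hp]
    rfl
  have hin : inner ℝ (tritension m n (φ 0) x) (variationField n φ x) =
      metricIn n (φ 0 x) (famIn m n p (φ 0 x) φ (0, extChartAt (𝓡 m) p x))
        (crd n (φ 0 x) (φ 0 x) (tritension m n (φ 0) x))
        (fderiv ℝ (famIn m n p (φ 0 x) φ) (0, extChartAt (𝓡 m) p x) (1, 0)) := by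
    rw [inner_eq_metricIn hq, hV, famIn_chart hp]
  have hdiv : divIn m p (boundaryForm m n φ) x =
      ∑ i, fderiv ℝ (fun z ↦ boundaryFormIn m n p (φ 0 x) φ z (0, onbIn m p x i))
        (0, extChartAt (𝓡 m) p x) (0, onbIn m p x i)
      - boundaryFormIn m n p (φ 0 x) φ (0, extChartAt (𝓡 m) p x) (0, sumChr p x) := by
    rw [divIn, Finset.sum_congr rfl fun i _ ↦ fderiv_formIn_boundaryForm hφ hε hp (onbIn m p x i),
      formIn_boundaryForm hφ hz]
    rfl
  rw [deriv_covNormSq hφ hε hτ hp hq, hdiv, hin, crd_tritension hφ hε hp, ← eq_sub_iff_add_eq]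
  exact key

end Identity

end Riem

end

/-! ### The first variation formula. -/

theorem theorem2p1 {m n : ℕ}
    {M : Type*} [TopologicalSpace M] [T2Space M] [CompactSpace M]
    [MeasurableSpace M] [BorelSpace M]
    [ChartedSpace (EuclideanSpace ℝ (Fin m)) M] [IsManifold (𝓡 m) ∞ M]
    [RiemannianBundle (fun x : M ↦ TangentSpace (𝓡 m) x)]
    [IsContMDiffRiemannianBundle (𝓡 m) ∞ (EuclideanSpace ℝ (Fin m))
      (fun x : M ↦ TangentSpace (𝓡 m) x)]
    {N : Type*} [TopologicalSpace N] [T2Space N]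
    [ChartedSpace (EuclideanSpace ℝ (Fin n)) N] [IsManifold (𝓡 n) ∞ N]
    [RiemannianBundle (fun q : N ↦ TangentSpace (𝓡 n) q)]
    [IsContMDiffRiemannianBundle (𝓡 n) ∞ (EuclideanSpace ℝ (Fin n))
      (fun q : N ↦ TangentSpace (𝓡 n) q)]
    (φ : ℝ → M → N) (ε : ℝ) (hε : 0 < ε)
    (hφ : ContMDiffOn (𝓘(ℝ, ℝ).prod (𝓡 m)) (𝓡 n) ∞ (fun z : ℝ × M ↦ φ z.1 z.2)
      (Ioo (-ε) ε ×ˢ univ)) :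
    (∀ t ∈ Ioo (-ε) ε,
      Integrable (Riem.trienergyDensity m n (φ t)) (Riem.riemannianVolume m M) ∧
      Integrable (Riem.covNormSq m n (φ t) (Riem.tension m n (φ t)))
        (Riem.riemannianVolume m M) ∧
      Riem.trienergy m n (φ t) =
        (1 / 2) * ∫ x, Riem.covNormSq m n (φ t) (Riem.tension m n (φ t)) x
          ∂(Riem.riemannianVolume m M)) ∧
    Integrable (fun x ↦ inner ℝ (Riem.tritension m n (φ 0) x) (Riem.variationField n φ x))
      (Riem.riemannianVolume m M) ∧
    HasDerivAt (fun t ↦ Riem.trienergy m n (φ t))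
      (-∫ x, inner ℝ (Riem.tritension m n (φ 0) x) (Riem.variationField n φ x)
        ∂(Riem.riemannianVolume m M)) 0 := by
  have h0 : (0 : ℝ) ∈ Ioo (-ε) ε := ⟨neg_lt_zero.2 hε, hε⟩
  have hτ := Riem.smoothFam_tension (m := m) (n := n) hφ
  obtain ⟨hcont, hderc, hder⟩ := Riem.hasDerivAt_integral_of_smooth (m := m)
    (Riem.riemannianVolume m M) hε
    (E := fun t ↦ Riem.covNormSq m n (φ t) (Riem.tension m n (φ t)))
    (Riem.contDiffAt_covNormSq (W := fun t ↦ Riem.tension m n (φ t)) hφ hτ)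
  have hcompact : ∀ {f : M → ℝ}, Continuous f → Integrable f (Riem.riemannianVolume m M) :=
    fun hf ↦ hf.integrable_of_hasCompactSupport (HasCompactSupport.of_compactSpace _)
  have htri : ∀ t ∈ Ioo (-ε) ε, Riem.trienergy m n (φ t) =
      (1 / 2) * ∫ x, Riem.covNormSq m n (φ t) (Riem.tension m n (φ t)) x
        ∂(Riem.riemannianVolume m M) := fun t ht ↦ by
    rw [Riem.trienergy, Riem.trienergyDensity_eq hφ ht]
  -- `D` is ½ ∂_t|∇̄τ|² + ⟨τ₃, V⟩ at `t = 0`, the divergence of the boundary form.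
  obtain ⟨hDc, hD0⟩ := Riem.integral_divergence_eq_zero
    (D := fun x ↦ (1 / 2) * deriv (fun t ↦ Riem.covNormSq m n (φ t) (Riem.tension m n (φ t)) x) 0
      + inner ℝ (Riem.tritension m n (φ 0) x) (Riem.variationField n φ x))
    (Riem.contDiffAt_formIn_boundaryForm hφ hε)
    (fun p x hx ↦ Riem.deriv_covNormSq_add_inner hφ hε hx)
  have hderi := (hcompact hderc).const_mul (1 / 2)
  -- ⟨τ₃, V⟩ is the continuous divergence `D` minus the continuous time derivative of half the
  -- energy density; no separate regularity of τ₃ is needed.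
  have hinner : Integrable (fun x ↦
      inner ℝ (Riem.tritension m n (φ 0) x) (Riem.variationField n φ x))
      (Riem.riemannianVolume m M) := by
    have h := (hcompact hDc).sub hderi
    refine h.congr (Filter.Eventually.of_forall fun x ↦ ?_)
    simp only [Pi.sub_apply, add_sub_cancel_left]
  refine ⟨fun t ht ↦ ⟨?_, hcompact (hcont t ht), htri t ht⟩, hinner, ?_⟩
  · rw [Riem.trienergyDensity_eq hφ ht]
    exact hcompact (hcont t ht)
  -- The vanishing integral of `D` identifies half the integrated time derivative with -∫⟨τ₃, V⟩.
  · rw [integral_add hderi hinner, integral_const_mul] at hD0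
    rw [← eq_neg_of_add_eq_zero_left hD0]
    -- The formula for the trienergy is available only for `t` in the interval, which is a
    -- neighbourhood of zero.
    refine (hder.const_mul (1 / 2)).congr_of_eventuallyEq ?_
    filter_upwards [isOpen_Ioo.mem_nhds h0] with t ht using htri t ht
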